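/- Let $M$ be a closed, connected, oriented $3$-manifold (smooth, or just of class $C^1$) and let $\mathcal F$ be a non-singular flow on $M$. A compact subset $P\subset M$ is a \emph{flow-spine} of $(M,\mathcal F)$ if * around each $p\in P$ there is a positive chart $(x,y,z)$ of $M$ centred at $p$ in which $\mathcal F$ is generated by $\partial/\partial z$ and $P$ is one of (i) $\{z=0\}$; (ii) $\{z=0\}\cup\{z=f(x,y)\}$ (a point of a triple line); (iii) $\{z=0\}\cup\{z=f(x,y)\}\cup\{z=-g(x,y)\}$ (a vertex), where $f,g\ge 0$ are $C^1$ functions, $f$ vanishes exactly for $y\le 0$, and $g$ vanishes either exactly for $x\le 0$ (the vertex is of $\ell$-type) or exactly for $x\ge 0$ (the vertex is of $r$-type); * there is a homeomorphism from $M\setminus P$ onto the open unit ball in $\mathbb R^3$ under which the points moving along $\mathcal F$ inside $M\setminus P$ move vertically upwards. It is \emph{positive} if it has at least one vertex and all its vertices are of $\ell$-type. Let $V(P)$ be the set of vertices and $S(P)$ the set of points of $P$ with a chart (ii) or (iii). The \emph{edges} $e_1,\dots,e_m$ of $P$ are the connected components of $S(P)\setminus V(P)$, and the \emph{regions} $R_1,\dots,R_n$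 are the connected components of $P\setminus S(P)$. Orient the regions so that $\mathcal F$ is positively transverse to them, and orient the edges arbitrarily. \textbf{Proposition.} Every positive flow-spine $P$ is admissible: there are real numbers $x_1,\dots,x_m$, assigned to the edges $e_1,\dots,e_m$, such that for every $i\in\{1,\dots,n\}$ $$\sum_{\tilde e_j\subset\partial\bar R_i}\varepsilon_{ij}\,x_j>0 .$$ Here $\bar R_i$ is the completion of $R_i$ with respect to its path metric; the sum runs over all lifts $\tilde e_j$ of edges $e_j$ to $\partial\bar R_i$, that is, over all pairs of an edge $e_j$ and one of the three local sheets of $P$ along $e_j$ that is contained in $R_i$; and $\varepsilon_{ij}=1$ if the orientation of $e_j$ agrees with the boundary orientation induced from this sheet of $R_i$, $\varepsilon_{ij}=-1$ otherwise. -/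

import Mathlib

open scoped Manifold

namespace FlowSpine

/-- Euclidean 3-space; the coordinates of `v` are `x = v 0`, `y = v 1`, `z = v 2`. -/
abbrev E3 : Type := EuclideanSpace ℝ (Fin 3)

/-! ### Oriented 3-manifolds

All charts and sheets below are of class `C¹`; this includes the smooth case. -/

/-- An orientation of a 3-manifold of class `C¹`, given by an oriented `C¹` atlas. -/
structure Orientation3 (M : Type*) [TopologicalSpace M] [ChartedSpace E3 M] where
  /-- the charts of the oriented atlas -/
  charts : Set (OpenPartialHomeomorph M E3)
  subset_maximalAtlas : charts ⊆ IsManifold.maximalAtlas 𝓘(ℝ, E3) 1 M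
  cover : ∀ p : M, ∃ φ ∈ charts, p ∈ φ.source
  compatible : ∀ φ ∈ charts, ∀ ψ ∈ charts, ∀ v ∈ (φ.symm.trans ψ).source,
    0 < (fderiv ℝ (φ.symm.trans ψ) v).det

variable {M : Type*} [TopologicalSpace M] [ChartedSpace E3 M]

/-- The positive charts of an oriented 3-manifold. -/
def Orientation3.IsPositive (o : Orientation3 M) (φ : OpenPartialHomeomorph M E3) : Prop :=
  φ ∈ IsManifold.maximalAtlas 𝓘(ℝ, E3) 1 M ∧
    ∀ ψ ∈ o.charts, ∀ v ∈ (φ.symm.trans ψ).source, 0 < (fderiv ℝ (φ.symm.trans ψ) v).det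

/-! ### Local models of a branched simple polyhedron, transverse to `∂/∂z`

All sheets are graphs over the `(x, y)`-plane. Two sheets merge along a line of that plane; the
difference of their heights is a fold function, which vanishes exactly on the closed side of the
line on which the sheets agree. Being `C¹`, it makes the sheets tangent along the line. -/

/-- `f` is a `C¹` function on the plane, `f ≥ 0`, and `f > 0` exactly on the open half-plane on
which the linear function `c` is positive. -/
def IsFold (c f : ℝ × ℝ → ℝ) : Prop :=
  ContDiff ℝ 1 f ∧ ∀ u, 0 ≤ f u ∧ (f u = 0 ↔ c u ≤ 0)

/-- A smooth point: one horizontal sheet. -/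
def planeModel : Set E3 := {v | v 2 = 0}

/-- A point of a triple line (the `x`-axis): the sheet `z = 0`, and the sheet `z = f(x, y)`,
which lies above it for `y > 0` and agrees with it for `y ≤ 0`. -/
def edgeModel (f : ℝ × ℝ → ℝ) : Set E3 := {v | v 2 = 0 ∨ v 2 = f (v 0, v 1)}

/-- A true vertex: the middle sheet `z = 0`, the top sheet `z = f(x, y)` and the bottom sheet
`z = -g(x, y)`. With `f > 0` exactly for `y > 0`, the top and the middle sheet merge along the
`x`-axis; the bottom and the middle sheet merge along the `y`-axis. -/
def vertexModel (f g : ℝ × ℝ → ℝ) : Set E3 :=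
  {v | v 2 = 0 ∨ v 2 = f (v 0, v 1) ∨ v 2 = -g (v 0, v 1)}

/-- `φ` is a positive chart centred at `p` in which the flow `F` is generated by `∂/∂z` and the
subset `P` is the subset `X` of `ℝ³`. -/
structure IsModelChart (o : Orientation3 M) (F : Flow ℝ M) (P : Set M) (X : Set E3) (p : M)
    (φ : OpenPartialHomeomorph M E3) : Prop where
  positive : o.IsPositive φ
  mem_source : p ∈ φ.source
  map_center : φ p = 0
  mem_iff : ∀ q ∈ φ.source, q ∈ P ↔ φ q ∈ X
  flow_eq : ∀ q ∈ φ.source, ∀ t : ℝ,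
    (∀ s ∈ Set.uIcc 0 t, φ q + !₂[0, 0, s] ∈ φ.target) → F t q = φ.symm (φ q + !₂[0, 0, t])

section Points

variable (o : Orientation3 M) (F : Flow ℝ M) (P : Set M)

/-- `p` is a nonsingular point of `P`. -/
def IsPlanePoint (p : M) : Prop :=
  ∃ φ, IsModelChart o F P planeModel p φ

/-- `φ` is an edge chart at `p`, with fold function `f`. -/
def IsEdgeChart (f : ℝ × ℝ → ℝ) (p : M) (φ : OpenPartialHomeomorph M E3) : Prop :=
  IsFold Prod.snd f ∧ IsModelChart o F P (edgeModel f) p φ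

/-- `p` lies on a triple line of `P`. -/
def IsEdgePoint (p : M) : Prop :=
  ∃ f φ, IsEdgeChart o F P f p φ

/-- `p` is a vertex of `ℓ`-type: the bottom sheet is separate from the middle one for `x > 0`. -/
def IsLVertex (p : M) : Prop :=
  ∃ f g φ, IsFold Prod.snd f ∧ IsFold Prod.fst g ∧ IsModelChart o F P (vertexModel f g) p φ

/-- `p` is a vertex of `r`-type, the mirror image: the bottom sheet is separate from the middle
one for `x < 0`. -/
def IsRVertex (p : M) : Prop :=
  ∃ f g φ, IsFold Prod.snd f ∧ IsFold (fun u => -u.1) g ∧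
    IsModelChart o F P (vertexModel f g) p φ

/-- `V(P)`, the set of true vertices. -/
def vertexSet : Set M := {p | IsLVertex o F P p ∨ IsRVertex o F P p}

/-- `S(P)`, the singular set. -/
def singularSet : Set M := {p | IsEdgePoint o F P p} ∪ vertexSet o F P

end Points

/-! ### Flow-spines -/

/-- The restriction of `F` to the complement of `P` is a constant vertical flow on an open ball:
there is a homeomorphism of the complement onto the open unit ball under which points that
move along `F` inside the complement move vertically upwards. -/
def HasVerticalComplement (F : Flow ℝ M) (P : Set M) : Prop :=
  ∃ ψ : ↥(Pᶜ) ≃ₜ ↥(Metric.ball (0 : E3) 1), ∀ (q q' : ↥(Pᶜ)) (t : ℝ), 0 < t →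
    (∀ s ∈ Set.Icc 0 t, F s q ∈ Pᶜ) → F t q = q' →
      (ψ q' : E3) 0 = (ψ q : E3) 0 ∧ (ψ q' : E3) 1 = (ψ q : E3) 1 ∧
        (ψ q : E3) 2 < (ψ q' : E3) 2

/-- `P` is a flow-spine of the oriented manifold `(M, o)` with the non-singular flow `F`. (It is
a spine since its complement is an open ball.) -/
structure IsFlowSpine (o : Orientation3 M) (F : Flow ℝ M) (P : Set M) : Prop where
  nonsingular : ∀ p : M, ∃ t : ℝ, F t p ≠ p
  compact : IsCompact P
  local_model : ∀ p ∈ P, IsPlanePoint o F P p ∨ IsEdgePoint o F P p ∨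
    IsLVertex o F P p ∨ IsRVertex o F P p
  complement : HasVerticalComplement F P

/-- A flow-spine is positive if it has a vertex and all its vertices are of `ℓ`-type. -/
def IsPositiveSpine (o : Orientation3 M) (F : Flow ℝ M) (P : Set M) : Prop :=
  (vertexSet o F P).Nonempty ∧ ∀ p ∈ vertexSet o F P, IsLVertex o F P p

/-! ### Admissibility -/

/-- The connected components of a subset `A` of `M`. -/
def Components (A : Set M) : Type _ :=
  {C : Set M // ∃ p ∈ A, C = connectedComponentIn A p}

/-- Edges of `P`: the components of `S(P) \ V(P)`. -/
abbrev Edge (o : Orientation3 M) (F : Flow ℝ M) (P : Set M) : Type _ :=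
  Components (singularSet o F P \ vertexSet o F P)

/-- Regions of `P`: the components of `P \ S(P)`. -/
abbrev Region (o : Orientation3 M) (F : Flow ℝ M) (P : Set M) : Type _ :=
  Components (P \ singularSet o F P)

/-- The three sheets of `P` adjacent to an edge: two on one side of it, the upper and the lower
one with respect to the flow, and the single one on the other side. -/
inductive Sheet
  | upper
  | lower
  | single
  deriving DecidableEq

instance : Fintype Sheet where
  elems := {.upper, .lower, .single}
  complete := by intro s; cases s <;> simp

/-- The three sheets in the edge model. -/
def Sheet.model (f : ℝ × ℝ → ℝ) : Sheet → Set E3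
  | .upper => {v | 0 < v 1 ∧ v 2 = f (v 0, v 1)}
  | .lower => {v | 0 < v 1 ∧ v 2 = 0}
  | .single => {v | v 1 < 0 ∧ v 2 = 0}

/-- Regions are oriented so that the flow is positively transverse to them, that is, by `(x, y)`
in a model chart. Then an upper or lower sheet `y > 0` induces the direction `∂/∂x` on its
boundary, and the single sheet `y < 0` induces `-∂/∂x`. -/
def Sheet.sign : Sheet → ℝ
  | .upper => 1
  | .lower => 1
  | .single => -1

/-- The sheet `s` of `P` along the edge `e` belongs to the region `R`. A pair `(e, s)` with this
property is the same thing as a lift of `e` to the boundary of the completion of `R` with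
respect to its path metric: a boundary point of the completion over `p ∈ e` is a local sheet of
`R` at `p`. -/
def LiesIn (o : Orientation3 M) (F : Flow ℝ M) (P : Set M)
    (s : Sheet) (e : Edge o F P) (R : Region o F P) : Prop :=
  ∀ p ∈ e.1, ∃ f φ, IsEdgeChart o F P f p φ ∧ φ.symm '' (φ.target ∩ s.model f) ⊆ R.1

open Classical in
/-- The signed sum, over all lifts of edges to the boundary of the region `R`, of the numbers
`x e`. Here every edge `e` has a fixed orientation, and `η e = 1` if this is the direction
`∂/∂x` in the edge charts along `e`, `η e = -1` if it is the opposite one. -/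
noncomputable def boundarySum (o : Orientation3 M) (F : Flow ℝ M) (P : Set M)
    (η : Edge o F P → ℤˣ) (x : Edge o F P → ℝ) (R : Region o F P) : ℝ :=
  ∑ᶠ e : Edge o F P, ∑ s : Sheet,
    if LiesIn o F P s e R then (((η e : ℤ) : ℝ) * s.sign) * x e else 0

/-- Admissibility: for any choice of orientations of the edges there are real numbers, one for
each edge, whose signed sum around the boundary of each region is positive. (Reversing an edge
amounts to changing the sign of its number, so that the choice does not matter. There are
finitely many edges.) -/
def IsAdmissible (o : Orientation3 M) (F : Flow ℝ M) (P : Set M) : Prop :=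
  ∀ η : Edge o F P → ℤˣ, ∃ x : Edge o F P → ℝ, ∀ R : Region o F P,
    0 < boundarySum o F P η x R

end FlowSpine

namespace FlowSpine

open Set Filter Topology

/-! ### Coordinates -/

/-- The point of Euclidean 3-space with given coordinates. -/
def vec (u : ℝ × ℝ × ℝ) : E3 := !₂[u.1, u.2.1, u.2.2]

@[simp] lemma vec_zero (u : ℝ × ℝ × ℝ) : vec u 0 = u.1 := rfl
@[simp] lemma vec_one (u : ℝ × ℝ × ℝ) : vec u 1 = u.2.1 := rfl
@[simp] lemma vec_two (u : ℝ × ℝ × ℝ) : vec u 2 = u.2.2 := rfl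

/-- Coordinates as a homeomorphism. -/
def vecHomeo : ℝ × ℝ × ℝ ≃ₜ E3 where
  toFun := vec
  invFun v := (v 0, v 1, v 2)
  left_inv u := rfl
  right_inv v := by
    ext i
    fin_cases i <;> rfl
  continuous_toFun := by
    unfold vec
    refine (PiLp.continuous_toLp 2 _).comp (continuous_pi fun i => ?_)
    fin_cases i <;> simp <;> fun_prop
  continuous_invFun := by fun_prop

lemma continuous_vec : Continuous vec := vecHomeo.continuous

lemma vec_injective : Function.Injective vec := vecHomeo.injective

lemma vec_surjective : Function.Surjective vec := vecHomeo.surjective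

lemma vec_add_vertical (x y z t : ℝ) : vec (x, y, z) + !₂[0, 0, t] = vec (x, y, z + t) := by
  ext i
  fin_cases i <;> simp [vec]

/-! ### Box charts -/

variable {M : Type*} [TopologicalSpace M] [ChartedSpace E3 M]

/-- The open box of half-width `r` and half-height `h`. -/
def box (r h : ℝ) : Set (ℝ × ℝ × ℝ) := Ioo (-r) r ×ˢ Ioo (-r) r ×ˢ Ioo (-h) h

lemma mem_box {r h x y z : ℝ} : (x, y, z) ∈ box r h ↔
    (-r < x ∧ x < r) ∧ (-r < y ∧ y < r) ∧ (-h < z ∧ z < h) := by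
  simp [box]

lemma isOpen_box (r h : ℝ) : IsOpen (box r h) :=
  isOpen_Ioo.prod (isOpen_Ioo.prod isOpen_Ioo)

/-- The union of the middle sheet `z = 0`, the top sheet `z = f` and the bottom sheet `z = -g`,
in coordinates. -/
def sheets (f g : ℝ × ℝ → ℝ) (x y z : ℝ) : Prop := z = 0 ∨ z = f (x, y) ∨ z = -g (x, y)

/-- A model chart whose target is a box, with top and bottom sheets that may agree with the
middle one. -/
structure FoldBox (o : Orientation3 M) (F : Flow ℝ M) (P : Set M) (p : M) where
  /-- the underlying chart -/
  chart : OpenPartialHomeomorph M E3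
  /-- the height of the top sheet -/
  f : ℝ × ℝ → ℝ
  /-- the depth of the bottom sheet -/
  g : ℝ × ℝ → ℝ
  /-- the half-width -/
  r : ℝ
  /-- the half-height -/
  h : ℝ
  r_pos : 0 < r
  h_pos : 0 < h
  mem_target : ∀ u, vec u ∈ chart.target ↔ u ∈ box r h
  model : IsModelChart o F P (vertexModel f g) p chart
  f_cases : f = 0 ∨ IsFold Prod.snd f
  g_cases : g = 0 ∨ IsFold Prod.fst g
  g_zero : f = 0 → g = 0
  f_lt : ∀ x y, -r < x → x < r → -r < y → y < r → f (x, y) < h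
  g_lt : ∀ x y, -r < x → x < r → -r < y → y < r → g (x, y) < h

lemma edgeModel_eq (f : ℝ × ℝ → ℝ) : edgeModel f = vertexModel f 0 := by
  ext v
  simp [edgeModel, vertexModel]
  tauto

lemma planeModel_eq : planeModel = vertexModel 0 0 := by
  ext v
  simp [planeModel, vertexModel]

lemma IsFold.apply_zero {c f : ℝ × ℝ → ℝ} (hf : IsFold c f) (hc : c (0, 0) ≤ 0) :
    f (0, 0) = 0 := ((hf.2 _).2).2 hc

lemma Orientation3.IsPositive.restr [IsManifold 𝓘(ℝ, E3) 1 M] {o : Orientation3 M}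
    {φ : OpenPartialHomeomorph M E3} (hφ : o.IsPositive φ) {s : Set M} (hs : IsOpen s) :
    o.IsPositive (φ.restr s) := by
  refine ⟨restr_mem_maximalAtlas (contDiffGroupoid 1 𝓘(ℝ, E3)) hφ.1 hs, fun ψ hψ v hv => ?_⟩
  have hv' : v ∈ (φ.symm.trans ψ).source := by
    simp only [OpenPartialHomeomorph.trans_source, OpenPartialHomeomorph.symm_source,
      OpenPartialHomeomorph.restr_target, mem_inter_iff, mem_preimage] at hv ⊢
    exact ⟨hv.1.1, hv.2⟩
  exact hφ.2 ψ hψ v hv'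

lemma IsModelChart.restr [IsManifold 𝓘(ℝ, E3) 1 M] {o : Orientation3 M} {F : Flow ℝ M}
    {P : Set M} {X : Set E3} {p : M} {φ : OpenPartialHomeomorph M E3}
    (hφ : IsModelChart o F P X p φ) {s : Set M} (hs : IsOpen s) (hp : p ∈ s) :
    IsModelChart o F P X p (φ.restr s) where
  positive := hφ.positive.restr hs
  mem_source := by
    rw [OpenPartialHomeomorph.restr_source, hs.interior_eq]
    exact ⟨hφ.mem_source, hp⟩
  map_center := hφ.map_center
  mem_iff q hq := hφ.mem_iff q (by
    rw [OpenPartialHomeomorph.restr_source] at hq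
    exact hq.1)
  flow_eq q hq t ht := by
    rw [OpenPartialHomeomorph.restr_source] at hq
    refine hφ.flow_eq q hq.1 t fun s' hs' => ?_
    have := ht s' hs'
    rw [OpenPartialHomeomorph.restr_target] at this
    exact this.1

/-- The height is chosen before the width. All sheets have height zero over the origin, so over a
small enough square they do not leave the box through its top or bottom. -/
lemma exists_box_subset {f g : ℝ × ℝ → ℝ} (hf : Continuous f) (hg : Continuous g)
    (hf0 : f (0, 0) = 0) (hg0 : g (0, 0) = 0) {U : Set (ℝ × ℝ × ℝ)} (hU : U ∈ 𝓝 (0, 0, 0)) :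
    ∃ r h : ℝ, 0 < r ∧ 0 < h ∧ box r h ⊆ U ∧
      (∀ x y, -r < x → x < r → -r < y → y < r → f (x, y) < h) ∧
      (∀ x y, -r < x → x < r → -r < y → y < r → g (x, y) < h) := by
  obtain ⟨h, hh, hhU⟩ := Metric.mem_nhds_iff.1 hU
  have hfe : ∀ᶠ u in 𝓝 ((0 : ℝ), (0 : ℝ)), f u < h ∧ g u < h :=
    (hf.continuousAt.eventually_lt continuousAt_const (by simpa [hf0] using hh)).and
      (hg.continuousAt.eventually_lt continuousAt_const (by simpa [hg0] using hh))
  obtain ⟨r, hr, hrf⟩ := Metric.eventually_nhds_iff_ball.1 hfe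
  have key : ∀ x y, -min r h < x → x < min r h → -min r h < y → y < min r h →
      (x, y) ∈ Metric.ball ((0 : ℝ), (0 : ℝ)) r := by
    intro x y h1 h2 h3 h4
    rw [Metric.mem_ball, Prod.dist_eq, max_lt_iff, Real.dist_eq, Real.dist_eq, sub_zero, sub_zero,
      abs_lt, abs_lt]
    have := min_le_left r h
    exact ⟨⟨by linarith, by linarith⟩, by linarith, by linarith⟩
  -- A width of at most `h` places the box in the ball of radius `h` of the sup metric.
  refine ⟨min r h, h, lt_min hr hh, hh, ?_, fun x y h1 h2 h3 h4 => (hrf _ (key x y h1 h2 h3 h4)).1,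
    fun x y h1 h2 h3 h4 => (hrf _ (key x y h1 h2 h3 h4)).2⟩
  rintro ⟨x, y, z⟩ hu
  rw [mem_box] at hu
  apply hhU
  have := min_le_right r h
  rw [Metric.mem_ball, Prod.dist_eq, max_lt_iff, Prod.dist_eq, max_lt_iff, Real.dist_eq,
    Real.dist_eq, Real.dist_eq, sub_zero, sub_zero, sub_zero, abs_lt, abs_lt, abs_lt]
  exact ⟨⟨by linarith [hu.1], by linarith [hu.1]⟩, ⟨by linarith [hu.2.1], by linarith [hu.2.1]⟩,
    hu.2.2⟩

lemma continuous_of_cases {c f : ℝ × ℝ → ℝ} (hf : f = 0 ∨ IsFold c f) : Continuous f := by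
  rcases hf with rfl | hf
  · exact continuous_zero
  · exact hf.1.continuous

/-- A model chart can be cut down to an arbitrarily small box. -/
lemma IsModelChart.exists_foldBox [IsManifold 𝓘(ℝ, E3) 1 M] {o : Orientation3 M} {F : Flow ℝ M}
    {P : Set M} {f g : ℝ × ℝ → ℝ} {p : M} {φ : OpenPartialHomeomorph M E3}
    (hφ : IsModelChart o F P (vertexModel f g) p φ) (hf : f = 0 ∨ IsFold Prod.snd f)
    (hg : g = 0 ∨ IsFold Prod.fst g) (hfg : f = 0 → g = 0) {U : Set M} (hU : U ∈ 𝓝 p) :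
    ∃ B : FoldBox o F P p, B.f = f ∧ B.g = g ∧ B.chart.source ⊆ U ∧
      B.chart.source ⊆ φ.source ∧ ⇑B.chart.symm = φ.symm ∧ B.chart.target ⊆ φ.target := by
  have hp : φ.symm (vec (0, 0, 0)) = p := by
    have : vec (0, 0, 0) = 0 := by
      ext i
      fin_cases i <;> simp [vec]
    rw [this, ← hφ.map_center, φ.left_inv hφ.mem_source]
  have h0 : vec (0, 0, 0) = φ p := by
    rw [hφ.map_center]
    ext i
    fin_cases i <;> simp [vec]
  have ht : φ.target ∈ 𝓝 (vec (0, 0, 0)) := by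
    rw [h0]
    exact φ.open_target.mem_nhds (φ.map_source hφ.mem_source)
  have hn : vec ⁻¹' (φ.target ∩ φ.symm ⁻¹' U) ∈ 𝓝 ((0 : ℝ), (0 : ℝ), (0 : ℝ)) := by
    refine continuous_vec.continuousAt.preimage_mem_nhds (inter_mem ht ?_)
    have : ContinuousAt φ.symm (vec (0, 0, 0)) := by
      rw [h0]
      exact φ.continuousAt_symm (φ.map_source hφ.mem_source)
    exact this.preimage_mem_nhds (by rwa [hp])
  have hf0 : f (0, 0) = 0 := by
    rcases hf with rfl | hf
    · rfl
    · exact hf.apply_zero le_rfl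
  have hg0 : g (0, 0) = 0 := by
    rcases hg with rfl | hg
    · rfl
    · exact hg.apply_zero le_rfl
  obtain ⟨r, h, hr, hh, hb, h1, h2⟩ := exists_box_subset (continuous_of_cases hf)
    (continuous_of_cases hg) hf0 hg0 hn
  have hbt : vec '' box r h ⊆ φ.target := by
    rintro _ ⟨u, hu, rfl⟩
    exact (hb hu).1
  have hbo : IsOpen (vec '' box r h) := vecHomeo.isOpenMap _ (isOpen_box r h)
  have hso : IsOpen (φ.source ∩ φ ⁻¹' (vec '' box r h)) := φ.isOpen_inter_preimage hbo
  have hps : p ∈ φ.source ∩ φ ⁻¹' (vec '' box r h) :=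
    ⟨hφ.mem_source, (0, 0, 0), by simp [mem_box, hr, hh], h0⟩
  refine ⟨⟨φ.restr (φ.source ∩ φ ⁻¹' (vec '' box r h)), f, g, r, h, hr, hh, ?_,
    hφ.restr hso hps, hf, hg, hfg, h1, h2⟩, rfl, rfl, ?_, ?_, rfl, ?_⟩
  · intro u
    rw [OpenPartialHomeomorph.restr_target, hso.interior_eq]
    constructor
    · rintro ⟨hu, -, u', hu', he⟩
      rw [φ.right_inv hu] at he
      exact vec_injective he ▸ hu'
    · intro hu
      have := hbt ⟨u, hu, rfl⟩
      exact ⟨this, φ.map_target this, u, hu, (φ.right_inv this).symm⟩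
  · intro q hq
    simp only [OpenPartialHomeomorph.restr_source, hso.interior_eq] at hq
    obtain ⟨hq, -, u, hu, he⟩ := hq
    have := (hb hu).2
    rw [mem_preimage, he, φ.left_inv hq] at this
    exact this
  · intro q hq
    simp only [OpenPartialHomeomorph.restr_source] at hq
    exact hq.1
  · intro q hq
    simp only [OpenPartialHomeomorph.restr_target] at hq
    exact hq.1

/-! ### Coordinates, flow and sheets in a box -/

namespace FoldBox

variable {o : Orientation3 M} {F : Flow ℝ M} {P : Set M} {p : M} (B : FoldBox o F P p)

/-- The point of `M` with given coordinates in the box. -/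
def pt (u : ℝ × ℝ × ℝ) : M := B.chart.symm (vec u)

lemma pt_mem_source {u : ℝ × ℝ × ℝ} (hu : u ∈ box B.r B.h) : B.pt u ∈ B.chart.source :=
  B.chart.map_target ((B.mem_target u).2 hu)

lemma chart_pt {u : ℝ × ℝ × ℝ} (hu : u ∈ box B.r B.h) : B.chart (B.pt u) = vec u :=
  B.chart.right_inv ((B.mem_target u).2 hu)

lemma pt_inj {u v : ℝ × ℝ × ℝ} (hu : u ∈ box B.r B.h) (hv : v ∈ box B.r B.h)
    (h : B.pt u = B.pt v) : u = v := by
  apply vec_injective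
  rw [← B.chart_pt hu, ← B.chart_pt hv, h]

lemma exists_pt {q : M} (hq : q ∈ B.chart.source) :
    ∃ x y z, (x, y, z) ∈ box B.r B.h ∧ B.pt (x, y, z) = q := by
  obtain ⟨⟨x, y, z⟩, hu⟩ := vec_surjective (B.chart q)
  refine ⟨x, y, z, (B.mem_target _).1 (hu ▸ B.chart.map_source hq), ?_⟩
  rw [pt, hu, B.chart.left_inv hq]

lemma zero_mem : ((0 : ℝ), (0 : ℝ), (0 : ℝ)) ∈ box B.r B.h := by
  simp [mem_box, B.r_pos, B.h_pos]

lemma pt_zero : B.pt (0, 0, 0) = p := by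
  have : vec (0, 0, 0) = B.chart p := by
    rw [B.model.map_center]
    ext i
    fin_cases i <;> simp [vec]
  rw [pt, this, B.chart.left_inv B.model.mem_source]

lemma map_nhds {u : ℝ × ℝ × ℝ} (hu : u ∈ box B.r B.h) : map B.pt (𝓝 u) = 𝓝 (B.pt u) := by
  have h1 : map vec (𝓝 u) = 𝓝 (vec u) := vecHomeo.map_nhds_eq u
  have : B.pt = B.chart.symm ∘ vec := rfl
  rw [this, ← Filter.map_map, h1]
  exact B.chart.symm.map_nhds_eq ((B.mem_target u).2 hu)

lemma eventually_nhds {u : ℝ × ℝ × ℝ} (hu : u ∈ box B.r B.h) {Q : M → Prop} :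
    (∀ᶠ q in 𝓝 (B.pt u), Q q) ↔ ∀ᶠ v in 𝓝 u, v ∈ box B.r B.h ∧ Q (B.pt v) := by
  rw [← B.map_nhds hu, eventually_map]
  constructor
  · intro h
    filter_upwards [h, (isOpen_box _ _).mem_nhds hu] with v h1 h2 using ⟨h2, h1⟩
  · intro h
    filter_upwards [h] with v h1 using h1.2

lemma frequently_nhds {u : ℝ × ℝ × ℝ} (hu : u ∈ box B.r B.h) {Q : M → Prop} :
    (∃ᶠ q in 𝓝 (B.pt u), Q q) ↔ ∃ᶠ v in 𝓝 u, Q (B.pt v) := by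
  rw [← B.map_nhds hu, frequently_map]

lemma continuousAt_pt {u : ℝ × ℝ × ℝ} (hu : u ∈ box B.r B.h) : ContinuousAt B.pt u :=
  (B.map_nhds hu).le

lemma continuousOn_pt : ContinuousOn B.pt (box B.r B.h) :=
  fun _ hu => (B.continuousAt_pt hu).continuousWithinAt

lemma pt_mem_iff {x y z : ℝ} (hu : (x, y, z) ∈ box B.r B.h) :
    B.pt (x, y, z) ∈ P ↔ sheets B.f B.g x y z := by
  rw [B.model.mem_iff _ (B.pt_mem_source hu), B.chart_pt hu]
  rfl

/-- A box is convex in the vertical direction, so the flow segment between two of its points on one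
vertical line never leaves the chart. -/
lemma flow_pt {x y z t : ℝ} (hu : (x, y, z) ∈ box B.r B.h) (ht : (x, y, z + t) ∈ box B.r B.h) :
    F t (B.pt (x, y, z)) = B.pt (x, y, z + t) := by
  rw [B.model.flow_eq _ (B.pt_mem_source hu) t, B.chart_pt hu, vec_add_vertical]
  · rfl
  · intro s hs
    rw [B.chart_pt hu, vec_add_vertical, B.mem_target, mem_box]
    rw [mem_box] at hu ht
    refine ⟨hu.1, hu.2.1, ?_⟩
    rcases le_total 0 t with h | h
    · rw [uIcc_of_le h] at hs
      exact ⟨by linarith [hs.1, hu.2.2.1], by linarith [hs.2, ht.2.2.2]⟩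
    · rw [uIcc_of_ge h] at hs
      exact ⟨by linarith [hs.1, ht.2.2.1], by linarith [hs.2, hu.2.2.2]⟩

lemma continuous_f : Continuous B.f := continuous_of_cases B.f_cases

lemma continuous_g : Continuous B.g := continuous_of_cases B.g_cases

lemma f_nonneg (u : ℝ × ℝ) : 0 ≤ B.f u := by
  rcases B.f_cases with h | h
  · simp [h]
  · exact (h.2 u).1

lemma g_nonneg (u : ℝ × ℝ) : 0 ≤ B.g u := by
  rcases B.g_cases with h | h
  · simp [h]
  · exact (h.2 u).1

lemma f_eq_zero {x y : ℝ} (hy : y ≤ 0) : B.f (x, y) = 0 := by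
  rcases B.f_cases with h | h
  · simp [h]
  · exact ((h.2 _).2).2 hy

lemma g_eq_zero {x y : ℝ} (hx : x ≤ 0) : B.g (x, y) = 0 := by
  rcases B.g_cases with h | h
  · simp [h]
  · exact ((h.2 _).2).2 hx

/-- The box contains an edge along the first axis. -/
def HasF : Prop := IsFold Prod.snd B.f

/-- The box contains an edge along the second axis. -/
def HasG : Prop := IsFold Prod.fst B.g

variable {B}

lemma HasF.pos (hB : B.HasF) {x y : ℝ} (hy : 0 < y) : 0 < B.f (x, y) :=
  lt_of_le_of_ne (hB.2 _).1 fun h => hy.not_ge ((hB.2 _).2.1 h.symm)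

lemma HasG.pos (hB : B.HasG) {x y : ℝ} (hx : 0 < x) : 0 < B.g (x, y) :=
  lt_of_le_of_ne (hB.2 _).1 fun h => hx.not_ge ((hB.2 _).2.1 h.symm)

lemma hasF_of_pos {u : ℝ × ℝ} (h : 0 < B.f u) : B.HasF := by
  rcases B.f_cases with h' | h'
  · simp [h'] at h
  · exact h'

lemma hasG_of_pos {u : ℝ × ℝ} (h : 0 < B.g u) : B.HasG := by
  rcases B.g_cases with h' | h'
  · simp [h'] at h
  · exact h'

lemma pos_of_f_pos {x y : ℝ} (h : 0 < B.f (x, y)) : 0 < y := by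
  by_contra! hy
  rw [B.f_eq_zero hy] at h
  exact h.false

lemma pos_of_g_pos {x y : ℝ} (h : 0 < B.g (x, y)) : 0 < x := by
  by_contra! hy
  rw [B.g_eq_zero hy] at h
  exact h.false

lemma HasG.hasF (hB : B.HasG) : B.HasF := by
  rcases B.f_cases with h' | h'
  · have := hB.pos (x := 1) (y := 0) one_pos
    simp [B.g_zero h'] at this
  · exact h'

end FoldBox

end FlowSpine

namespace FlowSpine

open Set Filter Topology

variable {M : Type*} [TopologicalSpace M] [ChartedSpace E3 M]

/-! ### The singular set in terms of the flow -/

/-- The flow line of `q` meets `P` within time `δ`. -/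
def Up (F : Flow ℝ M) (P : Set M) (δ : ℝ) (q : M) : Prop := ∃ t, 0 < t ∧ t < δ ∧ F t q ∈ P

/-- The backward flow line of `q` meets `P` within time `δ`. -/
def Dn (F : Flow ℝ M) (P : Set M) (δ : ℝ) (q : M) : Prop := ∃ t, 0 < t ∧ t < δ ∧ F (-t) q ∈ P

/-- Points of `P` with two sheets arbitrarily close to each other nearby. -/
def Cusp (F : Flow ℝ M) (P : Set M) (p : M) : Prop :=
  ∀ δ > 0, ∃ᶠ q in 𝓝 p, q ∈ P ∧ Up F P δ q

/-- Points of `P` with three sheets arbitrarily close to each other nearby. -/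
def TriCusp (F : Flow ℝ M) (P : Set M) (p : M) : Prop :=
  ∀ δ > 0, ∃ᶠ q in 𝓝 p, q ∈ P ∧ Up F P δ q ∧ Dn F P δ q

omit [ChartedSpace E3 M] in
lemma TriCusp.cusp {F : Flow ℝ M} {P : Set M} {p : M} (h : TriCusp F P p) : Cusp F P p :=
  fun δ hδ => (h δ hδ).mono fun _ hq => ⟨hq.1, hq.2.1⟩

namespace FoldBox

variable {o : Orientation3 M} {F : Flow ℝ M} {P : Set M} {p : M} (B : FoldBox o F P p)

/-- The bound on `δ` keeps the flow line in the box for all the times in question, so return times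
are differences of heights. -/
lemma up_iff {x y z δ : ℝ} (hu : (x, y, z) ∈ box B.r B.h) (hδ : z + δ ≤ B.h) :
    Up F P δ (B.pt (x, y, z)) ↔ ∃ z', sheets B.f B.g x y z' ∧ z < z' ∧ z' < z + δ := by
  have hm : ∀ t, 0 < t → t < δ → (x, y, z + t) ∈ box B.r B.h := by
    intro t h1 h2
    rw [mem_box] at hu ⊢
    exact ⟨hu.1, hu.2.1, by linarith [hu.2.2.1], by linarith⟩
  constructor
  · rintro ⟨t, h1, h2, h3⟩
    rw [B.flow_pt hu (hm t h1 h2), B.pt_mem_iff (hm t h1 h2)] at h3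
    exact ⟨z + t, h3, by linarith, by linarith⟩
  · rintro ⟨z', h1, h2, h3⟩
    have h4 : 0 < z' - z := by linarith
    have h5 : z' - z < δ := by linarith
    refine ⟨z' - z, h4, h5, ?_⟩
    rw [B.flow_pt hu (hm _ h4 h5), B.pt_mem_iff (hm _ h4 h5)]
    simpa using h1

lemma dn_iff {x y z δ : ℝ} (hu : (x, y, z) ∈ box B.r B.h) (hδ : -B.h ≤ z - δ) :
    Dn F P δ (B.pt (x, y, z)) ↔ ∃ z', sheets B.f B.g x y z' ∧ z - δ < z' ∧ z' < z := by
  have hm : ∀ t, 0 < t → t < δ → (x, y, z + -t) ∈ box B.r B.h := by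
    intro t h1 h2
    rw [mem_box] at hu ⊢
    exact ⟨hu.1, hu.2.1, by linarith, by linarith [hu.2.2.2]⟩
  constructor
  · rintro ⟨t, h1, h2, h3⟩
    rw [B.flow_pt hu (hm t h1 h2), B.pt_mem_iff (hm t h1 h2)] at h3
    exact ⟨z + -t, h3, by linarith, by linarith⟩
  · rintro ⟨z', h1, h2, h3⟩
    have h4 : 0 < z - z' := by linarith
    have h5 : z - z' < δ := by linarith
    refine ⟨z - z', h4, h5, ?_⟩
    rw [B.flow_pt hu (hm _ h4 h5), B.pt_mem_iff (hm _ h4 h5)]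
    simpa using h1

lemma g_eq_zero_of_not (hB : ¬ B.HasG) (u : ℝ × ℝ) : B.g u = 0 := by
  rcases B.g_cases with h | h
  · simp [h]
  · exact (hB h).elim

lemma f_eq_zero_of_not (hB : ¬ B.HasF) (u : ℝ × ℝ) : B.f u = 0 := by
  rcases B.f_cases with h | h
  · simp [h]
  · exact (hB h).elim

lemma tendsto_plane (x y z : ℝ) :
    Tendsto (fun v : ℝ × ℝ × ℝ => (v.1, v.2.1)) (𝓝 (x, y, z)) (𝓝 (x, y)) :=
  (by fun_prop : Continuous fun v : ℝ × ℝ × ℝ => (v.1, v.2.1)).tendsto (x, y, z)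

/-- Away from the fold line the top and the middle sheet either agree locally or keep a positive
distance. Only at the fold line do distinct sheets come arbitrarily close. -/
lemma f_gap {x y : ℝ} (z : ℝ) (h : y ≠ 0 ∨ ¬ B.HasF) :
    ∃ ε > 0, ∀ᶠ v : ℝ × ℝ × ℝ in 𝓝 (x, y, z), B.f (v.1, v.2.1) = 0 ∨ ε ≤ B.f (v.1, v.2.1) := by
  by_cases hB : B.HasF
  · have hy := h.resolve_right (not_not.2 hB)
    rcases lt_or_gt_of_ne hy with hy | hy
    · refine ⟨1, one_pos, ?_⟩
      have : ∀ᶠ v : ℝ × ℝ × ℝ in 𝓝 (x, y, z), v.2.1 < 0 :=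
        (by fun_prop : Continuous fun v : ℝ × ℝ × ℝ => v.2.1).continuousAt.eventually_lt
          continuousAt_const hy
      filter_upwards [this] with v hv using Or.inl (B.f_eq_zero hv.le)
    · have h0 := hB.pos (x := x) hy
      refine ⟨B.f (x, y) / 2, by linarith, ?_⟩
      have : ∀ᶠ v : ℝ × ℝ × ℝ in 𝓝 (x, y, z), B.f (x, y) / 2 < B.f (v.1, v.2.1) :=
        (tendsto_plane x y z).eventually
          (B.continuous_f.continuousAt.eventually_const_lt (by linarith))
      filter_upwards [this] with v hv using Or.inr hv.le
  · exact ⟨1, one_pos, Eventually.of_forall fun v => Or.inl (B.f_eq_zero_of_not hB _)⟩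

lemma g_gap {x y : ℝ} (z : ℝ) (h : x ≠ 0 ∨ ¬ B.HasG) :
    ∃ ε > 0, ∀ᶠ v : ℝ × ℝ × ℝ in 𝓝 (x, y, z), B.g (v.1, v.2.1) = 0 ∨ ε ≤ B.g (v.1, v.2.1) := by
  by_cases hB : B.HasG
  · have hy := h.resolve_right (not_not.2 hB)
    rcases lt_or_gt_of_ne hy with hy | hy
    · refine ⟨1, one_pos, ?_⟩
      have : ∀ᶠ v : ℝ × ℝ × ℝ in 𝓝 (x, y, z), v.1 < 0 :=
        (by fun_prop : Continuous fun v : ℝ × ℝ × ℝ => v.1).continuousAt.eventually_lt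
          continuousAt_const hy
      filter_upwards [this] with v hv using Or.inl (B.g_eq_zero hv.le)
    · have h0 := hB.pos (y := y) hy
      refine ⟨B.g (x, y) / 2, by linarith, ?_⟩
      have : ∀ᶠ v : ℝ × ℝ × ℝ in 𝓝 (x, y, z), B.g (x, y) / 2 < B.g (v.1, v.2.1) :=
        (tendsto_plane x y z).eventually
          (B.continuous_g.continuousAt.eventually_const_lt (by linarith))
      filter_upwards [this] with v hv using Or.inr hv.le
  · exact ⟨1, one_pos, Eventually.of_forall fun v => Or.inl (B.g_eq_zero_of_not hB _)⟩

lemma not_cusp_of {x y z ε : ℝ} (hu : (x, y, z) ∈ box B.r B.h) (hε : 0 < ε)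
    (H : ∀ᶠ v : ℝ × ℝ × ℝ in 𝓝 (x, y, z), ∀ z', sheets B.f B.g v.1 v.2.1 v.2.2 →
      sheets B.f B.g v.1 v.2.1 z' → v.2.2 < z' → v.2.2 + ε ≤ z') :
    ¬ Cusp F P (B.pt (x, y, z)) := by
  have hz := (mem_box.1 hu).2.2.2
  intro hc
  -- The second bound makes flow lines that start near the point stay below the top of the box.
  have hδ : 0 < min ε ((B.h - z) / 2) := lt_min hε (by linarith)
  refine hc _ hδ ?_
  rw [B.eventually_nhds hu]
  have h1 : ∀ᶠ v : ℝ × ℝ × ℝ in 𝓝 (x, y, z), v.2.2 < z + (B.h - z) / 2 :=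
    (by fun_prop : Continuous fun v : ℝ × ℝ × ℝ => v.2.2).continuousAt.eventually_lt
      continuousAt_const (by simp only []; linarith)
  filter_upwards [H, h1, (isOpen_box _ _).mem_nhds hu] with ⟨x', y', z'⟩ h2 h3 h4
  refine ⟨h4, fun ⟨h5, h6⟩ => ?_⟩
  rw [B.pt_mem_iff h4] at h5
  rw [B.up_iff h4 (by have := min_le_right ε ((B.h - z) / 2); simp only [] at h3; linarith)] at h6
  obtain ⟨w, hw1, hw2, hw3⟩ := h6
  have := h2 w h5 hw1 hw2
  have := min_le_left ε ((B.h - z) / 2)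
  simp only [] at *
  linarith

/-- A point with one sheet above it and another below it lies on the middle sheet, between a
separate top and a separate bottom sheet. Both have to be near, and each of the four alternatives
excludes this. -/
lemma not_triCusp_of {x y z ε : ℝ} (hu : (x, y, z) ∈ box B.r B.h) (hε : 0 < ε)
    (H : ∀ᶠ v : ℝ × ℝ × ℝ in 𝓝 (x, y, z), ε ≤ B.f (v.1, v.2.1) ∨ ε ≤ B.g (v.1, v.2.1) ∨
      B.f (v.1, v.2.1) = 0 ∨ B.g (v.1, v.2.1) = 0) :
    ¬ TriCusp F P (B.pt (x, y, z)) := by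
  have hz := (mem_box.1 hu).2.2.2
  have hz' := (mem_box.1 hu).2.2.1
  intro hc
  have hδ : 0 < min ε (min ((B.h - z) / 2) ((B.h + z) / 2)) :=
    lt_min hε (lt_min (by linarith) (by linarith))
  refine hc _ hδ ?_
  rw [B.eventually_nhds hu]
  have h1 : ∀ᶠ v : ℝ × ℝ × ℝ in 𝓝 (x, y, z), v.2.2 < z + (B.h - z) / 2 :=
    (by fun_prop : Continuous fun v : ℝ × ℝ × ℝ => v.2.2).continuousAt.eventually_lt
      continuousAt_const (by simp only []; linarith)
  have h1' : ∀ᶠ v : ℝ × ℝ × ℝ in 𝓝 (x, y, z), z - (B.h + z) / 2 < v.2.2 :=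
    (by fun_prop : Continuous fun v : ℝ × ℝ × ℝ => v.2.2).continuousAt.eventually_const_lt
      (by simp only []; linarith)
  filter_upwards [H, h1, h1', (isOpen_box _ _).mem_nhds hu] with ⟨x', y', z'⟩ h2 h3 h3' h4
  refine ⟨h4, fun ⟨h5, h6, h7⟩ => ?_⟩
  rw [B.pt_mem_iff h4] at h5
  have e1 := min_le_left ε (min ((B.h - z) / 2) ((B.h + z) / 2))
  have e2 := min_le_right ε (min ((B.h - z) / 2) ((B.h + z) / 2))
  have e3 := min_le_left ((B.h - z) / 2) ((B.h + z) / 2)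
  have e4 := min_le_right ((B.h - z) / 2) ((B.h + z) / 2)
  simp only [] at h2 h3 h3'
  rw [B.up_iff h4 (by linarith)] at h6
  rw [B.dn_iff h4 (by linarith)] at h7
  obtain ⟨w, hw1, hw2, hw3⟩ := h6
  obtain ⟨w', hw1', hw2', hw3'⟩ := h7
  have hf := B.f_nonneg (x', y')
  have hg := B.g_nonneg (x', y')
  unfold sheets at h5 hw1 hw1'
  rcases h5 with h5 | h5 | h5 <;> rcases hw1 with hw1 | hw1 | hw1 <;>
    rcases hw1' with hw1' | hw1' | hw1' <;> rcases h2 with h2 | h2 | h2 | h2 <;> linarith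

lemma frequently_of_path {u : ℝ × ℝ × ℝ} (hu : u ∈ box B.r B.h) {Q : M → Prop}
    {c : ℝ → ℝ × ℝ × ℝ} (hc : Tendsto c (𝓝[>] 0) (𝓝 u)) (H : ∀ᶠ s in 𝓝[>] 0, Q (B.pt (c s))) :
    ∃ᶠ q in 𝓝 (B.pt u), Q q := by
  rw [B.frequently_nhds hu]
  exact hc.frequently H.frequently

variable {B}

/-- Vertical distances between sheets are small near the axes. -/
lemma eventually_small {u v : ℝ × ℝ × ℝ} {δ : ℝ} (hδ : 0 < δ) {k : ℝ × ℝ × ℝ → ℝ}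
    (hk : Continuous k) (hu : k u = 0) :
    ∀ᶠ s : ℝ in 𝓝[>] 0, k (u + s • v) < δ := by
  have : Continuous fun s : ℝ => k (u + s • v) := by fun_prop
  exact (this.continuousAt.eventually_lt continuousAt_const (by simpa [hu] using hδ)).filter_mono
    nhdsWithin_le_nhds

lemma tendsto_line (u v : ℝ × ℝ × ℝ) :
    Tendsto (fun s : ℝ => u + s • v) (𝓝[>] 0) (𝓝 u) := by
  have : Continuous fun s : ℝ => u + s • v := by fun_prop
  have h := this.tendsto 0
  simp only [zero_smul, add_zero] at h
  exact h.mono_left nhdsWithin_le_nhds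

lemma eventually_mem_line {u : ℝ × ℝ × ℝ} {r h : ℝ} (hu : u ∈ box r h) (v : ℝ × ℝ × ℝ) :
    ∀ᶠ s : ℝ in 𝓝[>] 0, u + s • v ∈ box r h :=
  (tendsto_line u v).eventually ((isOpen_box r h).mem_nhds hu)

/-- Approach along the middle sheet on the side `y > 0`, where the top sheet lies at the small
height `f`. -/
lemma cusp_of_hasF (hB : B.HasF) {x : ℝ} (hu : (x, 0, 0) ∈ box B.r B.h) :
    Cusp F P (B.pt (x, 0, 0)) := by
  intro δ hδ
  refine B.frequently_of_path hu (tendsto_line _ (0, 1, 0)) ?_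
  have h1 := eventually_small (u := (x, 0, 0)) (v := (0, 1, 0)) (lt_min hδ B.h_pos)
    (k := fun v => B.f (v.1, v.2.1))
    (B.continuous_f.comp (by fun_prop)) (B.f_eq_zero le_rfl)
  filter_upwards [h1, eventually_mem_line hu (0, 1, 0), self_mem_nhdsWithin] with s h2 h3 h4
  simp only [Prod.smul_mk, smul_eq_mul, mul_zero, mul_one, Prod.mk_add_mk, zero_add,
    add_zero] at h2 h3 ⊢
  refine ⟨(B.pt_mem_iff h3).2 (Or.inl rfl), ?_⟩
  obtain ⟨t, ht1, ht2, ht3⟩ := (B.up_iff (δ := min δ B.h) h3 (by simp)).2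
    ⟨B.f (x, s), Or.inr (Or.inl rfl), hB.pos h4, by simpa using h2⟩
  exact ⟨t, ht1, ht2.trans_le (min_le_left _ _), ht3⟩

/-- `Cusp` looks forward along the flow, so the approach is along the bottom sheet: the middle sheet
is the one just above it. -/
lemma cusp_of_hasG (hB : B.HasG) {y : ℝ} (hu : (0, y, 0) ∈ box B.r B.h) :
    Cusp F P (B.pt (0, y, 0)) := by
  intro δ hδ
  have hc : Continuous fun s : ℝ => (s, y, -B.g (s, y)) := by
    have := B.continuous_g
    fun_prop
  have hc0 := hc.tendsto 0
  simp only [B.g_eq_zero (y := y) le_rfl, neg_zero] at hc0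
  refine B.frequently_of_path hu (hc0.mono_left nhdsWithin_le_nhds) ?_
  have h1 := eventually_small (u := (0, y, 0)) (v := (1, 0, 0)) (lt_min hδ B.h_pos)
    (k := fun v => B.g (v.1, v.2.1))
    (B.continuous_g.comp (by fun_prop)) (B.g_eq_zero le_rfl)
  have h3' : ∀ᶠ s : ℝ in 𝓝[>] 0, (s, y, -B.g (s, y)) ∈ box B.r B.h :=
    (hc0.mono_left nhdsWithin_le_nhds).eventually ((isOpen_box B.r B.h).mem_nhds hu)
  filter_upwards [h1, h3', self_mem_nhdsWithin] with s h2 h3 h4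
  simp only [Prod.smul_mk, smul_eq_mul, mul_zero, mul_one, Prod.mk_add_mk, zero_add,
    add_zero, lt_min_iff] at h2
  refine ⟨(B.pt_mem_iff h3).2 (Or.inr (Or.inr rfl)), ?_⟩
  have h5 := hB.pos (y := y) h4
  obtain ⟨t, ht1, ht2, ht3⟩ := (B.up_iff (δ := min δ B.h) h3
    (by have := min_le_right δ B.h; linarith)).2
    ⟨0, Or.inl rfl, by linarith, by have := lt_min h2.1 h2.2; linarith⟩
  exact ⟨t, ht1, ht2.trans_le (min_le_left _ _), ht3⟩

/-- On the diagonal of the quadrant `x, y > 0` all three sheets are separate, and both distances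
tend to zero at the origin. -/
lemma triCusp_of_hasG (hB : B.HasG) : TriCusp F P p := by
  rw [← B.pt_zero]
  intro δ hδ
  refine B.frequently_of_path B.zero_mem (tendsto_line _ (1, 1, 0)) ?_
  have h1 := eventually_small (u := (0, 0, 0)) (v := (1, 1, 0)) (lt_min hδ B.h_pos)
    (k := fun v => B.g (v.1, v.2.1))
    (B.continuous_g.comp (by fun_prop)) (B.g_eq_zero le_rfl)
  have h2 := eventually_small (u := (0, 0, 0)) (v := (1, 1, 0)) (lt_min hδ B.h_pos)
    (k := fun v => B.f (v.1, v.2.1))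
    (B.continuous_f.comp (by fun_prop)) (B.f_eq_zero le_rfl)
  filter_upwards [h1, h2, eventually_mem_line B.zero_mem (1, 1, 0), self_mem_nhdsWithin]
    with s h1 h2 h3 h4
  simp only [Prod.smul_mk, smul_eq_mul, mul_zero, mul_one, Prod.mk_add_mk, zero_add,
    add_zero, lt_min_iff] at h1 h2 h3 ⊢
  have h5 := hB.pos (y := s) h4
  have h6 := hB.hasF.pos (x := s) h4
  refine ⟨(B.pt_mem_iff h3).2 (Or.inl rfl), ?_, ?_⟩
  · obtain ⟨t, ht1, ht2, ht3⟩ := (B.up_iff (δ := min δ B.h) h3 (by simp)).2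
      ⟨B.f (s, s), Or.inr (Or.inl rfl), h6, by simpa using h2⟩
    exact ⟨t, ht1, ht2.trans_le (min_le_left _ _), ht3⟩
  · obtain ⟨t, ht1, ht2, ht3⟩ := (B.dn_iff (δ := min δ B.h) h3 (by simp)).2
      ⟨-B.g (s, s), Or.inr (Or.inr rfl), by have := lt_min h1.1 h1.2; linarith, by linarith⟩
    exact ⟨t, ht1, ht2.trans_le (min_le_left _ _), ht3⟩

/-- Off the height zero only one sheet passes near the point, with no other sheet closely above it.
At height zero both fold functions have a gap unless the point is on one of the axes that carry an
edge. -/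
lemma cusp_iff {x y z : ℝ} (hu : (x, y, z) ∈ box B.r B.h) :
    B.pt (x, y, z) ∈ P ∧ Cusp F P (B.pt (x, y, z)) ↔
      z = 0 ∧ ((y = 0 ∧ B.HasF) ∨ (x = 0 ∧ B.HasG)) := by
  constructor
  · rintro ⟨h1, h2⟩
    rcases lt_trichotomy z 0 with hz | hz | hz
    · exfalso
      refine B.not_cusp_of hu (ε := -z / 2) (by linarith) ?_ h2
      have : ∀ᶠ v : ℝ × ℝ × ℝ in 𝓝 (x, y, z), v.2.2 < z / 2 :=
        (by fun_prop : Continuous fun v : ℝ × ℝ × ℝ => v.2.2).continuousAt.eventually_lt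
          continuousAt_const (by simp only []; linarith)
      filter_upwards [this] with v hv z' h3 h4 h5
      have hf := B.f_nonneg (v.1, v.2.1)
      have hg := B.g_nonneg (v.1, v.2.1)
      unfold sheets at h3 h4
      rcases h3 with h3 | h3 | h3 <;> rcases h4 with h4 | h4 | h4 <;> linarith
    · refine ⟨hz, ?_⟩
      by_contra! hne
      obtain ⟨ε, hε, h3⟩ := B.f_gap (x := x) (y := y) z (by
        by_cases hy : y = 0
        · exact Or.inr (hne.1 hy)
        · exact Or.inl hy)
      obtain ⟨ε', hε', h4⟩ := B.g_gap (x := x) (y := y) z (by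
        by_cases hx : x = 0
        · exact Or.inr (hne.2 hx)
        · exact Or.inl hx)
      refine B.not_cusp_of hu (lt_min hε hε') ?_ h2
      filter_upwards [h3, h4] with v h3 h4 z' h5 h6 h7
      have hf := B.f_nonneg (v.1, v.2.1)
      have hg := B.g_nonneg (v.1, v.2.1)
      have e1 := min_le_left ε ε'
      have e2 := min_le_right ε ε'
      unfold sheets at h5 h6
      rcases h5 with h5 | h5 | h5 <;> rcases h6 with h6 | h6 | h6 <;> rcases h3 with h3 | h3 <;>
        rcases h4 with h4 | h4 <;> linarith
    · exfalso
      refine B.not_cusp_of hu (ε := 1) one_pos ?_ h2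
      have : ∀ᶠ v : ℝ × ℝ × ℝ in 𝓝 (x, y, z), 0 < v.2.2 :=
        (by fun_prop : Continuous fun v : ℝ × ℝ × ℝ => v.2.2).continuousAt.eventually_const_lt hz
      filter_upwards [this] with v hv z' h3 h4 h5
      have hf := B.f_nonneg (v.1, v.2.1)
      have hg := B.g_nonneg (v.1, v.2.1)
      unfold sheets at h3 h4
      rcases h3 with h3 | h3 | h3 <;> rcases h4 with h4 | h4 | h4 <;> linarith
  · rintro ⟨rfl, ⟨rfl, h⟩ | ⟨rfl, h⟩⟩
    · exact ⟨(B.pt_mem_iff hu).2 (Or.inl rfl), cusp_of_hasF h hu⟩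
    · exact ⟨(B.pt_mem_iff hu).2 (Or.inl rfl), cusp_of_hasG h hu⟩

/-- Away from the centre of a vertex box at least one of the two fold functions has a gap. -/
lemma triCusp_iff {x y z : ℝ} (hu : (x, y, z) ∈ box B.r B.h) :
    B.pt (x, y, z) ∈ P ∧ TriCusp F P (B.pt (x, y, z)) ↔ B.HasG ∧ x = 0 ∧ y = 0 ∧ z = 0 := by
  constructor
  · rintro ⟨h1, h2⟩
    obtain ⟨hz, -⟩ := (cusp_iff hu).1 ⟨h1, h2.cusp⟩
    by_contra! hne
    by_cases hy : y = 0
    · obtain ⟨ε, hε, h3⟩ := B.g_gap (x := x) (y := y) z (by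
        by_contra! h
        exact hne h.2 h.1 hy hz)
      exact B.not_triCusp_of hu hε (h3.mono fun v hv => by tauto) h2
    · obtain ⟨ε, hε, h3⟩ := B.f_gap (x := x) (y := y) z (Or.inl hy)
      exact B.not_triCusp_of hu hε (h3.mono fun v hv => by tauto) h2
  · rintro ⟨h, rfl, rfl, rfl⟩
    refine ⟨(B.pt_mem_iff hu).2 (Or.inl rfl), ?_⟩
    rw [B.pt_zero]
    exact triCusp_of_hasG h

end FoldBox

/-! ### Vertices and singular points in terms of return times -/

variable [IsManifold 𝓘(ℝ, E3) 1 M] {o : Orientation3 M} {F : Flow ℝ M} {P : Set M} {p : M}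

lemma IsFold.ne_zero_snd {f : ℝ × ℝ → ℝ} (hf : IsFold Prod.snd f) : f ≠ 0 := by
  rintro rfl
  have := ((hf.2 (0, 1)).2).1 rfl
  norm_num at this

lemma IsFold.ne_zero_fst {f : ℝ × ℝ → ℝ} (hf : IsFold Prod.fst f) : f ≠ 0 := by
  rintro rfl
  have := ((hf.2 (1, 0)).2).1 rfl
  norm_num at this

lemma IsPlanePoint.exists_foldBox (hp : IsPlanePoint o F P p) {U : Set M} (hU : U ∈ 𝓝 p) :
    ∃ B : FoldBox o F P p, ¬ B.HasF ∧ ¬ B.HasG ∧ B.chart.source ⊆ U := by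
  obtain ⟨φ, hφ⟩ := hp
  rw [planeModel_eq] at hφ
  obtain ⟨B, h1, h2, h3, -⟩ := hφ.exists_foldBox (Or.inl rfl) (Or.inl rfl) (fun _ => rfl) hU
  exact ⟨B, fun h => h.ne_zero_snd h1, fun h => h.ne_zero_fst h2, h3⟩

lemma IsEdgePoint.exists_foldBox (hp : IsEdgePoint o F P p) {U : Set M} (hU : U ∈ 𝓝 p) :
    ∃ B : FoldBox o F P p, B.HasF ∧ ¬ B.HasG ∧ B.chart.source ⊆ U := by
  obtain ⟨f, φ, hf, hφ⟩ := hp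
  rw [edgeModel_eq] at hφ
  obtain ⟨B, h1, h2, h3, -⟩ := hφ.exists_foldBox (Or.inr hf) (Or.inl rfl) (fun _ => rfl) hU
  exact ⟨B, by rw [FoldBox.HasF, h1]; exact hf, fun h => h.ne_zero_fst h2, h3⟩

lemma IsLVertex.exists_foldBox (hp : IsLVertex o F P p) {U : Set M} (hU : U ∈ 𝓝 p) :
    ∃ B : FoldBox o F P p, B.HasF ∧ B.HasG ∧ B.chart.source ⊆ U := by
  obtain ⟨f, g, φ, hf, hg, hφ⟩ := hp
  obtain ⟨B, h1, h2, h3, -⟩ := hφ.exists_foldBox (Or.inr hf) (Or.inr hg)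
    (fun h => (hf.ne_zero_snd h).elim) hU
  exact ⟨B, by rw [FoldBox.HasF, h1]; exact hf, by rw [FoldBox.HasG, h2]; exact hg, h3⟩

omit [IsManifold 𝓘(ℝ, E3) 1 M] in
lemma isLVertex_iff (hpos : IsPositiveSpine o F P) : IsLVertex o F P p ↔ p ∈ vertexSet o F P :=
  ⟨Or.inl, hpos.2 p⟩

omit [IsManifold 𝓘(ℝ, E3) 1 M] in
lemma local_cases (hP : IsFlowSpine o F P) (hpos : IsPositiveSpine o F P) (hp : p ∈ P) :
    IsPlanePoint o F P p ∨ IsEdgePoint o F P p ∨ IsLVertex o F P p := by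
  rcases hP.local_model p hp with h | h | h | h
  · exact Or.inl h
  · exact Or.inr (Or.inl h)
  · exact Or.inr (Or.inr h)
  · exact Or.inr (Or.inr (hpos.2 p (Or.inr h)))

lemma exists_foldBox (hP : IsFlowSpine o F P) (hpos : IsPositiveSpine o F P) (hp : p ∈ P)
    {U : Set M} (hU : U ∈ 𝓝 p) : ∃ B : FoldBox o F P p, B.chart.source ⊆ U := by
  rcases local_cases hP hpos hp with h | h | h
  · obtain ⟨B, -, -, h⟩ := h.exists_foldBox hU
    exact ⟨B, h⟩
  · obtain ⟨B, -, -, h⟩ := h.exists_foldBox hU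
    exact ⟨B, h⟩
  · obtain ⟨B, -, -, h⟩ := h.exists_foldBox hU
    exact ⟨B, h⟩

omit [IsManifold 𝓘(ℝ, E3) 1 M] in
lemma FoldBox.center_mem (B : FoldBox o F P p) : p ∈ P := by
  have := (B.pt_mem_iff B.zero_mem).2 (Or.inl rfl)
  rwa [B.pt_zero] at this

omit [IsManifold 𝓘(ℝ, E3) 1 M] in
lemma FoldBox.center_cusp_iff (B : FoldBox o F P p) : Cusp F P p ↔ B.HasF := by
  have h := FoldBox.cusp_iff B.zero_mem
  rw [B.pt_zero] at h
  constructor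
  · intro h'
    have := (h.1 ⟨B.center_mem, h'⟩).2
    rcases this with h | h
    · exact h.2
    · exact FoldBox.HasG.hasF h.2
  · intro h'
    exact (h.2 ⟨rfl, Or.inl ⟨rfl, h'⟩⟩).2

omit [IsManifold 𝓘(ℝ, E3) 1 M] in
lemma FoldBox.center_triCusp_iff (B : FoldBox o F P p) : TriCusp F P p ↔ B.HasG := by
  have h := FoldBox.triCusp_iff B.zero_mem
  rw [B.pt_zero] at h
  exact ⟨fun h' => (h.1 ⟨B.center_mem, h'⟩).1, fun h' => (h.2 ⟨h', rfl, rfl, rfl⟩).2⟩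

/-- Being a vertex is defined by the existence of some chart. This criterion has no chart in it, so
a single box around a point decides the kind of all points in the box. -/
lemma mem_vertexSet_iff (hP : IsFlowSpine o F P) (hpos : IsPositiveSpine o F P) :
    p ∈ vertexSet o F P ↔ p ∈ P ∧ TriCusp F P p := by
  rw [← isLVertex_iff hpos]
  constructor
  · intro h
    obtain ⟨B, -, h, -⟩ := h.exists_foldBox univ_mem
    exact ⟨B.center_mem, B.center_triCusp_iff.2 h⟩
  · rintro ⟨h1, h2⟩
    rcases local_cases hP hpos h1 with h | h | h
    · obtain ⟨B, -, h, -⟩ := h.exists_foldBox univ_mem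
      exact (h (B.center_triCusp_iff.1 h2)).elim
    · obtain ⟨B, -, h, -⟩ := h.exists_foldBox univ_mem
      exact (h (B.center_triCusp_iff.1 h2)).elim
    · exact h

lemma mem_singularSet_iff (hP : IsFlowSpine o F P) (hpos : IsPositiveSpine o F P) :
    p ∈ singularSet o F P ↔ p ∈ P ∧ Cusp F P p := by
  constructor
  · rintro (h | h)
    · obtain ⟨B, h, -⟩ := IsEdgePoint.exists_foldBox h univ_mem
      exact ⟨B.center_mem, B.center_cusp_iff.2 h⟩
    · have h' := (mem_vertexSet_iff hP hpos).1 h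
      exact ⟨h'.1, h'.2.cusp⟩
  · rintro ⟨h1, h2⟩
    rcases local_cases hP hpos h1 with h | h | h
    · obtain ⟨B, h, -⟩ := h.exists_foldBox univ_mem
      exact (h (B.center_cusp_iff.1 h2)).elim
    · exact Or.inl h
    · exact Or.inr ((isLVertex_iff hpos).1 h)

lemma singularSet_subset (hP : IsFlowSpine o F P) (hpos : IsPositiveSpine o F P) :
    singularSet o F P ⊆ P := fun _ h => ((mem_singularSet_iff hP hpos).1 h).1

namespace FoldBox

variable {B : FoldBox o F P p}

lemma pt_mem_singularSet (hP : IsFlowSpine o F P) (hpos : IsPositiveSpine o F P)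
    {x y z : ℝ} (hu : (x, y, z) ∈ box B.r B.h) :
    B.pt (x, y, z) ∈ singularSet o F P ↔ z = 0 ∧ ((y = 0 ∧ B.HasF) ∨ (x = 0 ∧ B.HasG)) := by
  rw [mem_singularSet_iff hP hpos, cusp_iff hu]

lemma pt_mem_vertexSet (hP : IsFlowSpine o F P) (hpos : IsPositiveSpine o F P)
    {x y z : ℝ} (hu : (x, y, z) ∈ box B.r B.h) :
    B.pt (x, y, z) ∈ vertexSet o F P ↔ B.HasG ∧ x = 0 ∧ y = 0 ∧ z = 0 := by
  rw [mem_vertexSet_iff hP hpos, triCusp_iff hu]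

lemma hasF_iff (hP : IsFlowSpine o F P) (hpos : IsPositiveSpine o F P)
    (B : FoldBox o F P p) : B.HasF ↔ p ∈ singularSet o F P := by
  rw [mem_singularSet_iff hP hpos, ← B.center_cusp_iff, and_iff_right B.center_mem]

lemma hasG_iff (hP : IsFlowSpine o F P) (hpos : IsPositiveSpine o F P)
    (B : FoldBox o F P p) : B.HasG ↔ p ∈ vertexSet o F P := by
  rw [mem_vertexSet_iff hP hpos, ← B.center_triCusp_iff, and_iff_right B.center_mem]

end FoldBox

end FlowSpine

namespace FlowSpine

open Set Filter Topology

/-- A locally constant function is constant on preconnected sets. -/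
lemma eq_of_isPreconnected {X Y : Type*} [TopologicalSpace X] {s : Set X} (hs : IsPreconnected s)
    {f : X → Y} (h : ∀ x ∈ s, ∀ᶠ y in 𝓝[s] x, f y = f x) {x y : X} (hx : x ∈ s) (hy : y ∈ s) :
    f x = f y := by
  let : TopologicalSpace Y := ⊥
  have : DiscreteTopology Y := ⟨rfl⟩
  refine hs.constant (f := f) (fun x hx => ?_) hx hy
  exact (tendsto_pure.2 (h x hx)).mono_right (pure_le_nhds _)

variable {M : Type*} [TopologicalSpace M] [ChartedSpace E3 M]

/-! ### Local sheets along the edges -/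

/-- The position of a point near a triple line among the three sheets, in terms of the flow. -/
def HasType (F : Flow ℝ M) (P : Set M) (δ : ℝ) (q : M) : Sheet → Prop
  | .upper => Dn F P δ q
  | .lower => Up F P δ q
  | .single => ¬ Up F P δ q ∧ ¬ Dn F P δ q

/-- The point `p` is in the closure of the part of `A` which is in position `s`. -/
def Adj (F : Flow ℝ M) (P : Set M) (s : Sheet) (p : M) (A : Set M) : Prop :=
  ∃ δ₀ > 0, ∀ δ, 0 < δ → δ < δ₀ → ∃ᶠ q in 𝓝 p, q ∈ A ∧ HasType F P δ q s

omit [ChartedSpace E3 M] in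
lemma Adj.mono {F : Flow ℝ M} {P : Set M} {s : Sheet} {p : M} {A A' : Set M}
    (h : Adj F P s p A) (hA : A ⊆ A') : Adj F P s p A' := by
  obtain ⟨δ₀, h0, h⟩ := h
  exact ⟨δ₀, h0, fun δ h1 h2 => (h δ h1 h2).mono fun q hq => ⟨hA hq.1, hq.2⟩⟩

variable (o : Orientation3 M) (F : Flow ℝ M) (P : Set M)

/-- The nonsingular points of `P`. -/
def regular : Set M := P \ singularSet o F P

/-- The component of a nonsingular point. -/
def comp (q : M) : Set M := connectedComponentIn (regular o F P) q

/-- The union of the regions which contain the sheet `s` at `p`. -/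
def reg (s : Sheet) (p : M) : Set M := {q | q ∈ regular o F P ∧ Adj F P s p (comp o F P q)}

variable {o F P}

lemma comp_eq_of_mem {A : Set M} (hA : IsPreconnected A) (hAP : A ⊆ regular o F P) {q q' : M}
    (hq : q ∈ A) (hq' : q' ∈ A) : comp o F P q = comp o F P q' :=
  connectedComponentIn_eq (hA.subset_connectedComponentIn hq hAP hq')

namespace FoldBox

variable {p : M} (B : FoldBox o F P p)

/-- The graph of `k` over a rectangle, in box coordinates. -/
def graph (k : ℝ × ℝ → ℝ) (a b c d : ℝ) : Set M :=
  (fun w : ℝ × ℝ => B.pt (w.1, w.2, k w)) '' (Ioo a b ×ˢ Ioo c d)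

variable {B}

lemma mem_graph {k : ℝ × ℝ → ℝ} {a b c d x y : ℝ} (h1 : a < x) (h2 : x < b) (h3 : c < y)
    (h4 : y < d) : B.pt (x, y, k (x, y)) ∈ B.graph k a b c d :=
  ⟨(x, y), ⟨⟨h1, h2⟩, h3, h4⟩, rfl⟩

lemma isPreconnected_graph {k : ℝ × ℝ → ℝ} (hk : Continuous k) {a b c d : ℝ} (ha : -B.r ≤ a)
    (hb : b ≤ B.r) (hc : -B.r ≤ c) (hd : d ≤ B.r)
    (hkh : ∀ x y, -B.r < x → x < B.r → -B.r < y → y < B.r → -B.h < k (x, y) ∧ k (x, y) < B.h) :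
    IsPreconnected (B.graph k a b c d) := by
  refine (isPreconnected_Ioo.prod isPreconnected_Ioo).image _ ?_
  refine B.continuousOn_pt.comp (by fun_prop) ?_
  rintro ⟨x, y⟩ ⟨⟨h1, h2⟩, h3, h4⟩
  rw [mem_box]
  exact ⟨⟨ha.trans_lt h1, h2.trans_le hb⟩, ⟨hc.trans_lt h3, h4.trans_le hd⟩,
    hkh x y (ha.trans_lt h1) (h2.trans_le hb) (hc.trans_lt h3) (h4.trans_le hd)⟩

lemma f_range (x y : ℝ) (h1 : -B.r < x) (h2 : x < B.r) (h3 : -B.r < y) (h4 : y < B.r) :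
    -B.h < B.f (x, y) ∧ B.f (x, y) < B.h :=
  ⟨by linarith [B.f_nonneg (x, y), B.h_pos], B.f_lt x y h1 h2 h3 h4⟩

lemma g_range (x y : ℝ) (h1 : -B.r < x) (h2 : x < B.r) (h3 : -B.r < y) (h4 : y < B.r) :
    -B.h < (-B.g) (x, y) ∧ (-B.g) (x, y) < B.h :=
  ⟨by simpa using B.g_lt x y h1 h2 h3 h4,
    by simp only [Pi.neg_apply]; linarith [B.g_nonneg (x, y), B.h_pos]⟩

lemma zero_range (x y : ℝ) (_ : -B.r < x) (_ : x < B.r) (_ : -B.r < y) (_ : y < B.r) :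
    -B.h < (0 : ℝ × ℝ → ℝ) (x, y) ∧ (0 : ℝ × ℝ → ℝ) (x, y) < B.h := by
  simp [B.h_pos]

variable (B)

/-- The top sheet. -/
def top : Set M := B.graph B.f (-B.r) B.r 0 B.r

/-- The bottom sheet. -/
def bot : Set M := B.graph (-B.g) 0 B.r (-B.r) B.r

/-- The middle sheet over a rectangle. -/
def mid (a b c d : ℝ) : Set M := B.graph 0 a b c d

/-- The sheets of an edge box. -/
def edgeSheet : Sheet → Set M
  | .upper => B.top
  | .lower => B.mid (-B.r) B.r 0 B.r
  | .single => B.mid (-B.r) B.r (-B.r) 0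

lemma isPreconnected_top : IsPreconnected B.top := by
  have := B.r_pos
  exact isPreconnected_graph B.continuous_f (by linarith) (by linarith) (by linarith)
    (by linarith) f_range

lemma isPreconnected_bot : IsPreconnected B.bot := by
  have := B.r_pos
  exact isPreconnected_graph B.continuous_g.neg (by linarith) (by linarith) (by linarith)
    (by linarith) g_range

lemma isPreconnected_mid {a b c d : ℝ} (ha : -B.r ≤ a)
    (hb : b ≤ B.r) (hc : -B.r ≤ c) (hd : d ≤ B.r) : IsPreconnected (B.mid a b c d) :=
  isPreconnected_graph continuous_zero ha hb hc hd zero_range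

lemma isPreconnected_edgeSheet (s : Sheet) : IsPreconnected (B.edgeSheet s) := by
  have := B.r_pos
  cases s
  · exact B.isPreconnected_top
  · exact B.isPreconnected_mid (by linarith) (by linarith) (by linarith) (by linarith)
  · exact B.isPreconnected_mid (by linarith) (by linarith) (by linarith) (by linarith)

lemma mem_box_zero {x y : ℝ} (h1 : -B.r < x) (h2 : x < B.r) (h3 : -B.r < y) (h4 : y < B.r) :
    (x, y, 0) ∈ box B.r B.h := by
  have := B.h_pos
  rw [mem_box]
  exact ⟨⟨h1, h2⟩, ⟨h3, h4⟩, by linarith, this⟩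

lemma mem_box_f {x y : ℝ} (h1 : -B.r < x) (h2 : x < B.r) (h3 : -B.r < y) (h4 : y < B.r) :
    (x, y, B.f (x, y)) ∈ box B.r B.h := by
  rw [mem_box]
  exact ⟨⟨h1, h2⟩, ⟨h3, h4⟩, f_range x y h1 h2 h3 h4⟩

lemma mem_box_g {x y : ℝ} (h1 : -B.r < x) (h2 : x < B.r) (h3 : -B.r < y) (h4 : y < B.r) :
    (x, y, -B.g (x, y)) ∈ box B.r B.h := by
  rw [mem_box]
  exact ⟨⟨h1, h2⟩, ⟨h3, h4⟩, g_range x y h1 h2 h3 h4⟩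

/-! ### Sheets adjacent to the points of the two axes -/

section adjacent

variable {B}

lemma eventually_small_line {k : ℝ × ℝ → ℝ} (hk : Continuous k) {a b c d ε : ℝ}
    (h0 : k (a, b) < ε) : ∀ᶠ s : ℝ in 𝓝[>] 0, k (a + s * c, b + s * d) < ε := by
  have : Continuous fun s : ℝ => k (a + s * c, b + s * d) := by fun_prop
  exact (this.continuousAt.eventually_lt continuousAt_const (by simpa using h0)).filter_mono
    nhdsWithin_le_nhds

lemma eventually_small_pos {b : ℝ} (hb : 0 < b) : ∀ᶠ s : ℝ in 𝓝[>] 0, 0 < s ∧ s < b :=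
  Ioo_mem_nhdsGT hb

/-- Along the top sheet, over a line of constant `x`, the middle sheet is met after flowing
backwards for the time `f`, which tends to zero. -/
lemma adj_f_upper (hB : B.HasF) {x : ℝ} (h1 : -B.r < x) (h2 : x < B.r) {A : Set M}
    (hA : ∀ᶠ y : ℝ in 𝓝[>] 0, B.pt (x, y, B.f (x, y)) ∈ A) :
    Adj F P .upper (B.pt (x, 0, 0)) A := by
  refine ⟨B.h, B.h_pos, fun δ hδ hδh => ?_⟩
  have hc : Continuous fun y : ℝ => (x, y, B.f (x, y)) := by
    have := B.continuous_f
    fun_prop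
  have hc0 := hc.tendsto 0
  simp only [B.f_eq_zero (x := x) le_rfl] at hc0
  have hr := B.r_pos
  refine B.frequently_of_path (B.mem_box_zero h1 h2 (by linarith) hr)
    (hc0.mono_left nhdsWithin_le_nhds) ?_
  have h3 := eventually_small_line (a := x) (b := 0) (c := 0) (d := 1) B.continuous_f
    (by rw [B.f_eq_zero le_rfl]; exact hδ)
  filter_upwards [hA, h3, eventually_small_pos hr] with y hy h3 h4
  simp only [mul_zero, add_zero, mul_one, zero_add] at h3
  have h5 := hB.pos (x := x) h4.1
  refine ⟨hy, (B.dn_iff (B.mem_box_f h1 h2 (by linarith) h4.2) (by linarith)).2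
    ⟨0, Or.inl rfl, by linarith, h5⟩⟩

lemma adj_f_lower (hB : B.HasF) {x : ℝ} (h1 : -B.r < x) (h2 : x < B.r) {A : Set M}
    (hA : ∀ᶠ y : ℝ in 𝓝[>] 0, B.pt (x, y, 0) ∈ A) :
    Adj F P .lower (B.pt (x, 0, 0)) A := by
  refine ⟨B.h, B.h_pos, fun δ hδ hδh => ?_⟩
  have hc : Continuous fun y : ℝ => (x, y, (0 : ℝ)) := by fun_prop
  have hr := B.r_pos
  refine B.frequently_of_path (B.mem_box_zero h1 h2 (by linarith) hr)
    ((hc.tendsto 0).mono_left nhdsWithin_le_nhds) ?_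
  have h3 := eventually_small_line (a := x) (b := 0) (c := 0) (d := 1) B.continuous_f
    (by rw [B.f_eq_zero le_rfl]; exact hδ)
  filter_upwards [hA, h3, eventually_small_pos hr] with y hy h3 h4
  simp only [mul_zero, add_zero, mul_one, zero_add] at h3
  have h5 := hB.pos (x := x) h4.1
  refine ⟨hy, (B.up_iff (B.mem_box_zero h1 h2 (by linarith) h4.2) (by linarith)).2
    ⟨B.f (x, y), Or.inr (Or.inl rfl), h5, by linarith⟩⟩

/-- In a vertex box with `x > 0` there is also a bottom sheet under the single sheet. It must not be
noticed, so `δ` is kept below its distance. -/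
lemma adj_f_single {x : ℝ} (h1 : -B.r < x) (h2 : x < B.r) (hx : x ≠ 0 ∨ ¬ B.HasG) {A : Set M}
    (hA : ∀ᶠ y : ℝ in 𝓝[>] 0, B.pt (x, -y, 0) ∈ A) :
    Adj F P .single (B.pt (x, 0, 0)) A := by
  obtain ⟨ε, hε, hg⟩ := B.g_gap (x := x) (y := 0) 0 hx
  refine ⟨min ε B.h, lt_min hε B.h_pos, fun δ hδ hδh => ?_⟩
  rw [lt_min_iff] at hδh
  have hc : Continuous fun y : ℝ => (x, -y, (0 : ℝ)) := by fun_prop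
  have hr := B.r_pos
  have hc0 := (hc.tendsto 0).mono_left (nhdsWithin_le_nhds (s := Ioi 0))
  simp only [neg_zero] at hc0
  refine B.frequently_of_path (B.mem_box_zero h1 h2 (by linarith) hr) hc0 ?_
  filter_upwards [hA, hc0.eventually hg, eventually_small_pos hr] with y hy h3 h4
  have hf := B.f_eq_zero (x := x) (y := -y) (by linarith [h4.1])
  have hm := B.mem_box_zero h1 h2 (by linarith [h4.2] : -B.r < -y) (by linarith [h4.1])
  have hg0 := B.g_nonneg (x, -y)
  refine ⟨hy, ?_, ?_⟩
  · rw [B.up_iff hm (by linarith)]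
    rintro ⟨z', h5, h6, h7⟩
    unfold sheets at h5
    rcases h5 with h5 | h5 | h5 <;> linarith
  · rw [B.dn_iff hm (by linarith)]
    rintro ⟨z', h5, h6, h7⟩
    unfold sheets at h5
    rcases h5 with h5 | h5 | h5 <;> rcases h3 with h3 | h3 <;> linarith

/-- Along the second axis the middle sheet takes the part of the upper sheet, as the sheet that
separates from it is the bottom one. -/
lemma adj_g_upper (hB : B.HasG) {y : ℝ} (h1 : -B.r < y) (h2 : y < B.r) {A : Set M}
    (hA : ∀ᶠ x : ℝ in 𝓝[>] 0, B.pt (x, y, 0) ∈ A) :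
    Adj F P .upper (B.pt (0, y, 0)) A := by
  refine ⟨B.h, B.h_pos, fun δ hδ hδh => ?_⟩
  have hc : Continuous fun x : ℝ => (x, y, (0 : ℝ)) := by fun_prop
  have hr := B.r_pos
  refine B.frequently_of_path (B.mem_box_zero (by linarith) hr h1 h2)
    ((hc.tendsto 0).mono_left nhdsWithin_le_nhds) ?_
  have h3 := eventually_small_line (a := 0) (b := y) (c := 1) (d := 0) B.continuous_g
    (by rw [B.g_eq_zero le_rfl]; exact hδ)
  filter_upwards [hA, h3, eventually_small_pos hr] with x hx h3 h4
  simp only [mul_zero, add_zero, mul_one, zero_add] at h3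
  have h5 := hB.pos (y := y) h4.1
  refine ⟨hx, (B.dn_iff (B.mem_box_zero (by linarith) h4.2 h1 h2) (by linarith)).2
    ⟨-B.g (x, y), Or.inr (Or.inr rfl), by linarith, by linarith⟩⟩

lemma adj_g_lower (hB : B.HasG) {y : ℝ} (h1 : -B.r < y) (h2 : y < B.r) {A : Set M}
    (hA : ∀ᶠ x : ℝ in 𝓝[>] 0, B.pt (x, y, -B.g (x, y)) ∈ A) :
    Adj F P .lower (B.pt (0, y, 0)) A := by
  refine ⟨B.h, B.h_pos, fun δ hδ hδh => ?_⟩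
  have hc : Continuous fun x : ℝ => (x, y, -B.g (x, y)) := by
    have := B.continuous_g
    fun_prop
  have hc0 := hc.tendsto 0
  simp only [B.g_eq_zero (y := y) le_rfl, neg_zero] at hc0
  have hr := B.r_pos
  refine B.frequently_of_path (B.mem_box_zero (by linarith) hr h1 h2)
    (hc0.mono_left nhdsWithin_le_nhds) ?_
  have h3 := eventually_small_line (a := 0) (b := y) (c := 1) (d := 0) B.continuous_g
    (by rw [B.g_eq_zero le_rfl]; exact hδ)
  filter_upwards [hA, h3, eventually_small_pos hr] with x hx h3 h4
  simp only [mul_zero, add_zero, mul_one, zero_add] at h3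
  have h5 := hB.pos (y := y) h4.1
  refine ⟨hx, (B.up_iff (B.mem_box_g (by linarith) h4.2 h1 h2) (by linarith)).2
    ⟨0, Or.inl rfl, by linarith, by linarith⟩⟩

/-- For `y > 0` the top sheet passes over the single sheet, but at a distance bounded from below. -/
lemma adj_g_single {y : ℝ} (h1 : -B.r < y) (h2 : y < B.r) (hy : y ≠ 0) {A : Set M}
    (hA : ∀ᶠ x : ℝ in 𝓝[>] 0, B.pt (-x, y, 0) ∈ A) :
    Adj F P .single (B.pt (0, y, 0)) A := by
  obtain ⟨ε, hε, hg⟩ := B.f_gap (x := 0) (y := y) 0 (Or.inl hy)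
  refine ⟨min ε B.h, lt_min hε B.h_pos, fun δ hδ hδh => ?_⟩
  rw [lt_min_iff] at hδh
  have hc : Continuous fun x : ℝ => (-x, y, (0 : ℝ)) := by fun_prop
  have hr := B.r_pos
  have hc0 := (hc.tendsto 0).mono_left (nhdsWithin_le_nhds (s := Ioi 0))
  simp only [neg_zero] at hc0
  refine B.frequently_of_path (B.mem_box_zero (by linarith) hr h1 h2) hc0 ?_
  filter_upwards [hA, hc0.eventually hg, eventually_small_pos hr] with x hx h3 h4
  have hf := B.g_eq_zero (x := -x) (y := y) (by linarith [h4.1])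
  have hm := B.mem_box_zero (by linarith [h4.2] : -B.r < -x) (by linarith [h4.1]) h1 h2
  have hg0 := B.f_nonneg (-x, y)
  refine ⟨hx, ?_, ?_⟩
  · rw [B.up_iff hm (by linarith)]
    rintro ⟨z', h5, h6, h7⟩
    unfold sheets at h5
    rcases h5 with h5 | h5 | h5 <;> rcases h3 with h3 | h3 <;> linarith
  · rw [B.dn_iff hm (by linarith)]
    rintro ⟨z', h5, h6, h7⟩
    unfold sheets at h5
    rcases h5 with h5 | h5 | h5 <;> linarith

/-- An edge box is adjacent with its sheets to all points of the edge. -/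
lemma adj_edgeSheet (hF : B.HasF) (hG : ¬ B.HasG) {x : ℝ} (h1 : -B.r < x) (h2 : x < B.r)
    (s : Sheet) : Adj F P s (B.pt (x, 0, 0)) (B.edgeSheet s) := by
  cases s
  · refine adj_f_upper hF h1 h2 ?_
    filter_upwards [eventually_small_pos B.r_pos] with y hy
    exact mem_graph h1 h2 hy.1 hy.2
  · refine adj_f_lower hF h1 h2 ?_
    filter_upwards [eventually_small_pos B.r_pos] with y hy
    exact mem_graph (k := 0) h1 h2 hy.1 hy.2
  · refine adj_f_single h1 h2 (Or.inr hG) ?_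
    filter_upwards [eventually_small_pos B.r_pos] with y hy
    exact mem_graph (k := 0) h1 h2 (by linarith [hy.2]) (by linarith [hy.1])

end adjacent

/-! ### The sheets of a box as pieces of regions -/

variable [IsManifold 𝓘(ℝ, E3) 1 M]
variable {B}

lemma pt_mem_regular (hP : IsFlowSpine o F P) (hpos : IsPositiveSpine o F P) {x y z : ℝ}
    (hu : (x, y, z) ∈ box B.r B.h) (hs : sheets B.f B.g x y z)
    (h : ¬ (z = 0 ∧ ((y = 0 ∧ B.HasF) ∨ (x = 0 ∧ B.HasG)))) :
    B.pt (x, y, z) ∈ regular o F P :=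
  ⟨(B.pt_mem_iff hu).2 hs, fun h' => h ((pt_mem_singularSet hP hpos hu).1 h')⟩

lemma top_subset (hP : IsFlowSpine o F P) (hpos : IsPositiveSpine o F P)
    (hF : B.HasF) : B.top ⊆ regular o F P := by
  rintro _ ⟨⟨x, y⟩, ⟨⟨h1, h2⟩, h3, h4⟩, rfl⟩
  have := hF.pos (x := x) h3
  exact pt_mem_regular hP hpos (B.mem_box_f h1 h2 (by linarith [B.r_pos]) h4)
    (Or.inr (Or.inl rfl)) fun h => this.ne' h.1

lemma bot_subset (hP : IsFlowSpine o F P) (hpos : IsPositiveSpine o F P)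
    (hG : B.HasG) : B.bot ⊆ regular o F P := by
  rintro _ ⟨⟨x, y⟩, ⟨⟨h1, h2⟩, h3, h4⟩, rfl⟩
  have := hG.pos (y := y) h1
  exact pt_mem_regular hP hpos (B.mem_box_g (by linarith [B.r_pos]) h2 h3 h4)
    (Or.inr (Or.inr rfl)) fun h => by have := h.1; simp at this; linarith

lemma mid_subset (hP : IsFlowSpine o F P) (hpos : IsPositiveSpine o F P)
    {a b c d : ℝ} (ha : -B.r ≤ a) (hb : b ≤ B.r) (hc : -B.r ≤ c) (hd : d ≤ B.r)
    (hab : 0 ≤ a ∨ b ≤ 0 ∨ ¬ B.HasG) (hcd : 0 ≤ c ∨ d ≤ 0) : B.mid a b c d ⊆ regular o F P := by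
  rintro _ ⟨⟨x, y⟩, ⟨⟨h1, h2⟩, h3, h4⟩, rfl⟩
  simp only [] at h1 h2 h3 h4
  refine pt_mem_regular hP hpos
    (B.mem_box_zero (by linarith) (by linarith) (by linarith) (by linarith)) (Or.inl rfl) ?_
  rintro ⟨-, ⟨rfl, -⟩ | ⟨rfl, h⟩⟩
  · rcases hcd with h | h <;> linarith
  · rcases hab with h' | h' | h'
    · linarith
    · linarith
    · exact h' h

lemma edgeSheet_subset (hP : IsFlowSpine o F P) (hpos : IsPositiveSpine o F P)
    (hF : B.HasF) (hG : ¬ B.HasG) (s : Sheet) :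
    B.edgeSheet s ⊆ regular o F P := by
  have := B.r_pos
  cases s
  · exact top_subset hP hpos hF
  · exact mid_subset hP hpos (by linarith) (by linarith) (by linarith) (by linarith)
      (Or.inr (Or.inr hG)) (Or.inl le_rfl)
  · exact mid_subset hP hpos (by linarith) (by linarith) (by linarith) (by linarith)
      (Or.inr (Or.inr hG)) (Or.inr le_rfl)

/-- Near an edge point, the position of a point relative to the flow determines its sheet. -/
lemma eventually_mem_edgeSheet (hP : IsFlowSpine o F P) (hpos : IsPositiveSpine o F P)
    (hF : B.HasF) (hG : ¬ B.HasG) {δ : ℝ} (hδ : 0 < δ)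
    (hδh : δ ≤ B.h / 2) :
    ∀ᶠ q in 𝓝 p, q ∈ regular o F P → ∀ s, HasType F P δ q s → q ∈ B.edgeSheet s := by
  suffices key : ∀ᶠ q in 𝓝 (B.pt (0, 0, 0)), q ∈ regular o F P →
      ∀ s, HasType F P δ q s → q ∈ B.edgeSheet s by rwa [B.pt_zero] at key
  rw [B.eventually_nhds B.zero_mem]
  have h1 : ∀ᶠ v : ℝ × ℝ × ℝ in 𝓝 (0, 0, 0), v.2.2 < B.h / 2 :=
    (by fun_prop : Continuous fun v : ℝ × ℝ × ℝ => v.2.2).continuousAt.eventually_lt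
      continuousAt_const (by simp only []; linarith)
  have h2 : ∀ᶠ v : ℝ × ℝ × ℝ in 𝓝 (0, 0, 0), -(B.h / 2) < v.2.2 :=
    (by fun_prop : Continuous fun v : ℝ × ℝ × ℝ => v.2.2).continuousAt.eventually_const_lt
      (by simp only []; linarith)
  -- With `f < δ` every nearby point over `y > 0` notices the other sheet, so it cannot be mistaken
  -- for a point of the single sheet.
  have h3 : ∀ᶠ v : ℝ × ℝ × ℝ in 𝓝 (0, 0, 0), B.f (v.1, v.2.1) < δ :=
    (tendsto_plane 0 0 0).eventually
      (B.continuous_f.continuousAt.eventually_lt_const (by rwa [B.f_eq_zero le_rfl]))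
  filter_upwards [h1, h2, h3, (isOpen_box _ _).mem_nhds B.zero_mem] with ⟨x, y, z⟩ h1 h2 h3 h4
  refine ⟨h4, fun h5 s hs => ?_⟩
  simp only [] at h1 h2 h3
  have hsh := (B.pt_mem_iff h4).1 h5.1
  have hup := B.up_iff h4 (δ := δ) (by linarith)
  have hdn := B.dn_iff h4 (δ := δ) (by linarith)
  have hg := g_eq_zero_of_not B hG (x, y)
  have hf := B.f_nonneg (x, y)
  have hb := mem_box.1 h4
  have hsh' : z = 0 ∨ z = B.f (x, y) := by
    unfold sheets at hsh
    rw [hg, neg_zero] at hsh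
    tauto
  cases s
  · obtain ⟨z', h6, h7, h8⟩ := hdn.1 hs
    have hz : z = B.f (x, y) ∧ 0 < B.f (x, y) := by
      unfold sheets at h6
      rcases hsh' with h | h <;> rcases h6 with h6 | h6 | h6 <;> constructor <;> linarith
    rw [hz.1]
    exact mem_graph hb.1.1 hb.1.2 (pos_of_f_pos hz.2) hb.2.1.2
  · obtain ⟨z', h6, h7, h8⟩ := hup.1 hs
    have hz : z = 0 ∧ 0 < B.f (x, y) := by
      unfold sheets at h6
      rcases hsh' with h | h <;> rcases h6 with h6 | h6 | h6 <;> constructor <;> linarith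
    rw [hz.1]
    exact mem_graph (k := 0) hb.1.1 hb.1.2 (pos_of_f_pos hz.2) hb.2.1.2
  · have hs1 := mt hup.2 hs.1
    have hs2 := mt hdn.2 hs.2
    have hy : y < 0 := by
      by_contra! hy
      rcases hy.eq_or_lt with rfl | hy
      · rw [B.f_eq_zero le_rfl] at hsh'
        have : z = 0 := by tauto
        exact h5.2 ((pt_mem_singularSet hP hpos h4).2 ⟨this, Or.inl ⟨rfl, hF⟩⟩)
      · have := hF.pos (x := x) hy
        rcases hsh' with h | h
        · exact hs1 ⟨_, Or.inr (Or.inl rfl), by linarith, by linarith⟩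
        · exact hs2 ⟨0, Or.inl rfl, by linarith, by linarith⟩
    rw [B.f_eq_zero hy.le] at hsh'
    have hz : z = 0 := by tauto
    rw [hz]
    exact mem_graph (k := 0) hb.1.1 hb.1.2 hb.2.1.1 hy

lemma inter_edgeSheet_nonempty (hP : IsFlowSpine o F P) (hpos : IsPositiveSpine o F P)
    (hF : B.HasF) (hG : ¬ B.HasG) {s : Sheet} {A : Set M}
    (hA : A ⊆ regular o F P) (h : Adj F P s p A) : (A ∩ B.edgeSheet s).Nonempty := by
  obtain ⟨δ₀, h0, h⟩ := h
  have hh := B.h_pos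
  have hδ : 0 < min (δ₀ / 2) (B.h / 2) := lt_min (by linarith) (by linarith)
  have h1 := h _ hδ (by have := min_le_left (δ₀ / 2) (B.h / 2); linarith)
  have h2 := eventually_mem_edgeSheet hP hpos hF hG hδ (min_le_right _ _)
  obtain ⟨q, hq1, hq2⟩ := (h1.and_eventually h2).exists
  exact ⟨q, hq1.1, hq2 (hA hq1.1) s hq1.2⟩

/-- The local sheet is connected and contains every nearby nonsingular point in position `s`. So
exactly one component qualifies, although `reg` is defined as a union of components. -/
lemma reg_eq_of_mem_edgeSheet (hP : IsFlowSpine o F P) (hpos : IsPositiveSpine o F P)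
    (hF : B.HasF) (hG : ¬ B.HasG) {s : Sheet} {q : M}
    (hq : q ∈ B.edgeSheet s) : reg o F P s p = comp o F P q := by
  have hsub := edgeSheet_subset hP hpos hF hG s
  ext q'
  constructor
  · rintro ⟨h1, h2⟩
    obtain ⟨q'', h3, h4⟩ := inter_edgeSheet_nonempty hP hpos hF hG
      (connectedComponentIn_subset _ _) h2
    have h5 : comp o F P q' = comp o F P q'' := connectedComponentIn_eq h3
    rw [← comp_eq_of_mem (B.isPreconnected_edgeSheet s) hsub h4 hq, ← h5]
    exact mem_connectedComponentIn h1
  · intro h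
    have h1 : comp o F P q = comp o F P q' := connectedComponentIn_eq h
    have h2 : B.edgeSheet s ⊆ comp o F P q :=
      (B.isPreconnected_edgeSheet s).subset_connectedComponentIn hq hsub
    refine ⟨connectedComponentIn_subset _ _ h, ?_⟩
    rw [← h1]
    refine Adj.mono ?_ h2
    have := adj_edgeSheet hF hG (x := 0) (by linarith [B.r_pos]) B.r_pos s
    rwa [B.pt_zero] at this

omit [IsManifold 𝓘(ℝ, E3) 1 M] in
lemma edgeSheet_nonempty (B : FoldBox o F P p) (s : Sheet) : (B.edgeSheet s).Nonempty := by
  have hr := B.r_pos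
  cases s
  · exact ⟨_, mem_graph (x := 0) (y := B.r / 2) (by linarith) (by linarith) (by linarith)
      (by linarith)⟩
  · exact ⟨_, mem_graph (x := 0) (y := B.r / 2) (by linarith) (by linarith) (by linarith)
      (by linarith)⟩
  · exact ⟨_, mem_graph (x := 0) (y := -(B.r / 2)) (by linarith) (by linarith) (by linarith)
      (by linarith)⟩

end FoldBox

variable [IsManifold 𝓘(ℝ, E3) 1 M]

lemma exists_edgeBox (hP : IsFlowSpine o F P) (hpos : IsPositiveSpine o F P) {p : M}
    (hp : p ∈ singularSet o F P \ vertexSet o F P) {U : Set M} (hU : U ∈ 𝓝 p) :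
    ∃ B : FoldBox o F P p, B.HasF ∧ ¬ B.HasG ∧ B.chart.source ⊆ U := by
  obtain ⟨B, h⟩ := exists_foldBox hP hpos (singularSet_subset hP hpos hp.1) hU
  exact ⟨B, (B.hasF_iff hP hpos).2 hp.1, mt (B.hasG_iff hP hpos).1 hp.2, h⟩

/-- A connected set of nonsingular points in position `s` determines the region of that sheet. -/
lemma reg_eq_of_adj (hP : IsFlowSpine o F P) (hpos : IsPositiveSpine o F P) {p : M}
    (hp : p ∈ singularSet o F P \ vertexSet o F P) {s : Sheet} {A : Set M}
    (hA : IsPreconnected A) (hAP : A ⊆ regular o F P) (h : Adj F P s p A) {q : M} (hq : q ∈ A) :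
    reg o F P s p = comp o F P q := by
  obtain ⟨B, hF, hG, -⟩ := exists_edgeBox hP hpos hp univ_mem
  obtain ⟨q', h1, h2⟩ := FoldBox.inter_edgeSheet_nonempty hP hpos hF hG hAP h
  rw [FoldBox.reg_eq_of_mem_edgeSheet hP hpos hF hG h2, comp_eq_of_mem hA hAP h1 hq]

lemma exists_reg_eq (hP : IsFlowSpine o F P) (hpos : IsPositiveSpine o F P) {p : M}
    (hp : p ∈ singularSet o F P \ vertexSet o F P) (s : Sheet) :
    ∃ q ∈ regular o F P, reg o F P s p = comp o F P q := by
  obtain ⟨B, hF, hG, -⟩ := exists_edgeBox hP hpos hp univ_mem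
  obtain ⟨q, hq⟩ := B.edgeSheet_nonempty s
  exact ⟨q, FoldBox.edgeSheet_subset hP hpos hF hG s hq,
    FoldBox.reg_eq_of_mem_edgeSheet hP hpos hF hG hq⟩

/-- The regions along the edges are locally constant. -/
lemma eventually_reg_eq (hP : IsFlowSpine o F P) (hpos : IsPositiveSpine o F P) {p : M}
    (hp : p ∈ singularSet o F P \ vertexSet o F P) (s : Sheet) :
    ∀ᶠ p' in 𝓝[singularSet o F P \ vertexSet o F P] p, reg o F P s p' = reg o F P s p := by
  obtain ⟨B, hF, hG, -⟩ := exists_edgeBox hP hpos hp univ_mem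
  have h1 : B.chart.source ∈ 𝓝 p := B.chart.open_source.mem_nhds B.model.mem_source
  filter_upwards [mem_nhdsWithin_of_mem_nhds h1, self_mem_nhdsWithin] with p' h2 h3
  obtain ⟨x, y, z, hu, rfl⟩ := B.exists_pt h2
  obtain ⟨rfl, ⟨rfl, -⟩ | ⟨-, h⟩⟩ := (FoldBox.pt_mem_singularSet hP hpos hu).1 h3.1
  · obtain ⟨q, hq⟩ := B.edgeSheet_nonempty s
    have hb := mem_box.1 hu
    rw [FoldBox.reg_eq_of_mem_edgeSheet hP hpos hF hG hq]
    exact reg_eq_of_adj hP hpos h3 (B.isPreconnected_edgeSheet s)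
      (FoldBox.edgeSheet_subset hP hpos hF hG s)
      (FoldBox.adj_edgeSheet hF hG hb.1.1 hb.1.2 s) hq
  · exact (hG h).elim

lemma reg_eq_of_isPreconnected (hP : IsFlowSpine o F P) (hpos : IsPositiveSpine o F P)
    {A : Set M} (hA : IsPreconnected A) (hAS : A ⊆ singularSet o F P \ vertexSet o F P)
    {p p' : M} (hp : p ∈ A) (hp' : p' ∈ A) (s : Sheet) : reg o F P s p = reg o F P s p' :=
  eq_of_isPreconnected hA (fun _ hx => (eventually_reg_eq hP hpos (hAS hx) s).filter_mono
    (nhdsWithin_mono _ hAS)) hp hp'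

omit [IsManifold 𝓘(ℝ, E3) 1 M] in
lemma edgeModel_image_subset {p : M} {B : FoldBox o F P p} (s : Sheet) :
    B.chart.symm '' (B.chart.target ∩ s.model B.f) ⊆ B.edgeSheet s := by
  rintro _ ⟨v, ⟨h1, h2⟩, rfl⟩
  obtain ⟨⟨x, y, z⟩, rfl⟩ := vec_surjective v
  have hu := mem_box.1 ((B.mem_target _).1 h1)
  cases s
  · have h3 : z = B.f (x, y) := h2.2
    rw [h3]
    exact FoldBox.mem_graph hu.1.1 hu.1.2 h2.1 hu.2.1.2
  · have h3 : z = 0 := h2.2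
    rw [h3]
    exact FoldBox.mem_graph (k := 0) hu.1.1 hu.1.2 h2.1 hu.2.1.2
  · have h3 : z = 0 := h2.2
    rw [h3]
    exact FoldBox.mem_graph (k := 0) hu.1.1 hu.1.2 hu.2.1.1 h2.1

omit [IsManifold 𝓘(ℝ, E3) 1 M] in
lemma edgeSheet_subset_image {p : M} {B : FoldBox o F P p} (s : Sheet) :
    B.edgeSheet s ⊆ B.chart.symm '' (B.chart.target ∩ s.model B.f) := by
  have hr := B.r_pos
  cases s
  · rintro _ ⟨⟨x, y⟩, ⟨⟨h1, h2⟩, h3, h4⟩, rfl⟩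
    exact ⟨_, ⟨(B.mem_target _).2 (B.mem_box_f h1 h2 (by linarith) h4), h3, rfl⟩, rfl⟩
  · rintro _ ⟨⟨x, y⟩, ⟨⟨h1, h2⟩, h3, h4⟩, rfl⟩
    exact ⟨_, ⟨(B.mem_target _).2 (B.mem_box_zero h1 h2 (by linarith) h4), h3, rfl⟩, rfl⟩
  · rintro _ ⟨⟨x, y⟩, ⟨⟨h1, h2⟩, h3, h4⟩, rfl⟩
    simp only [] at h1 h2 h3 h4
    exact ⟨_, ⟨(B.mem_target _).2 (B.mem_box_zero h1 h2 h3 (by linarith)), h4, rfl⟩, rfl⟩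

omit [IsManifold 𝓘(ℝ, E3) 1 M] in
lemma edge_subset (e : Edge o F P) : e.1 ⊆ singularSet o F P \ vertexSet o F P := by
  obtain ⟨p, hp, h⟩ := e.2
  rw [h]
  exact connectedComponentIn_subset _ _

/-- `LiesIn` asks for a chart at each point of the edge. Since `reg` is constant along the edge, one
point is enough, and each edge then has exactly one region for each of its three sheets. -/
lemma liesIn_iff (hP : IsFlowSpine o F P) (hpos : IsPositiveSpine o F P) {s : Sheet}
    {e : Edge o F P} {R : Region o F P} {p : M} (hp : p ∈ e.1) :
    LiesIn o F P s e R ↔ R.1 = reg o F P s p := by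
  obtain ⟨r, hr, hR⟩ := R.2
  constructor
  · intro h
    obtain ⟨f, φ, ⟨hf, hφ⟩, hsub⟩ := h p hp
    rw [edgeModel_eq] at hφ
    obtain ⟨B, h1, h2, -, h3, h4, h5⟩ := hφ.exists_foldBox (Or.inr hf) (Or.inl rfl)
      (fun h => (hf.ne_zero_snd h).elim) univ_mem
    have hF : B.HasF := by rw [FoldBox.HasF, h1]; exact hf
    have hG : ¬ B.HasG := fun h => h.ne_zero_fst h2
    obtain ⟨q, hq⟩ := B.edgeSheet_nonempty s
    -- The box is cut out of the given chart with the same coordinates, so its sheet is part of the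
    -- sheet known to lie in the region.
    have hqR : q ∈ R.1 := by
      apply hsub
      have := edgeSheet_subset_image s hq
      rw [h4, h1] at this
      exact image_mono (inter_subset_inter_left _ h5) this
    rw [FoldBox.reg_eq_of_mem_edgeSheet hP hpos hF hG hq, hR]
    rw [hR] at hqR
    exact connectedComponentIn_eq hqR
  · intro h p' hp'
    have hpe := edge_subset e hp'
    obtain ⟨B, hF, hG, -⟩ := exists_edgeBox hP hpos hpe univ_mem
    refine ⟨B.f, B.chart, ⟨hF, ?_⟩, ?_⟩
    · have := B.model
      have hg : B.g = 0 := funext (B.g_eq_zero_of_not hG)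
      rwa [hg, ← edgeModel_eq] at this
    · have he : IsPreconnected e.1 := by
        obtain ⟨p0, hp0, h0⟩ := e.2
        rw [h0]
        exact isPreconnected_connectedComponentIn
      obtain ⟨q, hq⟩ := B.edgeSheet_nonempty s
      rw [h, reg_eq_of_isPreconnected hP hpos he (edge_subset e) hp hp' s,
        FoldBox.reg_eq_of_mem_edgeSheet hP hpos hF hG hq]
      exact (edgeModel_image_subset s).trans
        ((B.isPreconnected_edgeSheet s).subset_connectedComponentIn hq
          (FoldBox.edgeSheet_subset hP hpos hF hG s))

end FlowSpine

namespace FlowSpine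

open Set Filter Topology

variable {M : Type*} [TopologicalSpace M] [ChartedSpace E3 M] [IsManifold 𝓘(ℝ, E3) 1 M]
variable {o : Orientation3 M} {F : Flow ℝ M} {P : Set M}

/-! ### The regions at a vertex -/

namespace FoldBox

variable {p : M} {B : FoldBox o F P p}

lemma pt_x_mem (hP : IsFlowSpine o F P) (hpos : IsPositiveSpine o F P) (hB : B.HasF) {x : ℝ}
    (h1 : -B.r < x) (h2 : x < B.r) (h0 : x ≠ 0 ∨ ¬ B.HasG) :
    B.pt (x, 0, 0) ∈ singularSet o F P \ vertexSet o F P := by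
  have hr := B.r_pos
  have hu := B.mem_box_zero h1 h2 (by linarith) hr
  rw [Set.mem_sdiff, pt_mem_singularSet hP hpos hu, pt_mem_vertexSet hP hpos hu]
  refine ⟨⟨rfl, Or.inl ⟨rfl, hB⟩⟩, fun h => ?_⟩
  tauto

lemma pt_y_mem (hP : IsFlowSpine o F P) (hpos : IsPositiveSpine o F P) (hB : B.HasG) {y : ℝ}
    (h1 : -B.r < y) (h2 : y < B.r) (h0 : y ≠ 0) :
    B.pt (0, y, 0) ∈ singularSet o F P \ vertexSet o F P := by
  have hr := B.r_pos
  have hu := B.mem_box_zero (by linarith) hr h1 h2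
  rw [Set.mem_sdiff, pt_mem_singularSet hP hpos hu, pt_mem_vertexSet hP hpos hu]
  refine ⟨⟨rfl, Or.inr ⟨rfl, hB⟩⟩, fun h => h0 h.2.2.1⟩

omit [IsManifold 𝓘(ℝ, E3) 1 M] in
lemma eventually_mem_top {x : ℝ} (h1 : -B.r < x) (h2 : x < B.r) :
    ∀ᶠ y : ℝ in 𝓝[>] 0, B.pt (x, y, B.f (x, y)) ∈ B.top := by
  filter_upwards [eventually_small_pos B.r_pos] with y hy
  exact mem_graph h1 h2 hy.1 hy.2

omit [IsManifold 𝓘(ℝ, E3) 1 M] in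
lemma eventually_mem_bot {y : ℝ} (h1 : -B.r < y) (h2 : y < B.r) :
    ∀ᶠ x : ℝ in 𝓝[>] 0, B.pt (x, y, -B.g (x, y)) ∈ B.bot := by
  filter_upwards [eventually_small_pos B.r_pos] with x hx
  exact mem_graph (k := -B.g) hx.1 hx.2 h1 h2

omit [IsManifold 𝓘(ℝ, E3) 1 M] in
lemma eventually_mem_mid {a b c d : ℝ} {u v : ℝ → ℝ}
    (h : ∀ s, 0 < s → s < B.r → (a < u s ∧ u s < b) ∧ c < v s ∧ v s < d) :
    ∀ᶠ s : ℝ in 𝓝[>] 0, B.pt (u s, v s, 0) ∈ B.mid a b c d := by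
  filter_upwards [eventually_small_pos B.r_pos] with s hs
  have := h s hs.1 hs.2
  exact mem_graph (k := 0) this.1.1 this.1.2 this.2.1 this.2.2

/-- The top sheet runs uninterrupted over the half-square `y > 0`, so it bounds the first axis in
the same region before and after the vertex. -/
lemma reg_x_upper (hP : IsFlowSpine o F P) (hpos : IsPositiveSpine o F P) (hF : B.HasF) {x : ℝ}
    (h1 : -B.r < x) (h2 : x < B.r) (h0 : x ≠ 0 ∨ ¬ B.HasG) {q : M} (hq : q ∈ B.top) :
    reg o F P .upper (B.pt (x, 0, 0)) = comp o F P q :=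
  reg_eq_of_adj hP hpos (pt_x_mem hP hpos hF h1 h2 h0) B.isPreconnected_top
    (top_subset hP hpos hF) (adj_f_upper hF h1 h2 (eventually_mem_top h1 h2)) hq

/-- Unlike the top sheet, the middle sheet is cut by the second axis if the box has a vertex. This
is why the rectangle has to stay on one side. -/
lemma reg_x_lower (hP : IsFlowSpine o F P) (hpos : IsPositiveSpine o F P) (hF : B.HasF)
    {x a b : ℝ} (h1 : a < x) (h2 : x < b) (ha : -B.r ≤ a) (hb : b ≤ B.r)
    (hab : 0 ≤ a ∨ b ≤ 0 ∨ ¬ B.HasG) {q : M} (hq : q ∈ B.mid a b 0 B.r) :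
    reg o F P .lower (B.pt (x, 0, 0)) = comp o F P q := by
  have hr := B.r_pos
  refine reg_eq_of_adj hP hpos (pt_x_mem hP hpos hF (by linarith) (by linarith) ?_)
    (B.isPreconnected_mid ha hb (by linarith) le_rfl)
    (mid_subset hP hpos ha hb (by linarith) le_rfl hab (Or.inl le_rfl))
    (adj_f_lower hF (by linarith) (by linarith)
      (eventually_mem_mid (u := fun _ => x) (v := fun y => y)
        fun s hs1 hs2 => ⟨⟨h1, h2⟩, hs1, hs2⟩)) hq
  rcases hab with h | h | h
  · exact Or.inl (by linarith)
  · exact Or.inl (by linarith)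
  · exact Or.inr h

lemma reg_x_single (hP : IsFlowSpine o F P) (hpos : IsPositiveSpine o F P) (hF : B.HasF)
    {x a b : ℝ} (h1 : a < x) (h2 : x < b) (ha : -B.r ≤ a) (hb : b ≤ B.r)
    (hab : 0 ≤ a ∨ b ≤ 0 ∨ ¬ B.HasG) {q : M} (hq : q ∈ B.mid a b (-B.r) 0) :
    reg o F P .single (B.pt (x, 0, 0)) = comp o F P q := by
  have hr := B.r_pos
  have h0 : x ≠ 0 ∨ ¬ B.HasG := by
    rcases hab with h | h | h
    · exact Or.inl (by linarith)
    · exact Or.inl (by linarith)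
    · exact Or.inr h
  exact reg_eq_of_adj hP hpos (pt_x_mem hP hpos hF (by linarith) (by linarith) h0)
    (B.isPreconnected_mid ha hb le_rfl (by linarith))
    (mid_subset hP hpos ha hb le_rfl (by linarith) hab (Or.inr le_rfl))
    (adj_f_single (by linarith) (by linarith) h0
      (eventually_mem_mid (u := fun _ => x) (v := fun y => -y)
        fun s hs1 hs2 => ⟨⟨h1, h2⟩, by linarith, by linarith⟩)) hq

lemma reg_y_lower (hP : IsFlowSpine o F P) (hpos : IsPositiveSpine o F P) (hG : B.HasG) {y : ℝ}
    (h1 : -B.r < y) (h2 : y < B.r) (h0 : y ≠ 0) {q : M} (hq : q ∈ B.bot) :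
    reg o F P .lower (B.pt (0, y, 0)) = comp o F P q :=
  reg_eq_of_adj hP hpos (pt_y_mem hP hpos hG h1 h2 h0) B.isPreconnected_bot
    (bot_subset hP hpos hG) (adj_g_lower hG h1 h2 (eventually_mem_bot h1 h2)) hq

lemma reg_y_upper (hP : IsFlowSpine o F P) (hpos : IsPositiveSpine o F P) (hG : B.HasG)
    {y c d : ℝ} (h1 : c < y) (h2 : y < d) (hc : -B.r ≤ c) (hd : d ≤ B.r)
    (hcd : 0 ≤ c ∨ d ≤ 0) {q : M} (hq : q ∈ B.mid 0 B.r c d) :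
    reg o F P .upper (B.pt (0, y, 0)) = comp o F P q := by
  have hr := B.r_pos
  refine reg_eq_of_adj hP hpos (pt_y_mem hP hpos hG (by linarith) (by linarith) ?_)
    (B.isPreconnected_mid (by linarith) le_rfl hc hd)
    (mid_subset hP hpos (by linarith) le_rfl hc hd (Or.inl le_rfl) hcd)
    (adj_g_upper hG (by linarith) (by linarith)
      (eventually_mem_mid (u := fun x => x) (v := fun _ => y)
        fun s hs1 hs2 => ⟨⟨hs1, hs2⟩, h1, h2⟩)) hq
  rcases hcd with h | h <;> linarith

lemma reg_y_single (hP : IsFlowSpine o F P) (hpos : IsPositiveSpine o F P) (hG : B.HasG)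
    {y c d : ℝ} (h1 : c < y) (h2 : y < d) (hc : -B.r ≤ c) (hd : d ≤ B.r)
    (hcd : 0 ≤ c ∨ d ≤ 0) {q : M} (hq : q ∈ B.mid (-B.r) 0 c d) :
    reg o F P .single (B.pt (0, y, 0)) = comp o F P q := by
  have hr := B.r_pos
  have h0 : y ≠ 0 := by rcases hcd with h | h <;> linarith
  exact reg_eq_of_adj hP hpos (pt_y_mem hP hpos hG (by linarith) (by linarith) h0)
    (B.isPreconnected_mid le_rfl (by linarith) hc hd)
    (mid_subset hP hpos le_rfl (by linarith) hc hd (Or.inr (Or.inl le_rfl)) hcd)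
    (adj_g_single (by linarith) (by linarith) h0
      (eventually_mem_mid (u := fun x => -x) (v := fun _ => y)
        fun s hs1 hs2 => ⟨⟨by linarith, by linarith⟩, h1, h2⟩)) hq

/-- Every region which meets a singular box is adjacent to an edge. -/
lemma exists_reg_eq_comp (hP : IsFlowSpine o F P) (hpos : IsPositiveSpine o F P) (hF : B.HasF)
    {q : M} (hq : q ∈ B.chart.source) (hqr : q ∈ regular o F P) :
    ∃ p' ∈ singularSet o F P \ vertexSet o F P, ∃ s, reg o F P s p' = comp o F P q := by
  have hr := B.r_pos
  obtain ⟨x, y, z, hu, rfl⟩ := B.exists_pt hq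
  have hb := mem_box.1 hu
  have hsh := (B.pt_mem_iff hu).1 hqr.1
  have hS := mt (pt_mem_singularSet hP hpos hu).2 hqr.2
  -- The edge point is taken at `r / 2` and not at `x`, since for `x = 0` the latter might be the
  -- vertex.
  have htop : 0 < y → z = B.f (x, y) → ∃ p' ∈ singularSet o F P \ vertexSet o F P,
      ∃ s, reg o F P s p' = comp o F P (B.pt (x, y, z)) := by
    rintro hy rfl
    exact ⟨_, pt_x_mem hP hpos hF (x := B.r / 2) (by linarith) (by linarith)
      (Or.inl (by linarith)), .upper, reg_x_upper hP hpos hF (by linarith) (by linarith)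
      (Or.inl (by linarith)) (mem_graph hb.1.1 hb.1.2 hy hb.2.1.2)⟩
  by_cases hG : B.HasG
  · by_cases hz : z = 0
    · subst hz
      have hx : x ≠ 0 := fun h => hS ⟨rfl, Or.inr ⟨h, hG⟩⟩
      have hy : y ≠ 0 := fun h => hS ⟨rfl, Or.inl ⟨h, hF⟩⟩
      refine ⟨_, pt_x_mem hP hpos hF hb.1.1 hb.1.2 (Or.inl hx), ?_⟩
      rcases lt_or_gt_of_ne hx with hx | hx <;> rcases lt_or_gt_of_ne hy with hy | hy
      · exact ⟨.single, reg_x_single hP hpos hF hb.1.1 hx le_rfl hr.le (Or.inr (Or.inl le_rfl))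
          (mem_graph (k := 0) hb.1.1 hx hb.2.1.1 hy)⟩
      · exact ⟨.lower, reg_x_lower hP hpos hF hb.1.1 hx le_rfl hr.le (Or.inr (Or.inl le_rfl))
          (mem_graph (k := 0) hb.1.1 hx hy hb.2.1.2)⟩
      · exact ⟨.single, reg_x_single hP hpos hF hx hb.1.2 (by linarith) le_rfl (Or.inl le_rfl)
          (mem_graph (k := 0) hx hb.1.2 hb.2.1.1 hy)⟩
      · exact ⟨.lower, reg_x_lower hP hpos hF hx hb.1.2 (by linarith) le_rfl (Or.inl le_rfl)
          (mem_graph (k := 0) hx hb.1.2 hy hb.2.1.2)⟩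
    · rcases hsh with h | h | h
      · exact (hz h).elim
      · exact htop (pos_of_f_pos (lt_of_le_of_ne (B.f_nonneg _) fun h' =>
          hz (h.trans h'.symm))) h
      · have hx : 0 < x := pos_of_g_pos (B := B) (y := y) (lt_of_le_of_ne (B.g_nonneg _) fun h' =>
          hz (by rw [h, ← h', neg_zero]))
        rw [h]
        exact ⟨_, pt_y_mem hP hpos hG (y := B.r / 2) (by linarith) (by linarith) (by linarith),
          .lower, reg_y_lower hP hpos hG (by linarith) (by linarith) (by linarith)
          (mem_graph (k := -B.g) hx hb.1.2 hb.2.1.1 hb.2.1.2)⟩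
  · have hsh' : z = 0 ∨ z = B.f (x, y) := by
      rcases hsh with h | h | h
      · exact Or.inl h
      · exact Or.inr h
      · rw [B.g_eq_zero_of_not hG, neg_zero] at h
        exact Or.inl h
    rcases lt_trichotomy y 0 with hy | hy | hy
    · rw [B.f_eq_zero hy.le, or_self] at hsh'
      rw [hsh']
      exact ⟨_, pt_x_mem hP hpos hF hb.1.1 hb.1.2 (Or.inr hG), .single,
        reg_x_single hP hpos hF hb.1.1 hb.1.2 le_rfl le_rfl (Or.inr (Or.inr hG))
          (mem_graph (k := 0) hb.1.1 hb.1.2 hb.2.1.1 hy)⟩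
    · rw [B.f_eq_zero hy.le, or_self] at hsh'
      exact (hS ⟨hsh', Or.inl ⟨hy, hF⟩⟩).elim
    · rcases hsh' with h | h
      · rw [h]
        exact ⟨_, pt_x_mem hP hpos hF hb.1.1 hb.1.2 (Or.inr hG), .lower,
          reg_x_lower hP hpos hF hb.1.1 hb.1.2 le_rfl le_rfl (Or.inr (Or.inr hG))
            (mem_graph (k := 0) hb.1.1 hb.1.2 hy hb.2.1.2)⟩
      · exact htop hy h

omit [IsManifold 𝓘(ℝ, E3) 1 M] in
lemma source_mem_nhds (B : FoldBox o F P p) : B.chart.source ∈ 𝓝 p :=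
  B.chart.open_source.mem_nhds B.model.mem_source

end FoldBox

/-- If the closure of a region missed the singular set, the region would be closed. Plane charts
show that it is open in `P`, so it would be all of the connected set `P`. But `P` contains a vertex.
-/
lemma exists_reg_eq_comp [T2Space M] (hP : IsFlowSpine o F P) (hpos : IsPositiveSpine o F P)
    (hconn : IsPreconnected P) {q : M} (hq : q ∈ regular o F P) :
    ∃ p ∈ singularSet o F P \ vertexSet o F P, ∃ s, reg o F P s p = comp o F P q := by
  by_cases hcl : (closure (comp o F P q) ∩ singularSet o F P).Nonempty
  · obtain ⟨p, h1, h2⟩ := hcl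
    obtain ⟨B, -⟩ := exists_foldBox hP hpos (singularSet_subset hP hpos h2) univ_mem
    obtain ⟨q', h3, h4⟩ := mem_closure_iff_nhds.1 h1 _ B.source_mem_nhds
    obtain ⟨p', hp', s, hs⟩ := FoldBox.exists_reg_eq_comp hP hpos ((B.hasF_iff hP hpos).2 h2) h3
      (connectedComponentIn_subset _ _ h4)
    exact ⟨p', hp', s, hs.trans (connectedComponentIn_eq h4).symm⟩
  · exfalso
    have hsub : closure (comp o F P q) ⊆ regular o F P := by
      intro x hx
      refine ⟨?_, fun h => hcl ⟨x, hx, h⟩⟩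
      exact hP.compact.isClosed.closure_subset_iff.2
        ((connectedComponentIn_subset _ _).trans sdiff_subset) hx
    have hqc : q ∈ comp o F P q := mem_connectedComponentIn hq
    have hclosed : IsClosed (comp o F P q) := by
      refine isClosed_of_closure_subset ?_
      exact isPreconnected_connectedComponentIn.closure.subset_connectedComponentIn
        (subset_closure hqc) hsub
    obtain ⟨v, hv⟩ := hpos.1
    have hvS : v ∈ singularSet o F P := Or.inr hv
    have hvP := singularSet_subset hP hpos hvS
    have : (q ∈ comp o F P q) = (v ∈ comp o F P q) := by
      refine eq_of_isPreconnected hconn (f := fun x => x ∈ comp o F P q) ?_ hq.1 hvP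
      intro x hx
      by_cases hxc : x ∈ comp o F P q
      · have hxr := connectedComponentIn_subset _ _ hxc
        obtain ⟨B, -⟩ := exists_foldBox hP hpos hx univ_mem
        have hF : ¬ B.HasF := fun h => hxr.2 ((B.hasF_iff hP hpos).1 h)
        have hG : ¬ B.HasG := fun h => hF h.hasF
        have hr := B.r_pos
        have hmid : ∀ x y, -B.r < x → x < B.r → -B.r < y → y < B.r →
            B.pt (x, y, 0) ∈ B.mid (-B.r) B.r (-B.r) B.r :=
          fun x y h1 h2 h3 h4 => FoldBox.mem_graph (k := 0) h1 h2 h3 h4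
        have hxm := hmid 0 0 (by linarith) hr (by linarith) hr
        rw [B.pt_zero] at hxm
        have hsubr : B.mid (-B.r) B.r (-B.r) B.r ⊆ regular o F P := by
          rintro _ ⟨⟨a, b⟩, ⟨⟨h1, h2⟩, h3, h4⟩, rfl⟩
          refine FoldBox.pt_mem_regular hP hpos (B.mem_box_zero h1 h2 h3 h4) (Or.inl rfl) ?_
          tauto
        have hmc : B.mid (-B.r) B.r (-B.r) B.r ⊆ comp o F P q := by
          have h5 : comp o F P q = comp o F P x := connectedComponentIn_eq hxc
          rw [h5]
          exact (B.isPreconnected_mid le_rfl le_rfl le_rfl le_rfl).subset_connectedComponentIn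
            hxm hsubr
        filter_upwards [mem_nhdsWithin_of_mem_nhds B.source_mem_nhds, self_mem_nhdsWithin]
          with y hy hyP
        obtain ⟨a, b, c, hu, rfl⟩ := B.exists_pt hy
        have hb := mem_box.1 hu
        have hc : c = 0 := by
          have := (B.pt_mem_iff hu).1 hyP
          unfold sheets at this
          rw [B.f_eq_zero_of_not hF, B.g_eq_zero_of_not hG, neg_zero] at this
          tauto
        subst hc
        exact propext ⟨fun _ => hxc, fun _ => hmc (hmid a b hb.1.1 hb.1.2 hb.2.1.1 hb.2.1.2)⟩
      · filter_upwards [mem_nhdsWithin_of_mem_nhds (hclosed.isOpen_compl.mem_nhds hxc)] with y hy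
        exact propext ⟨fun h => (hy h).elim, fun h => (hxc h).elim⟩
    rw [this] at hqc
    exact (connectedComponentIn_subset _ _ hqc).2 hvS

end FlowSpine

namespace FlowSpine

open Set Filter Topology

variable {M : Type*} [TopologicalSpace M] [ChartedSpace E3 M] [IsManifold 𝓘(ℝ, E3) 1 M]
variable {o : Orientation3 M} {F : Flow ℝ M} {P : Set M}

/-! ### Flow lines and the complement of the spine -/

/-- Flow lines passing close to `P` hit `P`. -/
lemma eventually_hit (hP : IsFlowSpine o F P) (hpos : IsPositiveSpine o F P) {p : M} (hp : p ∈ P)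
    {δ : ℝ} (hδ : 0 < δ) : ∀ᶠ q in 𝓝 p, ∃ t, |t| < δ ∧ F t q ∈ P := by
  obtain ⟨B, -⟩ := exists_foldBox hP hpos hp univ_mem
  suffices key : ∀ᶠ q in 𝓝 (B.pt (0, 0, 0)), ∃ t, |t| < δ ∧ F t q ∈ P by rwa [B.pt_zero] at key
  rw [B.eventually_nhds B.zero_mem]
  have h1 : ∀ᶠ v : ℝ × ℝ × ℝ in 𝓝 (0, 0, 0), |v.2.2| < δ :=
    (by fun_prop : Continuous fun v : ℝ × ℝ × ℝ => |v.2.2|).continuousAt.eventually_lt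
      continuousAt_const (by simpa using hδ)
  filter_upwards [h1, (isOpen_box _ _).mem_nhds B.zero_mem] with ⟨x, y, z⟩ h1 h2
  have hb := mem_box.1 h2
  have h3 := B.mem_box_zero hb.1.1 hb.1.2 hb.2.1.1 hb.2.1.2
  have h4 := B.flow_pt (t := -z) h2 (by simpa using h3)
  rw [add_neg_cancel] at h4
  refine ⟨h2, -z, by simpa using h1, ?_⟩
  rw [h4]
  exact (B.pt_mem_iff h3).2 (Or.inl rfl)

/-- A hit at time `t` leaves `δ - |t|` to spare, which is enough for nearby flow lines to hit `P` by
`eventually_hit`. -/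
lemma isOpen_hit (hP : IsFlowSpine o F P) (hpos : IsPositiveSpine o F P) (δ : ℝ) :
    IsOpen {q | ∃ t, |t| < δ ∧ F t q ∈ P} := by
  rw [isOpen_iff_mem_nhds]
  rintro q ⟨t, ht, hq⟩
  have h1 := eventually_hit hP hpos hq (sub_pos.2 ht)
  have hc : Continuous (F t) := F.continuous continuous_const continuous_id
  filter_upwards [hc.continuousAt.eventually h1] with q' hq'
  obtain ⟨t', h2, h3⟩ := hq'
  refine ⟨t' + t, ?_, ?_⟩
  · calc |t' + t| ≤ |t'| + |t| := abs_add_le _ _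
      _ < δ := by linarith
  · rwa [F.map_add]

/-- Two points on the same flow line in the complement of `P`. -/
def SameOrbit (F : Flow ℝ M) (P : Set M) (q q' : M) : Prop :=
  ∃ t, F t q = q' ∧ ∀ s ∈ uIcc 0 t, F s q ∉ P

omit [ChartedSpace E3 M] [IsManifold 𝓘(ℝ, E3) 1 M] in
lemma SameOrbit.symm {q q' : M} (h : SameOrbit F P q q') : SameOrbit F P q' q := by
  obtain ⟨t, rfl, ht⟩ := h
  refine ⟨-t, by rw [← F.map_add, neg_add_cancel, F.map_zero_apply], fun s hs => ?_⟩
  rw [← F.map_add]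
  apply ht
  rw [mem_uIcc] at hs ⊢
  rcases hs with hs | hs
  · exact Or.inr ⟨by linarith, by linarith⟩
  · exact Or.inl ⟨by linarith, by linarith⟩

omit [ChartedSpace E3 M] [IsManifold 𝓘(ℝ, E3) 1 M] in
lemma SameOrbit.trans {q q' q'' : M} (h : SameOrbit F P q q') (h' : SameOrbit F P q' q'') :
    SameOrbit F P q q'' := by
  obtain ⟨t, rfl, ht⟩ := h
  obtain ⟨t', rfl, ht'⟩ := h'
  refine ⟨t' + t, by rw [F.map_add], fun s hs => ?_⟩
  by_cases hst : s ∈ uIcc 0 t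
  · exact ht s hst
  · have := ht' (s - t) (by
      rw [mem_uIcc] at hs hst ⊢
      push Not at hst
      rcases hs with hs | hs
      · rcases le_total 0 t with h | h
        · have := hst.1 hs.1
          exact Or.inl ⟨by linarith, by linarith⟩
        · exact Or.inl ⟨by linarith, by linarith⟩
      · rcases le_total 0 t with h | h
        · exact Or.inr ⟨by linarith, by linarith⟩
        · have : s < t := by
            by_contra! hh
            exact (hst.2 hh).not_ge hs.2
          exact Or.inr ⟨by linarith, by linarith⟩)
    rwa [← F.map_add, sub_add_cancel] at this

/-- A homeomorphism from the complement of `P` onto the unit ball which makes the flow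
vertical. -/
def IsVertical (F : Flow ℝ M) (P : Set M) (ψ : ↥(Pᶜ) ≃ₜ ↥(Metric.ball (0 : E3) 1)) : Prop :=
  ∀ (q q' : ↥(Pᶜ)) (t : ℝ), 0 < t →
    (∀ s ∈ Set.Icc 0 t, F s q ∈ Pᶜ) → F t q = q' →
      (ψ q' : E3) 0 = (ψ q : E3) 0 ∧ (ψ q' : E3) 1 = (ψ q : E3) 1 ∧
        (ψ q : E3) 2 < (ψ q' : E3) 2

lemma mem_ball_iff (v : E3) : v ∈ Metric.ball (0 : E3) 1 ↔ v 0 ^ 2 + v 1 ^ 2 + v 2 ^ 2 < 1 := by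
  rw [mem_ball_zero_iff, ← sq_lt_one_iff₀ (norm_nonneg v), EuclideanSpace.real_norm_sq_eq,
    Fin.sum_univ_three]

/-! ### Chords of the ball and their lengths -/

section vertical

variable {ψ : ↥(Pᶜ) ≃ₜ ↥(Metric.ball (0 : E3) 1)}

/-- The squared distance of a flow line from the axis of the ball. -/
def radius (ψ : ↥(Pᶜ) ≃ₜ ↥(Metric.ball (0 : E3) 1)) (q : ↥(Pᶜ)) : ℝ :=
  (ψ q : E3) 0 ^ 2 + (ψ q : E3) 1 ^ 2

omit [ChartedSpace E3 M] [IsManifold 𝓘(ℝ, E3) 1 M] in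
lemma continuous_coord (i : Fin 3) : Continuous fun q => (ψ q : E3) i := by
  have : Continuous fun q => (ψ q : E3) := continuous_subtype_val.comp ψ.continuous
  fun_prop

omit [ChartedSpace E3 M] [IsManifold 𝓘(ℝ, E3) 1 M] in
lemma continuous_radius : Continuous (radius ψ) :=
  ((continuous_coord 0).pow 2).add ((continuous_coord 1).pow 2)

omit [ChartedSpace E3 M] [IsManifold 𝓘(ℝ, E3) 1 M] in
lemma radius_lt_one (q : ↥(Pᶜ)) : radius ψ q < 1 := by
  have := (mem_ball_iff _).1 (ψ q).2
  unfold radius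
  nlinarith [sq_nonneg ((ψ q : E3) 2)]

omit [ChartedSpace E3 M] [IsManifold 𝓘(ℝ, E3) 1 M] in
/-- Each vertical chord of the ball is a single flow line. -/
lemma sameOrbit_of_eq (hψ : IsVertical F P ψ) (hP : IsClosed P) {q q' : ↥(Pᶜ)}
    (h0 : (ψ q : E3) 0 = (ψ q' : E3) 0) (h1 : (ψ q : E3) 1 = (ψ q' : E3) 1) :
    SameOrbit F P q q' := by
  set A : Set ↥(Pᶜ) := {x | (ψ x : E3) 0 = (ψ q : E3) 0 ∧ (ψ x : E3) 1 = (ψ q : E3) 1} with hA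
  have hAc : IsPreconnected A := by
    have e : A = ψ ⁻¹' {v | (v : E3) 0 = (ψ q : E3) 0 ∧ (v : E3) 1 = (ψ q : E3) 1} := rfl
    rw [e, ψ.isPreconnected_preimage, ← IsInducing.subtypeVal.isPreconnected_image]
    have e2 : (Subtype.val '' {v : ↥(Metric.ball (0 : E3) 1) | (v : E3) 0 = (ψ q : E3) 0 ∧
        (v : E3) 1 = (ψ q : E3) 1}) =
        Metric.ball (0 : E3) 1 ∩ {v | v 0 = (ψ q : E3) 0 ∧ v 1 = (ψ q : E3) 1} := by
      ext v
      constructor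
      · rintro ⟨w, hw, rfl⟩
        exact ⟨w.2, hw⟩
      · rintro ⟨h, h'⟩
        exact ⟨⟨v, h⟩, h', rfl⟩
    rw [e2]
    refine ((convex_ball _ _).inter ?_).isPreconnected
    intro v hv w hw a b ha hb hab
    simp only [mem_ofPred_eq, PiLp.add_apply, PiLp.smul_apply, smul_eq_mul] at hv hw ⊢
    rw [hv.1, hv.2, hw.1, hw.2, ← add_mul, ← add_mul, hab, one_mul, one_mul]
    exact ⟨rfl, rfl⟩
  -- The chord is connected, so it suffices that the set of points on the same flow line is locally
  -- constant along it.
  have key := eq_of_isPreconnected hAc (f := fun x : ↥(Pᶜ) => {y : M | SameOrbit F P x y})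
    (x := q) (y := q') ?_ ⟨rfl, rfl⟩ ⟨h0.symm, h1.symm⟩
  · have hq' : (q' : M) ∈ {y : M | SameOrbit F P q' y} := ⟨0, F.map_zero_apply _, by
      intro s hs
      rw [uIcc_self, mem_singleton_iff] at hs
      rw [hs, F.map_zero_apply]
      exact q'.2⟩
    rw [← key] at hq'
    exact hq'
  · intro x hx
    have hcont : Continuous fun s : ℝ => F s (x : M) := F.continuous continuous_id continuous_const
    have hev : ∀ᶠ s in 𝓝 (0 : ℝ), F s (x : M) ∈ Pᶜ := by
      refine hcont.continuousAt.eventually (hP.isOpen_compl.mem_nhds ?_)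
      change F 0 (x : M) ∈ Pᶜ
      rw [F.map_zero_apply]
      exact x.2
    obtain ⟨δ', hδ', hball⟩ := Metric.eventually_nhds_iff.1 hev
    obtain ⟨δ, hδ, hδ''⟩ : ∃ δ, 0 < δ ∧ δ < δ' := ⟨δ' / 2, by linarith, by linarith⟩
    have hW : ∀ s : Icc (-δ) δ, F s (x : M) ∈ Pᶜ := fun s => hball (by
      rw [Real.dist_eq, sub_zero, abs_lt]
      exact ⟨by linarith [s.2.1], by linarith [s.2.2]⟩)
    set γ : Icc (-δ) δ → ↥(Pᶜ) := fun s => ⟨F s (x : M), hW s⟩ with hγ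
    have hγc : Continuous γ := by
      refine Continuous.subtype_mk ?_ _
      exact hcont.comp continuous_subtype_val
    have hinc : ∀ s s' : Icc (-δ) δ, s < s' → (ψ (γ s') : E3) 0 = (ψ (γ s) : E3) 0 ∧
        (ψ (γ s') : E3) 1 = (ψ (γ s) : E3) 1 ∧ (ψ (γ s) : E3) 2 < (ψ (γ s') : E3) 2 := by
      intro s s' hs
      have hs' : (s : ℝ) < s' := hs
      refine hψ (γ s) (γ s') (s' - s) (by linarith) ?_ ?_
      · intro r hr
        simp only [hγ, ← F.map_add]
        exact hW ⟨r + s, by linarith [hr.1, s.2.1], by linarith [hr.2, s'.2.2]⟩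
      · simp only [hγ, ← F.map_add, sub_add_cancel]
    have h0' : (0 : ℝ) ∈ Icc (-δ) δ := ⟨by linarith, by linarith⟩
    have hγ0 : γ ⟨0, h0'⟩ = x := by
      apply Subtype.ext
      simp [hγ]
    have hlow : (ψ (γ ⟨-δ, by simp [hδ.le]⟩) : E3) 2 < (ψ x : E3) 2 := by
      have := (hinc ⟨-δ, by simp [hδ.le]⟩ ⟨0, h0'⟩ (by simp [hδ])).2.2
      rwa [hγ0] at this
    have hhigh : (ψ x : E3) 2 < (ψ (γ ⟨δ, by simp [hδ.le]⟩) : E3) 2 := by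
      have := (hinc ⟨0, h0'⟩ ⟨δ, by simp [hδ.le]⟩ (by simp [hδ])).2.2
      rwa [hγ0] at this
    have hcoord : ∀ s, (ψ (γ s) : E3) 0 = (ψ x : E3) 0 ∧ (ψ (γ s) : E3) 1 = (ψ x : E3) 1 := by
      intro s
      rcases lt_trichotomy s ⟨0, h0'⟩ with h | h | h
      · have := hinc _ _ h
        rw [hγ0] at this
        exact ⟨this.1.symm, this.2.1.symm⟩
      · rw [h, hγ0]
        exact ⟨rfl, rfl⟩
      · have := hinc _ _ h
        rw [hγ0] at this
        exact ⟨this.1, this.2.1⟩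
    have e1 := (continuous_coord (ψ := ψ) 2).continuousAt.eventually_const_lt hlow
    have e2 := (continuous_coord (ψ := ψ) 2).continuousAt.eventually_lt_const hhigh
    filter_upwards [mem_nhdsWithin_of_mem_nhds e1, mem_nhdsWithin_of_mem_nhds e2,
      self_mem_nhdsWithin] with y hy1 hy2 hyA
    have : PreconnectedSpace (Icc (-δ) δ) := Subtype.preconnectedSpace isPreconnected_Icc
    -- A short flow arc through `x` stays on the chord and takes a lower and a higher height than
    -- `y`. By the intermediate value theorem it passes through `y`.
    have hivt := mem_range_of_exists_le_of_exists_ge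
      (f := fun s => (ψ (γ s) : E3) 2) ((continuous_coord 2).comp hγc)
      ⟨_, le_of_lt hy1⟩ ⟨_, le_of_lt hy2⟩
    obtain ⟨s, hs⟩ := hivt
    have hxy : γ s = y := by
      apply ψ.injective
      apply Subtype.ext
      ext i
      have := hcoord s
      fin_cases i
      · exact this.1.trans (hx.1.trans hyA.1.symm)
      · exact this.2.trans (hx.2.trans hyA.2.symm)
      · exact hs
    have hrel : SameOrbit F P x y := by
      refine ⟨s, by rw [← hxy], fun r hr => hW ⟨r, ?_⟩⟩
      have := uIcc_subset_Icc h0' s.2 hr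
      exact this
    ext z
    exact ⟨fun h => hrel.trans h, fun h => hrel.symm.trans h⟩

/-- Flow lines close to the boundary cylinder are short. -/
lemma exists_radius_short [CompactSpace M] [T2Space M] (hψ : IsVertical F P ψ)
    (hP : IsFlowSpine o F P) (hpos : IsPositiveSpine o F P) {ε : ℝ} (hε : 0 < ε) :
    ∃ R, 0 ≤ R ∧ R < 1 ∧ ∀ q : ↥(Pᶜ), R < radius ψ q → Up F P ε q ∧ Dn F P ε q := by
  -- The points that are at least `ε / 2` away from `P` in both directions of the flow form a
  -- compact subset of the complement, on which `radius` stays away from 1.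
  set Y : Set M := {q | ∃ t, |t| < ε / 2 ∧ F t q ∈ P}ᶜ with hY
  have hYc : IsCompact Y := (isOpen_hit hP hpos _).isClosed_compl.isCompact
  have hYP : Y ⊆ Pᶜ := by
    intro q hq hqP
    exact hq ⟨0, by simpa using hε, by rwa [F.map_zero_apply]⟩
  have hYW : IsCompact (Subtype.val ⁻¹' Y : Set ↥(Pᶜ)) := by
    rw [IsInducing.subtypeVal.isCompact_iff, Subtype.image_preimage_coe,
      inter_eq_self_of_subset_right hYP]
    exact hYc
  obtain ⟨R, hR0, hR1, hR⟩ : ∃ R, 0 ≤ R ∧ R < 1 ∧ ∀ q : ↥(Pᶜ), (q : M) ∈ Y → radius ψ q ≤ R := by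
    rcases (Subtype.val ⁻¹' Y : Set ↥(Pᶜ)).eq_empty_or_nonempty with h | h
    · refine ⟨0, le_rfl, one_pos, fun q hq => ?_⟩
      have : q ∈ (Subtype.val ⁻¹' Y : Set ↥(Pᶜ)) := hq
      rw [h] at this
      exact this.elim
    · obtain ⟨q, -, hq⟩ := hYW.exists_isMaxOn h (continuous_radius (ψ := ψ)).continuousOn
      exact ⟨radius ψ q, by unfold radius; positivity, radius_lt_one q, fun q' hq' => hq hq'⟩
  refine ⟨R, hR0, hR1, fun q hq => ⟨?_, ?_⟩⟩
  -- If the chord continued for the time `ε`, its point at time `ε / 2` would lie in `Y`. But it has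
  -- the same radius as `q`, which is larger than `R`.
  · by_contra hn
    have hn' : ∀ t, 0 ≤ t → t < ε → F t (q : M) ∉ P := by
      intro t h1 h2 h3
      rcases h1.eq_or_lt with rfl | h1
      · rw [F.map_zero_apply] at h3
        exact q.2 h3
      · exact hn ⟨t, h1, h2, h3⟩
    have hW : F (ε / 2) (q : M) ∈ Pᶜ := hn' _ (by linarith) (by linarith)
    have h4 := hψ q ⟨_, hW⟩ (ε / 2) (by linarith)
      (fun s hs => hn' s hs.1 (by linarith [hs.2])) rfl
    have h5 : F (ε / 2) (q : M) ∈ Y := by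
      rintro ⟨t, ht, htP⟩
      rw [abs_lt] at ht
      rw [← F.map_add] at htP
      exact hn' _ (by linarith) (by linarith) htP
    have h6 := hR ⟨_, hW⟩ h5
    have h7 : radius ψ ⟨_, hW⟩ = radius ψ q := by
      unfold radius
      rw [h4.1, h4.2.1]
    linarith
  · by_contra hn
    have hn' : ∀ t, 0 ≤ t → t < ε → F (-t) (q : M) ∉ P := by
      intro t h1 h2 h3
      rcases h1.eq_or_lt with rfl | h1
      · rw [neg_zero, F.map_zero_apply] at h3
        exact q.2 h3
      · exact hn ⟨t, h1, h2, h3⟩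
    have hW : F (-(ε / 2)) (q : M) ∈ Pᶜ := hn' _ (by linarith) (by linarith)
    have h4 := hψ ⟨_, hW⟩ q (ε / 2) (by linarith)
      (fun s hs => by
        have := hn' (ε / 2 - s) (by linarith [hs.2]) (by linarith [hs.1])
        rw [neg_sub, sub_eq_add_neg, F.map_add] at this
        exact this) (by
          show F (ε / 2) (F (-(ε / 2)) (q : M)) = q
          rw [← F.map_add, add_neg_cancel, F.map_zero_apply])
    have h5 : F (-(ε / 2)) (q : M) ∈ Y := by
      rintro ⟨t, ht, htP⟩
      rw [abs_lt] at ht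
      rw [← F.map_add] at htP
      have := hn' (ε / 2 - t) (by linarith) (by linarith)
      rw [neg_sub, sub_eq_add_neg] at this
      exact this htP
    have h6 := hR ⟨_, hW⟩ h5
    have h7 : radius ψ ⟨_, hW⟩ = radius ψ q := by
      unfold radius
      rw [h4.1, h4.2.1]
    linarith

omit [IsManifold 𝓘(ℝ, E3) 1 M] in
/-- Flow lines away from the boundary cylinder are not short. -/
lemma exists_not_short [T2Space M] (hψ : IsVertical F P ψ) (hP : IsFlowSpine o F P) {R : ℝ}
    (hR : R < 1) :
    ∃ δ > 0, ∀ q : ↥(Pᶜ), Up F P δ q → Dn F P δ q → R < radius ψ q := by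
  have hPc := hP.compact.isClosed
  -- Every chord within radius `R` passes through this compact equatorial disc, whose points remain
  -- off `P` for a uniform time.
  set K : Set ↥(Pᶜ) := {q | (ψ q : E3) 2 = 0 ∧ radius ψ q ≤ R} with hK
  have hKc : IsCompact K := by
    have e : K = ψ ⁻¹' {v | (v : E3) 2 = 0 ∧ (v : E3) 0 ^ 2 + (v : E3) 1 ^ 2 ≤ R} := rfl
    rw [e, ψ.isCompact_preimage, IsInducing.subtypeVal.isCompact_iff]
    have e2 : (Subtype.val '' {v : ↥(Metric.ball (0 : E3) 1) | (v : E3) 2 = 0 ∧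
        (v : E3) 0 ^ 2 + (v : E3) 1 ^ 2 ≤ R}) =
        {v | v 2 = 0 ∧ v 0 ^ 2 + v 1 ^ 2 ≤ R} := by
      ext v
      constructor
      · rintro ⟨w, hw, rfl⟩
        exact hw
      · rintro ⟨h, h'⟩
        refine ⟨⟨v, (mem_ball_iff _).2 ?_⟩, ⟨h, h'⟩, rfl⟩
        rw [h]
        linarith
    rw [e2]
    refine Metric.isCompact_of_isClosed_isBounded ?_ ?_
    · have hc (i : Fin 3) : Continuous fun v : E3 => v i := by fun_prop
      exact (isClosed_eq (hc 2) continuous_const).inter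
        (isClosed_le (((hc 0).pow 2).add ((hc 1).pow 2)) continuous_const)
    · refine Metric.isBounded_ball (x := (0 : E3)) (r := 1) |>.subset ?_
      rintro v ⟨h1, h2⟩
      rw [mem_ball_iff, h1]
      linarith
  have hev : ∀ᶠ s in 𝓝 (0 : ℝ), ∀ q ∈ K, F s (q : M) ∈ Pᶜ := by
    refine hKc.eventually_forall_of_forall_eventually fun q _ => ?_
    have hc : Continuous fun u : ℝ × ↥(Pᶜ) => F u.1 (u.2 : M) :=
      F.continuous continuous_fst (continuous_subtype_val.comp continuous_snd)
    refine hc.continuousAt.eventually (hPc.isOpen_compl.mem_nhds ?_)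
    simp only [F.map_zero_apply]
    exact q.2
  obtain ⟨δ, hδ, hball⟩ := Metric.eventually_nhds_iff.1 hev
  -- The disc may be met anywhere between the two ends of the chord, so the time from there to `P`
  -- is only bounded by the sum of the two given times.
  refine ⟨δ / 2, by linarith, fun q hup hdn => ?_⟩
  by_contra! hq
  obtain ⟨t1, h1, h2, h3⟩ := hup
  obtain ⟨t2, h1', h2', h3'⟩ := hdn
  set v0 : E3 := vec ((ψ q : E3) 0, (ψ q : E3) 1, 0) with hv0
  have hv0b : v0 ∈ Metric.ball (0 : E3) 1 := by
    rw [mem_ball_iff]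
    have : (ψ q : E3) 0 ^ 2 + (ψ q : E3) 1 ^ 2 ≤ R := hq
    simp only [hv0, vec_zero, vec_one, vec_two]
    linarith
  set q0 : ↥(Pᶜ) := ψ.symm ⟨v0, hv0b⟩ with hq0
  have hψq0 : (ψ q0 : E3) = v0 := by rw [hq0, ψ.apply_symm_apply]
  have hq0K : q0 ∈ K := by
    refine ⟨by rw [hψq0]; rfl, ?_⟩
    unfold radius
    rw [hψq0]
    exact hq
  obtain ⟨t, ht, htW⟩ := sameOrbit_of_eq hψ hPc (q := q) (q' := q0)
    (by rw [hψq0]; rfl) (by rw [hψq0]; rfl)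
  have ht1 : t < t1 := by
    by_contra! h
    exact htW t1 (mem_uIcc.2 (Or.inl ⟨h1.le, h⟩)) h3
  have ht2 : -t2 < t := by
    by_contra! h
    exact htW (-t2) (mem_uIcc.2 (Or.inr ⟨h, by linarith⟩)) h3'
  have := hball (y := t1 - t) (by rw [Real.dist_eq, sub_zero, abs_lt]; constructor <;> linarith)
    q0 hq0K
  rw [← ht, ← F.map_add, sub_add_cancel] at this
  exact this h3

omit [ChartedSpace E3 M] [IsManifold 𝓘(ℝ, E3) 1 M] in
-- Polar coordinates, with the height rescaled by the half-length of the chord, present the set as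
-- the image of a product of intervals.
lemma isPreconnected_annulus {R : ℝ} (hR : 0 ≤ R) : IsPreconnected {q | R < radius ψ q} := by
  have e : {q | R < radius ψ q} = ψ ⁻¹' {v | R < (v : E3) 0 ^ 2 + (v : E3) 1 ^ 2} := rfl
  rw [e, ψ.isPreconnected_preimage, ← IsInducing.subtypeVal.isPreconnected_image]
  have e2 : (Subtype.val '' {v : ↥(Metric.ball (0 : E3) 1) |
      R < (v : E3) 0 ^ 2 + (v : E3) 1 ^ 2}) =
      (fun u : ℝ × ℝ × ℝ => vec (u.2.1 * Real.cos u.1, u.2.1 * Real.sin u.1,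
        u.2.2 * √(1 - u.2.1 ^ 2))) '' (univ ×ˢ Ioo (√R) 1 ×ˢ Ioo (-1) 1) := by
    ext v
    simp only [mem_image, mem_ofPred_eq, Subtype.exists, exists_and_right, exists_eq_right,
      mem_ball_iff]
    constructor
    · rintro ⟨h1, h2⟩
      set c : ℂ := ⟨v 0, v 1⟩ with hc
      have hn : ‖c‖ ^ 2 = v 0 ^ 2 + v 1 ^ 2 := by
        rw [← Complex.normSq_eq_norm_sq, Complex.normSq_apply]
        simp only [hc]
        ring
      have hpos : 0 < 1 - ‖c‖ ^ 2 := by nlinarith [sq_nonneg (v 2)]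
      have hsq := Real.sq_sqrt hpos.le
      have hsp := Real.sqrt_pos.2 hpos
      refine ⟨(c.arg, ‖c‖, v 2 / √(1 - ‖c‖ ^ 2)), ⟨mem_univ _, ⟨?_, ?_⟩, ?_⟩, ?_⟩
      · rw [Real.sqrt_lt' ((norm_nonneg c).lt_of_ne ?_), hn]
        · exact h2
        · intro h
          rw [← h] at hn
          nlinarith
      · exact (sq_lt_one_iff₀ (norm_nonneg c)).1 (by linarith)
      · have habs : |v 2 / √(1 - ‖c‖ ^ 2)| < 1 := by
          rw [abs_div, abs_of_pos hsp, div_lt_one hsp]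
          refine abs_lt_of_sq_lt_sq ?_ hsp.le
          rw [hsq]
          linarith
        exact abs_lt.1 habs
      · simp only [Complex.norm_mul_cos_arg, Complex.norm_mul_sin_arg, div_mul_cancel₀ _ hsp.ne']
        ext i
        fin_cases i <;> rfl
    · rintro ⟨⟨θ, ρ, z⟩, ⟨-, ⟨h1, h2⟩, h3, h4⟩, rfl⟩
      simp only [] at h1 h2 h3 h4
      have h0 := Real.sqrt_nonneg R
      have hR2 := Real.sq_sqrt hR
      have hpos : 0 < 1 - ρ ^ 2 := by nlinarith
      have hsq := Real.sq_sqrt hpos.le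
      have hcs := Real.sin_sq_add_cos_sq θ
      have hxy : (ρ * Real.cos θ) ^ 2 + (ρ * Real.sin θ) ^ 2 = ρ ^ 2 := by
        linear_combination ρ ^ 2 * hcs
      simp only [vec_zero, vec_one, vec_two]
      rw [hxy, mul_pow, hsq]
      refine ⟨?_, by nlinarith⟩
      have hz : z ^ 2 < 1 := by nlinarith
      nlinarith
  rw [e2]
  refine (isPreconnected_univ.prod (isPreconnected_Ioo.prod isPreconnected_Ioo)).image _ ?_
  exact (continuous_vec.comp (by fun_prop)).continuousOn

end vertical

end FlowSpine

namespace FlowSpine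

open Set Filter Topology

variable {M : Type*} [TopologicalSpace M] [ChartedSpace E3 M]

/-! ### Weights of short flow lines -/

section defs

variable (o : Orientation3 M) (F : Flow ℝ M) (P : Set M) (a : Set M → ℝ)

open Classical in
/-- The weight of a point of `P`; at an edge point, that of the single sheet. -/
noncomputable def weight (p : M) : ℝ :=
  if p ∈ singularSet o F P then a (reg o F P .single p) else a (comp o F P p)

/-- At each edge the weight of the single sheet is the sum of those of the other two. -/
def IsBalanced : Prop := ∀ p ∈ singularSet o F P \ vertexSet o F P,
  a (reg o F P .upper p) + a (reg o F P .lower p) = a (reg o F P .single p)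

/-- The top and the bottom sheets at the vertices have weight zero. -/
def VanishesAtVertices : Prop := ∀ p, ∀ B : FoldBox o F P p, B.HasG → ∀ q ∈ B.top ∪ B.bot,
  a (comp o F P q) = 0

/-- The first point of `P` on the flow line of `q`. -/
def FirstUp (q p : M) : Prop :=
  ∃ t, 0 < t ∧ F t q = p ∧ p ∈ P ∧ ∀ s, 0 < s → s < t → F s q ∉ P

/-- The first point of `P` on the backward flow line of `q`. -/
def FirstDn (q p : M) : Prop :=
  ∃ t, 0 < t ∧ F (-t) q = p ∧ p ∈ P ∧ ∀ s, 0 < s → s < t → F (-s) q ∉ P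

/-- The pair of weights of the two ends of the flow line of `q` in the complement of `P`. -/
def chordWeights (q : M) : Set (ℝ × ℝ) :=
  {c | ∃ p p', FirstDn F P q p ∧ FirstUp F P q p' ∧ c = (weight o F P a p, weight o F P a p')}

end defs

variable {o : Orientation3 M} {F : Flow ℝ M} {P : Set M} {a : Set M → ℝ}

omit [ChartedSpace E3 M] in
lemma FirstUp.unique {q p p' : M} (h : FirstUp F P q p) (h' : FirstUp F P q p') : p = p' := by
  obtain ⟨t, ht, rfl, htP, h1⟩ := h
  obtain ⟨t', ht', rfl, htP', h1'⟩ := h'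
  rcases lt_trichotomy t t' with h | h | h
  · exact (h1' t ht h htP).elim
  · rw [h]
  · exact (h1 t' ht' h htP').elim

omit [ChartedSpace E3 M] in
lemma FirstDn.unique {q p p' : M} (h : FirstDn F P q p) (h' : FirstDn F P q p') : p = p' := by
  obtain ⟨t, ht, rfl, htP, h1⟩ := h
  obtain ⟨t', ht', rfl, htP', h1'⟩ := h'
  rcases lt_trichotomy t t' with h | h | h
  · exact (h1' t ht h htP).elim
  · rw [h]
  · exact (h1 t' ht' h htP').elim

lemma weight_of_regular {p : M} (hp : p ∈ regular o F P) :
    weight o F P a p = a (comp o F P p) := if_neg hp.2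

lemma weight_of_singular {p : M} (hp : p ∈ singularSet o F P) :
    weight o F P a p = a (reg o F P .single p) := if_pos hp

namespace FoldBox

variable {p : M} {B : FoldBox o F P p}

/-- With no sheet strictly between the two heights, the vertical segment is a whole flow line of the
complement, and its ends are unique. -/
lemma chordWeights_eq {x y z z0 z1 : ℝ} (h0 : (x, y, z0) ∈ box B.r B.h)
    (h1 : (x, y, z1) ∈ box B.r B.h) (hz0 : z0 < z) (hz1 : z < z1) (hs0 : sheets B.f B.g x y z0)
    (hs1 : sheets B.f B.g x y z1) (hs : ∀ z', z0 < z' → z' < z1 → ¬ sheets B.f B.g x y z') :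
    chordWeights o F P a (B.pt (x, y, z)) =
      {(weight o F P a (B.pt (x, y, z0)), weight o F P a (B.pt (x, y, z1)))} := by
  have hb : ∀ z', z0 ≤ z' → z' ≤ z1 → (x, y, z') ∈ box B.r B.h := by
    intro z' h2 h3
    rw [mem_box] at h0 h1 ⊢
    exact ⟨h0.1, h0.2.1, by linarith [h0.2.2.1], by linarith [h1.2.2.2]⟩
  have hz := hb z hz0.le hz1.le
  have hfl : ∀ t, z0 ≤ z + t → z + t ≤ z1 → F t (B.pt (x, y, z)) = B.pt (x, y, z + t) :=
    fun t h2 h3 => B.flow_pt hz (hb _ h2 h3)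
  have hdn : FirstDn F P (B.pt (x, y, z)) (B.pt (x, y, z0)) := by
    refine ⟨z - z0, by linarith, ?_, (B.pt_mem_iff h0).2 hs0, fun s h2 h3 => ?_⟩
    · rw [hfl _ (by linarith) (by linarith)]
      congr 3
      ring
    · rw [hfl _ (by linarith) (by linarith), B.pt_mem_iff (hb _ (by linarith) (by linarith))]
      exact hs _ (by linarith) (by linarith)
  have hup : FirstUp F P (B.pt (x, y, z)) (B.pt (x, y, z1)) := by
    refine ⟨z1 - z, by linarith, ?_, (B.pt_mem_iff h1).2 hs1, fun s h2 h3 => ?_⟩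
    · rw [hfl _ (by linarith) (by linarith)]
      congr 3
      ring
    · rw [hfl _ (by linarith) (by linarith), B.pt_mem_iff (hb _ (by linarith) (by linarith))]
      exact hs _ (by linarith) (by linarith)
  ext c
  constructor
  · rintro ⟨p1, p2, h2, h3, rfl⟩
    rw [h2.unique hdn, h3.unique hup]
    rfl
  · rintro rfl
    exact ⟨_, _, hdn, hup, rfl⟩

variable [IsManifold 𝓘(ℝ, E3) 1 M]

lemma weight_top (hP : IsFlowSpine o F P) (hpos : IsPositiveSpine o F P) (hF : B.HasF)
    {q q' : M} (hq : q ∈ B.top) (hq' : q' ∈ B.top) : weight o F P a q = weight o F P a q' := by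
  rw [weight_of_regular (top_subset hP hpos hF hq), weight_of_regular (top_subset hP hpos hF hq'),
    comp_eq_of_mem B.isPreconnected_top (top_subset hP hpos hF) hq hq']

/-- The lower ends of the chords below the top sheet all have the same weight. -/
lemma weight_mid_f (hP : IsFlowSpine o F P) (hpos : IsPositiveSpine o F P)
    (ha : IsBalanced o F P a) (hv : VanishesAtVertices o F P a) (hF : B.HasF) :
    ∃ c, ∀ x y, -B.r < x → x < B.r → 0 < y → y < B.r →
      weight o F P a (B.pt (x, y, 0)) = c := by
  have hr := B.r_pos
  by_cases hG : B.HasG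
  · have hm : ∀ {s t : ℝ}, -B.r ≤ s → t ≤ B.r → (0 ≤ s ∨ t ≤ 0) → ∀ {q q'}, q ∈ B.mid s t 0 B.r →
        q' ∈ B.mid s t 0 B.r → weight o F P a q = weight o F P a q' := by
      intro s t hs ht hst q q' hq hq'
      have hsub := mid_subset hP hpos hs ht (by linarith) le_rfl (c := 0)
        (hst.imp_right Or.inl) (Or.inl le_rfl)
      rw [weight_of_regular (hsub hq), weight_of_regular (hsub hq'),
        comp_eq_of_mem (B.isPreconnected_mid hs ht (by linarith) le_rfl) hsub hq hq']
    have h1 : B.pt (B.r / 2, B.r / 2, 0) ∈ B.mid 0 B.r 0 B.r :=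
      mem_graph (k := 0) (by linarith) (by linarith) (by linarith) (by linarith)
    have h2 : B.pt (-(B.r / 2), B.r / 2, 0) ∈ B.mid (-B.r) 0 0 B.r :=
      mem_graph (k := 0) (by linarith) (by linarith) (by linarith) (by linarith)
    have h3 : B.pt (B.r / 2, B.r / 2, -B.g (B.r / 2, B.r / 2)) ∈ B.bot :=
      mem_graph (k := -B.g) (by linarith) (by linarith) (by linarith) (by linarith)
    -- The second axis is where the middle sheet could change its weight. The balance there reads
    -- upper + lower = single, and the lower sheet is the bottom sheet, of weight zero. On the axis
    -- itself `weight` is by definition that of the single sheet.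
    have key : ∀ y, 0 < y → y < B.r → weight o F P a (B.pt (0, y, 0)) =
        weight o F P a (B.pt (-(B.r / 2), B.r / 2, 0)) ∧
        weight o F P a (B.pt (B.r / 2, B.r / 2, 0)) =
        weight o F P a (B.pt (-(B.r / 2), B.r / 2, 0)) := by
      intro y hy hy'
      have hm := pt_y_mem hP hpos hG (by linarith : -B.r < y) hy' hy.ne'
      have hbal := ha _ hm
      rw [weight_of_singular hm.1, weight_of_regular (mid_subset hP hpos (by linarith) le_rfl
        (by linarith) le_rfl (Or.inl le_rfl) (Or.inl le_rfl) h1),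
        weight_of_regular (mid_subset hP hpos le_rfl (by linarith)
        (by linarith) le_rfl (Or.inr (Or.inl le_rfl)) (Or.inl le_rfl) h2)]
      rw [reg_y_single hP hpos hG hy hy' (by linarith) le_rfl (Or.inl le_rfl) h2] at hbal ⊢
      rw [reg_y_upper hP hpos hG hy hy' (by linarith) le_rfl (Or.inl le_rfl) h1,
        reg_y_lower hP hpos hG (by linarith) hy' hy.ne' h3, hv p B hG _ (Or.inr h3),
        add_zero] at hbal
      exact ⟨rfl, hbal⟩
    refine ⟨weight o F P a (B.pt (-(B.r / 2), B.r / 2, 0)), fun x y hx1 hx2 hy1 hy2 => ?_⟩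
    rcases lt_trichotomy x 0 with hx | rfl | hx
    · exact hm le_rfl (by linarith) (Or.inr le_rfl) (mem_graph (k := 0) hx1 hx hy1 hy2) h2
    · exact (key y hy1 hy2).1
    · rw [← (key y hy1 hy2).2]
      exact hm (by linarith) le_rfl (Or.inl le_rfl) (mem_graph (k := 0) hx hx2 hy1 hy2) h1
  · have hsub := edgeSheet_subset hP hpos hF hG .lower
    refine ⟨weight o F P a (B.pt (0, B.r / 2, 0)), fun x y hx1 hx2 hy1 hy2 => ?_⟩
    have h1 : B.pt (x, y, 0) ∈ B.edgeSheet .lower := mem_graph (k := 0) hx1 hx2 hy1 hy2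
    have h2 : B.pt (0, B.r / 2, 0) ∈ B.edgeSheet .lower :=
      mem_graph (k := 0) (by linarith) (by linarith) (by linarith) (by linarith)
    rw [weight_of_regular (hsub h1), weight_of_regular (hsub h2),
      comp_eq_of_mem (B.isPreconnected_edgeSheet .lower) hsub h1 h2]

/-- The upper ends of the chords above the bottom sheet all have the same weight. -/
lemma weight_mid_g (hP : IsFlowSpine o F P) (hpos : IsPositiveSpine o F P)
    (ha : IsBalanced o F P a) (hv : VanishesAtVertices o F P a) (hG : B.HasG) :
    ∃ c, ∀ x y, 0 < x → x < B.r → -B.r < y → y < B.r →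
      weight o F P a (B.pt (x, y, 0)) = c := by
  have hr := B.r_pos
  have hF := hG.hasF
  have hm : ∀ {s t : ℝ}, -B.r ≤ s → t ≤ B.r → (0 ≤ s ∨ t ≤ 0) → ∀ {q q'}, q ∈ B.mid 0 B.r s t →
      q' ∈ B.mid 0 B.r s t → weight o F P a q = weight o F P a q' := by
    intro s t hs ht hst q q' hq hq'
    have hsub := mid_subset hP hpos (by linarith) le_rfl (a := 0) hs ht
      (Or.inl le_rfl) hst
    rw [weight_of_regular (hsub hq), weight_of_regular (hsub hq'),
      comp_eq_of_mem (B.isPreconnected_mid (by linarith) le_rfl hs ht) hsub hq hq']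
  have h1 : B.pt (B.r / 2, B.r / 2, 0) ∈ B.mid 0 B.r 0 B.r :=
    mem_graph (k := 0) (by linarith) (by linarith) (by linarith) (by linarith)
  have h2 : B.pt (B.r / 2, -(B.r / 2), 0) ∈ B.mid 0 B.r (-B.r) 0 :=
    mem_graph (k := 0) (by linarith) (by linarith) (by linarith) (by linarith)
  have h3 : B.pt (B.r / 2, B.r / 2, B.f (B.r / 2, B.r / 2)) ∈ B.top :=
    mem_graph (by linarith) (by linarith) (by linarith) (by linarith)
  -- The same on the first axis, where the upper sheet is the top sheet, of weight zero.
  have key : ∀ x, 0 < x → x < B.r → weight o F P a (B.pt (x, 0, 0)) =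
      weight o F P a (B.pt (B.r / 2, -(B.r / 2), 0)) ∧
      weight o F P a (B.pt (B.r / 2, B.r / 2, 0)) =
      weight o F P a (B.pt (B.r / 2, -(B.r / 2), 0)) := by
    intro x hx hx'
    have hm := pt_x_mem hP hpos hF (by linarith : -B.r < x) hx' (Or.inl hx.ne')
    have hbal := ha _ hm
    rw [weight_of_singular hm.1, weight_of_regular (mid_subset hP hpos (by linarith) le_rfl
      (by linarith) le_rfl (Or.inl le_rfl) (Or.inl le_rfl) h1),
      weight_of_regular (mid_subset hP hpos (by linarith) le_rfl
      le_rfl (by linarith) (Or.inl le_rfl) (Or.inr le_rfl) h2)]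
    rw [reg_x_single hP hpos hF hx hx' (by linarith) le_rfl (Or.inl le_rfl) h2] at hbal ⊢
    rw [reg_x_lower hP hpos hF hx hx' (by linarith) le_rfl (Or.inl le_rfl) h1,
      reg_x_upper hP hpos hF (by linarith) hx' (Or.inl hx.ne') h3, hv p B hG _ (Or.inl h3),
      zero_add] at hbal
    exact ⟨rfl, hbal⟩
  refine ⟨weight o F P a (B.pt (B.r / 2, -(B.r / 2), 0)), fun x y hx1 hx2 hy1 hy2 => ?_⟩
  rcases lt_trichotomy y 0 with hy | rfl | hy
  · exact hm le_rfl (by linarith) (Or.inr le_rfl) (mem_graph (k := 0) hx1 hx2 hy1 hy) h2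
  · exact (key x hx1 hx2).1
  · rw [← (key x hx1 hx2).2]
    exact hm (by linarith) le_rfl (Or.inl le_rfl) (mem_graph (k := 0) hx1 hx2 hy hy2) h1

omit [IsManifold 𝓘(ℝ, E3) 1 M] in
lemma chordWeights_f {x y z : ℝ} (hx1 : -B.r < x) (hx2 : x < B.r) (hy2 : y < B.r)
    (hz0 : 0 < z) (hz1 : z < B.f (x, y)) : 0 < y ∧ chordWeights o F P a (B.pt (x, y, z)) =
      {(weight o F P a (B.pt (x, y, 0)), weight o F P a (B.pt (x, y, B.f (x, y))))} := by
  have hr := B.r_pos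
  have hy : 0 < y := pos_of_f_pos (hz0.trans hz1)
  refine ⟨hy, ?_⟩
  refine chordWeights_eq (B.mem_box_zero hx1 hx2 (by linarith) hy2)
    (B.mem_box_f hx1 hx2 (by linarith) hy2) hz0 hz1 (Or.inl rfl) (Or.inr (Or.inl rfl)) ?_
  have hg := B.g_nonneg (x, y)
  rintro z' h1 h2 (h | h | h) <;> linarith

omit [IsManifold 𝓘(ℝ, E3) 1 M] in
lemma chordWeights_g {x y z : ℝ} (hx2 : x < B.r) (hy1 : -B.r < y) (hy2 : y < B.r)
    (hz0 : -B.g (x, y) < z) (hz1 : z < 0) : 0 < x ∧ chordWeights o F P a (B.pt (x, y, z)) =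
      {(weight o F P a (B.pt (x, y, -B.g (x, y))), weight o F P a (B.pt (x, y, 0)))} := by
  have hr := B.r_pos
  have hx : 0 < x := pos_of_g_pos (B := B) (y := y) (by linarith)
  refine ⟨hx, ?_⟩
  refine chordWeights_eq (B.mem_box_g (by linarith) hx2 hy1 hy2)
    (B.mem_box_zero (by linarith) hx2 hy1 hy2) hz0 hz1 (Or.inr (Or.inr rfl)) (Or.inl rfl) ?_
  have hg := B.f_nonneg (x, y)
  rintro z' h1 h2 (h | h | h) <;> linarith

/-- The weights of short chords are locally constant. -/
lemma eventually_chordWeights_eq (hP : IsFlowSpine o F P) (hpos : IsPositiveSpine o F P)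
    (ha : IsBalanced o F P a) (hv : VanishesAtVertices o F P a) {x y z z0 z1 : ℝ}
    (h0 : (x, y, z0) ∈ box B.r B.h) (h1 : (x, y, z1) ∈ box B.r B.h) (hz0 : z0 < z) (hz1 : z < z1)
    (hs0 : sheets B.f B.g x y z0) (hs1 : sheets B.f B.g x y z1) (hs : ¬ sheets B.f B.g x y z) :
    ∀ᶠ q in 𝓝 (B.pt (x, y, z)),
      chordWeights o F P a q = chordWeights o F P a (B.pt (x, y, z)) := by
  have hb0 := mem_box.1 h0
  have hb1 := mem_box.1 h1
  have hu : (x, y, z) ∈ box B.r B.h :=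
    mem_box.2 ⟨hb0.1, hb0.2.1, by linarith [hb0.2.2.1], by linarith [hb1.2.2.2]⟩
  have hf := B.f_nonneg (x, y)
  have hg := B.g_nonneg (x, y)
  -- A chord with both ends in the box lies either between the middle and the top sheet or between
  -- the bottom and the middle sheet.
  have hcases : (0 < z ∧ z < B.f (x, y)) ∨ (-B.g (x, y) < z ∧ z < 0) := by
    unfold sheets at hs0 hs1 hs
    rcases lt_trichotomy z 0 with hz | hz | hz
    · right
      rcases hs0 with h | h | h
      · linarith
      · linarith
      · exact ⟨by linarith, hz⟩
    · exact (hs (Or.inl hz)).elim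
    · left
      rcases hs1 with h | h | h
      · linarith
      · exact ⟨hz, by linarith⟩
      · linarith
  rw [B.eventually_nhds hu]
  have hc2 : Continuous fun v : ℝ × ℝ × ℝ => v.2.2 := by fun_prop
  rcases hcases with ⟨hz, hz'⟩ | ⟨hz, hz'⟩
  · have hF : B.HasF := hasF_of_pos (hz.trans hz')
    obtain ⟨c, hc⟩ := weight_mid_f hP hpos ha hv hF
    have e1 : ∀ᶠ v : ℝ × ℝ × ℝ in 𝓝 (x, y, z), 0 < v.2.2 :=
      hc2.continuousAt.eventually_const_lt hz
    have e2 : ∀ᶠ v : ℝ × ℝ × ℝ in 𝓝 (x, y, z), v.2.2 < B.f (v.1, v.2.1) :=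
      hc2.continuousAt.eventually_lt (B.continuous_f.comp (by fun_prop)).continuousAt hz'
    filter_upwards [e1, e2, (isOpen_box _ _).mem_nhds hu] with ⟨x', y', z'⟩ e1 e2 e3
    refine ⟨e3, ?_⟩
    have hb3 := mem_box.1 e3
    obtain ⟨k1, k2⟩ := chordWeights_f (a := a) hb3.1.1 hb3.1.2 hb3.2.1.2 e1 e2
    obtain ⟨l1, l2⟩ := chordWeights_f (a := a) hb0.1.1 hb0.1.2 hb0.2.1.2 hz hz'
    rw [k2, l2, hc x' y' hb3.1.1 hb3.1.2 k1 hb3.2.1.2, hc x y hb0.1.1 hb0.1.2 l1 hb0.2.1.2,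
      weight_top hP hpos hF (mem_graph hb3.1.1 hb3.1.2 k1 hb3.2.1.2)
        (mem_graph hb0.1.1 hb0.1.2 l1 hb0.2.1.2)]
  · have hG : B.HasG := hasG_of_pos (u := (x, y)) (by linarith)
    obtain ⟨c, hc⟩ := weight_mid_g hP hpos ha hv hG
    have e1 : ∀ᶠ v : ℝ × ℝ × ℝ in 𝓝 (x, y, z), v.2.2 < 0 :=
      hc2.continuousAt.eventually_lt_const hz'
    have e2 : ∀ᶠ v : ℝ × ℝ × ℝ in 𝓝 (x, y, z), -B.g (v.1, v.2.1) < v.2.2 :=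
      (B.continuous_g.comp (by fun_prop)).neg.continuousAt.eventually_lt hc2.continuousAt hz
    filter_upwards [e1, e2, (isOpen_box _ _).mem_nhds hu] with ⟨x', y', z'⟩ e1 e2 e3
    refine ⟨e3, ?_⟩
    have hb3 := mem_box.1 e3
    obtain ⟨k1, k2⟩ := chordWeights_g (a := a) hb3.1.2 hb3.2.1.1 hb3.2.1.2 e2 e1
    obtain ⟨l1, l2⟩ := chordWeights_g (a := a) hb0.1.2 hb0.2.1.1 hb0.2.1.2 hz hz'
    have m1 : B.pt (x', y', -B.g (x', y')) ∈ B.bot :=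
      mem_graph (k := -B.g) k1 hb3.1.2 hb3.2.1.1 hb3.2.1.2
    have m2 : B.pt (x, y, -B.g (x, y)) ∈ B.bot :=
      mem_graph (k := -B.g) l1 hb0.1.2 hb0.2.1.1 hb0.2.1.2
    rw [k2, l2, hc x' y' k1 hb3.1.2 hb3.2.1.1 hb3.2.1.2, hc x y l1 hb0.1.2 hb0.2.1.1 hb0.2.1.2,
      weight_of_regular (bot_subset hP hpos hG m1), weight_of_regular (bot_subset hP hpos hG m2),
      comp_eq_of_mem B.isPreconnected_bot (bot_subset hP hpos hG) m1 m2]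

end FoldBox

variable [IsManifold 𝓘(ℝ, E3) 1 M]

/-- Short chords are contained in boxes. -/
lemma exists_short_in_box (hP : IsFlowSpine o F P) (hpos : IsPositiveSpine o F P) :
    ∃ ε > 0, ∀ q ∈ P, ∀ t, 0 < t → t < ε → ∃ p, ∃ B : FoldBox o F P p, ∃ x y z,
      (x, y, z) ∈ box B.r B.h ∧ (x, y, z + t) ∈ box B.r B.h ∧ B.pt (x, y, z) = q := by
  refine hP.compact.induction_on (p := fun s => ∃ ε > 0, ∀ q ∈ s, ∀ t, 0 < t → t < ε →
    ∃ p, ∃ B : FoldBox o F P p, ∃ x y z,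
      (x, y, z) ∈ box B.r B.h ∧ (x, y, z + t) ∈ box B.r B.h ∧ B.pt (x, y, z) = q)
    ⟨1, one_pos, by simp⟩ ?_ ?_ ?_
  · rintro s t hst ⟨ε, hε, h⟩
    exact ⟨ε, hε, fun q hq => h q (hst hq)⟩
  · rintro s t ⟨ε, hε, h⟩ ⟨ε', hε', h'⟩
    refine ⟨min ε ε', lt_min hε hε', fun q hq t h1 h2 => ?_⟩
    rw [lt_min_iff] at h2
    exact hq.elim (fun hq => h q hq t h1 h2.1) (fun hq => h' q hq t h1 h2.2)
  · intro p hp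
    obtain ⟨B, -⟩ := exists_foldBox hP hpos hp univ_mem
    have hh := B.h_pos
    have key : ∀ᶠ q in 𝓝 (B.pt (0, 0, 0)), ∃ x y z, (x, y, z) ∈ box B.r B.h ∧ z < B.h / 2 ∧
        B.pt (x, y, z) = q := by
      rw [B.eventually_nhds B.zero_mem]
      have h1 : ∀ᶠ v : ℝ × ℝ × ℝ in 𝓝 (0, 0, 0), v.2.2 < B.h / 2 :=
        (by fun_prop : Continuous fun v : ℝ × ℝ × ℝ => v.2.2).continuousAt.eventually_lt
          continuousAt_const (by simp only []; linarith)
      filter_upwards [h1, (isOpen_box _ _).mem_nhds B.zero_mem] with ⟨x, y, z⟩ h1 h2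
      exact ⟨h2, x, y, z, h2, h1, rfl⟩
    rw [B.pt_zero] at key
    -- A start below height `h / 2` and a time below `h / 2` end below the top of the box.
    refine ⟨_, mem_nhdsWithin_of_mem_nhds key, B.h / 2, by linarith, ?_⟩
    rintro q ⟨x, y, z, h1, h2, h3⟩ t ht1 ht2
    refine ⟨p, B, x, y, z, h1, ?_, h3⟩
    rw [mem_box] at h1 ⊢
    exact ⟨h1.1, h1.2.1, by linarith [h1.2.2.1], by linarith⟩

/-- Since the complement of the spine is a ball, all edges have the same weights. -/
lemma reg_weight_eq [CompactSpace M] [T2Space M] (hP : IsFlowSpine o F P)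
    (hpos : IsPositiveSpine o F P)
    (ha : IsBalanced o F P a) (hv : VanishesAtVertices o F P a) {p p' : M}
    (hp : p ∈ singularSet o F P \ vertexSet o F P)
    (hp' : p' ∈ singularSet o F P \ vertexSet o F P) :
    a (reg o F P .upper p) = a (reg o F P .upper p') ∧
      a (reg o F P .lower p) = a (reg o F P .lower p') := by
  obtain ⟨ψ, hψ⟩ := hP.complement
  obtain ⟨ε, hε, hbox⟩ := exists_short_in_box hP hpos
  -- Half of `ε` in each direction makes the whole chord shorter than `ε`, so that it fits into a
  -- box.
  obtain ⟨R, hR0, hR1, hR⟩ := exists_radius_short (ψ := ψ) hψ hP hpos (half_pos hε)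
  obtain ⟨δ, hδ, hδR⟩ := exists_not_short (ψ := ψ) hψ hP hR1
  have hconst : ∀ q ∈ {q | R < radius ψ q}, ∀ q' ∈ {q | R < radius ψ q},
      chordWeights o F P a q = chordWeights o F P a q' := by
    intro q hq q' hq'
    refine eq_of_isPreconnected (isPreconnected_annulus hR0)
      (f := fun q : ↥(Pᶜ) => chordWeights o F P a q) ?_ hq hq'
    intro q hq
    obtain ⟨⟨t1, h1, h1', h1P⟩, t2, h2, h2', h2P⟩ := hR q hq
    obtain ⟨p, B, x, y, z, hb1, hb2, hpt⟩ := hbox _ h2P (t1 + t2) (by linarith) (by linarith)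
    have hb1' := mem_box.1 hb1
    have hb2' := mem_box.1 hb2
    have hbq : (x, y, z + t2) ∈ box B.r B.h :=
      mem_box.2 ⟨hb1'.1, hb1'.2.1, by linarith [hb1'.2.2.1], by linarith [hb2'.2.2.2]⟩
    have hq1 : B.pt (x, y, z + t2) = q := by
      rw [← B.flow_pt hb1 hbq, hpt, ← F.map_add, add_neg_cancel, F.map_zero_apply]
    have hq2 : B.pt (x, y, z + (t1 + t2)) = F t1 q := by
      rw [← B.flow_pt hb1 hb2, hpt, ← F.map_add, add_neg_cancel_right]
    have hev := B.eventually_chordWeights_eq hP hpos ha hv hb1 hb2 (z := z + t2) (by linarith)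
      (by linarith) ((B.pt_mem_iff hb1).1 (by rwa [hpt])) ((B.pt_mem_iff hb2).1 (by rwa [hq2]))
      (fun h => q.2 (by rw [← hq1]; exact (B.pt_mem_iff hbq).2 h))
    rw [hq1] at hev
    exact mem_nhdsWithin_of_mem_nhds (continuous_subtype_val.continuousAt.eventually hev)
  -- Close to the edge the two sheets are less than `δ` apart, so the point halfway between them
  -- lies on a chord near the boundary cylinder. The ends of this chord are on the lower and the
  -- upper sheet of the edge.
  have key : ∀ p ∈ singularSet o F P \ vertexSet o F P, ∃ q ∈ {q | R < radius ψ q},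
      chordWeights o F P a q = {(a (reg o F P .lower p), a (reg o F P .upper p))} := by
    intro p hp
    obtain ⟨B, hF, hG, -⟩ := exists_edgeBox hP hpos hp univ_mem
    have hr := B.r_pos
    have h1 := FoldBox.eventually_small_line (a := 0) (b := 0) (c := 0) (d := 1) B.continuous_f
      (by rw [B.f_eq_zero le_rfl]; exact hδ)
    obtain ⟨y, hy1, hy2⟩ := (h1.and (FoldBox.eventually_small_pos hr)).exists
    simp only [mul_zero, add_zero, mul_one, zero_add] at hy1
    have hf := hF.pos (x := 0) hy2.1
    have hb0 := B.mem_box_zero (x := 0) (y := y) (by linarith) hr (by linarith) hy2.2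
    have hb1 := B.mem_box_f (x := 0) (y := y) (by linarith) hr (by linarith) hy2.2
    have hb0' := mem_box.1 hb0
    have hb1' := mem_box.1 hb1
    have hbm : (0, y, B.f (0, y) / 2) ∈ box B.r B.h :=
      mem_box.2 ⟨hb0'.1, hb0'.2.1, by linarith [hb0'.2.2.1], by linarith [hb1'.2.2.2]⟩
    have hqP : B.pt (0, y, B.f (0, y) / 2) ∉ P := by
      rw [B.pt_mem_iff hbm]
      have := B.g_nonneg (0, y)
      rintro (h | h | h) <;> linarith
    refine ⟨⟨_, hqP⟩, hδR _ ?_ ?_, ?_⟩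
    · refine ⟨B.f (0, y) / 2, by linarith, by linarith, ?_⟩
      simp only []
      rw [B.flow_pt hbm (by rwa [add_halves]), add_halves]
      exact (B.pt_mem_iff hb1).2 (Or.inr (Or.inl rfl))
    · refine ⟨B.f (0, y) / 2, by linarith, by linarith, ?_⟩
      simp only []
      rw [B.flow_pt hbm (by rwa [add_neg_cancel]), add_neg_cancel]
      exact (B.pt_mem_iff hb0).2 (Or.inl rfl)
    · have h2 : B.pt (0, y, 0) ∈ B.edgeSheet .lower :=
        FoldBox.mem_graph (k := 0) (by linarith) hr hy2.1 hy2.2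
      have h3 : B.pt (0, y, B.f (0, y)) ∈ B.edgeSheet .upper :=
        FoldBox.mem_graph (by linarith) hr hy2.1 hy2.2
      rw [(B.chordWeights_f (a := a) (x := 0) (y := y) (z := B.f (0, y) / 2) (by linarith) hr
        hy2.2 (by linarith) (by linarith)).2,
        weight_of_regular (FoldBox.edgeSheet_subset hP hpos hF hG _ h2),
        weight_of_regular (FoldBox.edgeSheet_subset hP hpos hF hG _ h3),
        FoldBox.reg_eq_of_mem_edgeSheet hP hpos hF hG h2,
        FoldBox.reg_eq_of_mem_edgeSheet hP hpos hF hG h3]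
  obtain ⟨q, hq, hqe⟩ := key p hp
  obtain ⟨q', hq', hqe'⟩ := key p' hp'
  have := hconst q hq q' hq'
  rw [hqe, hqe', singleton_eq_singleton_iff, Prod.mk.injEq] at this
  exact ⟨this.2, this.1⟩

end FlowSpine

namespace FlowSpine

open Set Filter Topology

variable {M : Type*} [TopologicalSpace M] [ChartedSpace E3 M]
variable {o : Orientation3 M} {F : Flow ℝ M} {P : Set M}

/-! ### The spine is connected -/

omit [ChartedSpace E3 M] in
lemma exists_firstUp (hP : IsClosed P) {q : M} (hq : q ∉ P) {t : ℝ} (ht : 0 < t)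
    (hqt : F t q ∈ P) : ∃ p, FirstUp F P q p := by
  have hc : Continuous fun s : ℝ => F s q := F.continuous continuous_id continuous_const
  have hK : IsCompact (Icc 0 t ∩ (fun s => F s q) ⁻¹' P) :=
    isCompact_Icc.inter_right (hP.preimage hc)
  obtain ⟨s, ⟨⟨hs0, hst⟩, hsP⟩, hmin⟩ := hK.exists_isLeast ⟨t, ⟨ht.le, le_rfl⟩, hqt⟩
  refine ⟨F s q, s, hs0.lt_of_ne ?_, rfl, hsP, fun s' h1 h2 h3 => ?_⟩
  · rintro rfl
    rw [mem_preimage, F.map_zero_apply] at hsP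
    exact hq hsP
  · exact (hmin ⟨⟨h1.le, h2.le.trans hst⟩, h3⟩).not_gt h2

variable [IsManifold 𝓘(ℝ, E3) 1 M]

/-- Every flow line hits the spine. -/
lemma exists_hit [CompactSpace M] [T2Space M] (hP : IsFlowSpine o F P)
    (hpos : IsPositiveSpine o F P) {q : M} (hq : q ∉ P) : ∃ t > 0, F t q ∈ P := by
  classical
  by_contra! hno
  have hno' : ∀ t, 0 ≤ t → F t q ∉ P := by
    intro t ht
    rcases ht.eq_or_lt with rfl | ht
    · rwa [F.map_zero_apply]
    · exact hno t ht
  have hPc := hP.compact.isClosed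
  obtain ⟨ψ, hψ⟩ := hP.complement
  -- A limit point in `P` would produce hits at arbitrarily late times.
  have hcl : ∀ y, MapClusterPt y atTop (fun t : ℝ => F t q) → y ∉ P := by
    intro y hy hyP
    have h1 := hy.frequently (eventually_hit hP hpos hyP one_pos)
    obtain ⟨t, ⟨s, hs, hsP⟩, ht⟩ := (h1.and_eventually (eventually_ge_atTop 1)).exists
    rw [← F.map_add] at hsP
    exact hno' _ (by linarith [(abs_lt.1 hs).1]) hsP
  obtain ⟨y, -, hy⟩ := isCompact_univ.exists_mapClusterPt_of_frequently (l := atTop)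
    (f := fun t : ℝ => F t q) (Frequently.of_forall fun _ => mem_univ _)
  have hyr : ∀ r : ℝ, MapClusterPt (F r y) atTop (fun t : ℝ => F t q) := by
    intro r
    have hc : Continuous (F r) := F.continuous continuous_const continuous_id
    have h1 := hy.continuousAt_comp (f := F r) hc.continuousAt
    have h2 : (F r ∘ fun t : ℝ => F t q) = (fun t : ℝ => F t q) ∘ fun t => r + t := by
      ext t
      exact (F.map_add r t q).symm
    rw [h2] at h1
    exact h1.of_comp (tendsto_atTop_add_const_left _ _ tendsto_id)
  set H : M → ℝ := fun x => if h : x ∈ Pᶜ then (ψ ⟨x, h⟩ : E3) 2 else 0 with hH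
  have hHW : ∀ x : ↥(Pᶜ), H x = (ψ x : E3) 2 := fun x => dif_pos x.2
  have hHc : ∀ x ∉ P, ContinuousAt H x := by
    intro x hx
    have hxc : x ∈ Pᶜ := hx
    have h1 : ContinuousOn H Pᶜ := by
      rw [continuousOn_iff_continuous_domRestrict]
      have : (Pᶜ).domRestrict H = fun x => (ψ x : E3) 2 := funext hHW
      rw [this]
      exact continuous_coord 2
    exact h1.continuousAt (hPc.isOpen_compl.mem_nhds hxc)
  have hinc : ∀ (x : M) (t : ℝ), 0 < t → (∀ s ∈ Icc 0 t, F s x ∈ Pᶜ) → H x < H (F t x) := by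
    intro x t ht hW
    have hx : x ∈ Pᶜ := by simpa using hW 0 ⟨le_rfl, ht.le⟩
    have hxt : F t x ∈ Pᶜ := hW t ⟨ht.le, le_rfl⟩
    have := (hψ ⟨x, hx⟩ ⟨_, hxt⟩ t ht hW rfl).2.2
    rwa [← hHW, ← hHW] at this
  have hmono : MonotoneOn (fun t : ℝ => H (F t q)) (Ici 0) := by
    intro s hs t ht hst
    rcases hst.eq_or_lt with rfl | hst
    · exact le_rfl
    · have hs' : (0 : ℝ) ≤ s := hs
      have := hinc (F s q) (t - s) (by linarith) (fun r hr => by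
        rw [← F.map_add]
        exact hno' _ (by linarith [hr.1]))
      rw [← F.map_add, sub_add_cancel] at this
      exact this.le
  have hlim : ∃ l, Tendsto (fun t : ℝ => H (F t q)) atTop (𝓝 l) := by
    -- Freezing the flow line before time zero turns monotonicity on the half-line into monotonicity
    -- on the whole line.
    have hm : Monotone fun t : ℝ => H (F (max t 0) q) := fun s t hst =>
      hmono (mem_Ici.2 (le_max_right _ _)) (mem_Ici.2 (le_max_right _ _)) (max_le_max_right 0 hst)
    have hbdd : BddAbove (range fun t : ℝ => H (F (max t 0) q)) := by
      refine ⟨1, ?_⟩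
      rintro _ ⟨t, rfl⟩
      have hW : F (max t 0) q ∈ Pᶜ := hno' _ (le_max_right _ _)
      have h1 := (mem_ball_iff _).1 (ψ ⟨_, hW⟩).2
      simp only []
      rw [hHW ⟨_, hW⟩]
      nlinarith [sq_nonneg ((ψ ⟨_, hW⟩ : E3) 0), sq_nonneg ((ψ ⟨_, hW⟩ : E3) 1)]
    refine ⟨_, (tendsto_atTop_ciSup hm hbdd).congr' ?_⟩
    filter_upwards [eventually_ge_atTop 0] with t ht
    rw [max_eq_left ht]
  obtain ⟨l, hl⟩ := hlim
  have hval : ∀ r : ℝ, H (F r y) = l := by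
    intro r
    have h1 := (hyr r).continuousAt_comp (hHc _ (hcl _ (hyr r)))
    exact eq_of_nhds_neBot (h1.neBot.mono (inf_le_inf_left _ hl))
  -- The height has to be the limit `l` on the whole flow line of the limit point `y`, but it
  -- increases strictly along it.
  have := hinc y 1 one_pos (fun s _ => hcl _ (hyr s))
  have h0 := hval 0
  rw [F.map_zero_apply] at h0
  rw [h0, hval 1] at this
  exact this.false

namespace FoldBox

variable {p : M} {B : FoldBox o F P p}

omit [IsManifold 𝓘(ℝ, E3) 1 M] in
/-- Below the bottom sheet, the flow first hits the bottom sheet. -/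
lemma pt_notMem_of_lt {x y z : ℝ} (hu : (x, y, z) ∈ box B.r B.h) (hz : z < -B.g (x, y)) :
    B.pt (x, y, z) ∉ P := by
  rw [B.pt_mem_iff hu]
  have hf := B.f_nonneg (x, y)
  have hg := B.g_nonneg (x, y)
  rintro (h | h | h) <;> linarith

omit [IsManifold 𝓘(ℝ, E3) 1 M] in
-- The bottom sheet is the lowest of the sheets, so a flow line that arrives beneath it meets it
-- before any other sheet.
lemma firstUp_of_below {x y z t : ℝ} {q : M} (hu : (x, y, z) ∈ box B.r B.h)
    (hz : z < -B.g (x, y)) (hq : F t q = B.pt (x, y, z)) (ht : 0 ≤ t)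
    (h : ∀ s ∈ Icc 0 t, F s q ∉ P) : FirstUp F P q (B.pt (x, y, -B.g (x, y))) := by
  have hb := mem_box.1 hu
  have hg := B.mem_box_g hb.1.1 hb.1.2 hb.2.1.1 hb.2.1.2
  have hb' := mem_box.1 hg
  refine ⟨-B.g (x, y) - z + t, by linarith, ?_, (B.pt_mem_iff hg).2 (Or.inr (Or.inr rfl)), ?_⟩
  · rw [F.map_add, hq, B.flow_pt hu (by simpa using hg), add_sub_cancel]
  · intro s h1 h2
    by_cases hs : s ≤ t
    · exact h s ⟨h1.le, hs⟩
    · push Not at hs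
      have h3 : F s q = F (s - t) (B.pt (x, y, z)) := by rw [← hq, ← F.map_add, sub_add_cancel]
      have h4 : (x, y, z + (s - t)) ∈ box B.r B.h :=
        mem_box.2 ⟨hb.1, hb.2.1, by linarith, by linarith⟩
      rw [h3, B.flow_pt hu h4]
      exact pt_notMem_of_lt h4 (by linarith)

end FoldBox

/-- Sending a point of the complement to the first point of `P` on its flow line is a map from a
connected set onto `P`. It is continuous: a flow line enters the box centred at its end from below,
and its neighbours land on the bottom sheet near that end. The proof checks this for the two parts
of a closed partition of `P`. -/
lemma isPreconnected_spine [CompactSpace M] [T2Space M] (hP : IsFlowSpine o F P)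
    (hpos : IsPositiveSpine o F P) : IsPreconnected P := by
  have hPc := hP.compact.isClosed
  rw [isPreconnected_iff_subset_of_disjoint_closed]
  intro u v hu hv huv hdisj
  have hnot : ∀ p ∈ P, p ∈ u → p ∉ v := fun p h1 h2 h3 => by
    have : p ∈ P ∩ (u ∩ v) := ⟨h1, h2, h3⟩
    rw [hdisj] at this
    exact this
  have hW : IsPreconnected (univ : Set ↥(Pᶜ)) := by
    obtain ⟨ψ, -⟩ := hP.complement
    have : IsPreconnected (univ : Set ↥(Metric.ball (0 : E3) 1)) := by
      rw [← IsInducing.subtypeVal.isPreconnected_image, image_univ, Subtype.range_coe]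
      exact (convex_ball _ _).isPreconnected
    rwa [← ψ.isPreconnected_preimage, preimage_univ] at this
  have hloc : ∀ q ∈ (univ : Set ↥(Pᶜ)), ∀ᶠ q' : ↥(Pᶜ) in 𝓝[univ] q,
      (∃ p ∈ u, FirstUp F P (q' : M) p) = ∃ p ∈ u, FirstUp F P (q : M) p := by
    intro q _
    obtain ⟨t', ht', hqt'⟩ := exists_hit hP hpos q.2
    obtain ⟨p, hp⟩ := exists_firstUp hPc q.2 ht' hqt'
    obtain ⟨t, ht, htp, hpP, hfirst⟩ := hp
    obtain ⟨O, hO, hOu⟩ : ∃ O ∈ 𝓝 p, ∀ p' ∈ P, p' ∈ O → (p' ∈ u ↔ p ∈ u) := by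
      by_cases hpu : p ∈ u
      · refine ⟨vᶜ, hv.isOpen_compl.mem_nhds (hnot p hpP hpu), fun p' h1 h2 => ?_⟩
        exact iff_of_true ((huv h1).resolve_right h2) hpu
      · exact ⟨uᶜ, hu.isOpen_compl.mem_nhds hpu, fun p' h1 h2 => iff_of_false h2 hpu⟩
    obtain ⟨B, hB⟩ := exists_foldBox hP hpos hpP hO
    have hh := B.h_pos
    have hr := B.r_pos
    -- Stopping at time `t - η` gives a point of the flow line that is inside the box but still
    -- below all sheets.
    obtain ⟨η, hη, hηh, hηt⟩ : ∃ η, 0 < η ∧ η < B.h ∧ η < t :=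
      ⟨min (B.h / 2) (t / 2), lt_min (by linarith) (by linarith),
        by have := min_le_left (B.h / 2) (t / 2); linarith,
        by have := min_le_right (B.h / 2) (t / 2); linarith⟩
    have hbη : (0, 0, -η) ∈ box B.r B.h :=
      mem_box.2 ⟨⟨by linarith, hr⟩, ⟨by linarith, hr⟩, by linarith, by linarith⟩
    have hg0 : B.g (0, 0) = 0 := B.g_eq_zero le_rfl
    have hqη : F (t - η) (q : M) = B.pt (0, 0, -η) := by
      calc F (t - η) (q : M) = F (-η) (F t (q : M)) := by
            rw [← F.map_add]
            congr 1
            ring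
        _ = F (-η) (B.pt (0, 0, 0)) := by rw [htp, B.pt_zero]
        _ = B.pt (0, 0, -η) := by
            rw [B.flow_pt B.zero_mem (by simpa using hbη), zero_add]
    have e1 : ∀ᶠ x in 𝓝 (B.pt (0, 0, -η)), ∃ a b c, (a, b, c) ∈ box B.r B.h ∧
        c < -B.g (a, b) ∧ B.pt (a, b, c) = x := by
      rw [B.eventually_nhds hbη]
      have h1 : ∀ᶠ w : ℝ × ℝ × ℝ in 𝓝 (0, 0, -η), w.2.2 < -B.g (w.1, w.2.1) :=
        (by fun_prop : Continuous fun w : ℝ × ℝ × ℝ => w.2.2).continuousAt.eventually_lt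
          (B.continuous_g.comp (by fun_prop)).neg.continuousAt (by simp [hg0, hη])
      filter_upwards [h1, (isOpen_box _ _).mem_nhds hbη] with ⟨a, b, c⟩ h1 h2
      exact ⟨h2, a, b, c, h2, h1, rfl⟩
    have hc : Continuous fun x : M => F (t - η) x := F.continuous continuous_const continuous_id
    rw [← hqη] at e1
    have e2 := hc.continuousAt.eventually e1
    have e3 : ∀ᶠ x in 𝓝 (q : M), ∀ s ∈ Icc 0 (t - η), F s x ∈ Pᶜ := by
      refine isCompact_Icc.eventually_forall_of_forall_eventually fun s hs => ?_
      have hc2 : Continuous fun w : M × ℝ => F w.2 w.1 :=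
        F.continuous continuous_snd continuous_fst
      refine hc2.continuousAt.eventually (hPc.isOpen_compl.mem_nhds ?_)
      change F s (q : M) ∈ Pᶜ
      rcases hs.1.eq_or_lt with rfl | hs0
      · rw [F.map_zero_apply]
        exact q.2
      · exact hfirst s hs0 (by linarith [hs.2])
    have main : ∀ x : M, (∃ a b c, (a, b, c) ∈ box B.r B.h ∧ c < -B.g (a, b) ∧
        B.pt (a, b, c) = F (t - η) x) → (∀ s ∈ Icc 0 (t - η), F s x ∈ Pᶜ) →
        ((∃ p ∈ u, FirstUp F P x p) ↔ p ∈ u) := by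
      rintro x ⟨a, b, c, h1, h2, h3⟩ h4
      have h5 := FoldBox.firstUp_of_below h1 h2 h3.symm (by linarith) h4
      have hb := mem_box.1 h1
      have h6 := B.mem_box_g hb.1.1 hb.1.2 hb.2.1.1 hb.2.1.2
      have h7 := hOu _ ((B.pt_mem_iff h6).2 (Or.inr (Or.inr rfl))) (hB (B.pt_mem_source h6))
      rw [← h7]
      constructor
      · rintro ⟨p', hp'u, hp'⟩
        rwa [← hp'.unique h5]
      · intro h
        exact ⟨_, h, h5⟩
    rw [nhdsWithin_univ]
    filter_upwards [continuous_subtype_val.continuousAt.eventually e2,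
      continuous_subtype_val.continuousAt.eventually e3] with q' h1 h2
    exact propext ((main q' h1 h2).trans (main q e2.self_of_nhds e3.self_of_nhds).symm)
  have hbelow : ∀ p ∈ P, ∃ q : ↥(Pᶜ), FirstUp F P (q : M) p := by
    intro p hp
    obtain ⟨B, -⟩ := exists_foldBox hP hpos hp univ_mem
    have hh := B.h_pos
    have hr := B.r_pos
    have hg0 : B.g (0, 0) = 0 := B.g_eq_zero le_rfl
    have hb : (0, 0, -(B.h / 2)) ∈ box B.r B.h :=
      mem_box.2 ⟨⟨by linarith, hr⟩, ⟨by linarith, hr⟩, by linarith, by linarith⟩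
    have hlt : -(B.h / 2) < -B.g (0, 0) := by rw [hg0]; linarith
    have hqP := FoldBox.pt_notMem_of_lt hb hlt
    refine ⟨⟨_, hqP⟩, ?_⟩
    have := FoldBox.firstUp_of_below hb hlt (F.map_zero_apply _) le_rfl (fun s hs => by
      rw [Icc_self, mem_singleton_iff] at hs
      rwa [hs, F.map_zero_apply])
    rwa [hg0, neg_zero, B.pt_zero] at this
  by_cases hex : ∃ q : ↥(Pᶜ), ∃ p ∈ u, FirstUp F P (q : M) p
  · left
    intro p hp
    obtain ⟨q, hq⟩ := hbelow p hp
    obtain ⟨q0, hq0⟩ := hex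
    have := eq_of_isPreconnected hW hloc (mem_univ q0) (mem_univ q)
    obtain ⟨p', hp'u, hp'⟩ : ∃ p ∈ u, FirstUp F P (q : M) p := this ▸ hq0
    rwa [hq.unique hp']
  · right
    intro p hp
    obtain ⟨q, hq⟩ := hbelow p hp
    exact (huv hp).resolve_left fun h => hex ⟨q, p, h, hq⟩

end FlowSpine

namespace FlowSpine

open Set Filter Topology

/-! ### Orientation of the edges -/

lemma det_eq (D : E3 →L[ℝ] E3) : D.det =
    D (vec (1, 0, 0)) 0 * D (vec (0, 1, 0)) 1 * D (vec (0, 0, 1)) 2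
      - D (vec (1, 0, 0)) 0 * D (vec (0, 0, 1)) 1 * D (vec (0, 1, 0)) 2
      - D (vec (0, 1, 0)) 0 * D (vec (1, 0, 0)) 1 * D (vec (0, 0, 1)) 2
      + D (vec (0, 1, 0)) 0 * D (vec (0, 0, 1)) 1 * D (vec (1, 0, 0)) 2
      + D (vec (0, 0, 1)) 0 * D (vec (1, 0, 0)) 1 * D (vec (0, 1, 0)) 2
      - D (vec (0, 0, 1)) 0 * D (vec (0, 1, 0)) 1 * D (vec (1, 0, 0)) 2 := by
  have e0 : vec (1, 0, 0) = EuclideanSpace.single 0 1 := by ext i; fin_cases i <;> simp [vec]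
  have e1 : vec (0, 1, 0) = EuclideanSpace.single 1 1 := by ext i; fin_cases i <;> simp [vec]
  have e2 : vec (0, 0, 1) = EuclideanSpace.single 2 1 := by ext i; fin_cases i <;> simp [vec]
  rw [ContinuousLinearMap.det,
    ← LinearMap.det_toMatrix (EuclideanSpace.basisFun (Fin 3) ℝ).toBasis, Matrix.det_fin_three]
  simp only [LinearMap.toMatrix_apply, e0, e1, e2]
  simp

lemma nonneg_of_hasDerivAt {k : ℝ → ℝ} {d : ℝ} (hk : HasDerivAt k d 0) (h0 : k 0 = 0)
    (h : ∀ᶠ s in 𝓝[>] 0, 0 ≤ k s) : 0 ≤ d := by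
  have h1 := (hasDerivAt_iff_tendsto_slope.1 hk).mono_left
    (nhdsWithin_mono 0 (fun x (hx : x ∈ Ioi (0 : ℝ)) => (ne_of_gt hx : x ≠ 0)))
  refine ge_of_tendsto h1 ?_
  filter_upwards [h, self_mem_nhdsWithin] with s hs hs'
  rw [slope_def_field, h0, sub_zero, sub_zero]
  exact div_nonneg hs (le_of_lt hs')

lemma vec_add_smul (u w : ℝ × ℝ × ℝ) (s : ℝ) : vec (u + s • w) = vec u + s • vec w := by
  ext i
  fin_cases i <;> simp [vec]

/-- The oriented edges of a box: the first axis, and the second axis in the negative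
direction. -/
def axis : Bool → ℝ → ℝ × ℝ × ℝ
  | false, t => (t, 0, 0)
  | true, t => (0, -t, 0)

/-- The direction to the side of an edge where there are two sheets. -/
def side : Bool → ℝ × ℝ × ℝ
  | false => (0, 1, 0)
  | true => (1, 0, 0)

/-- The coordinate along an oriented edge. -/
def along : Bool → ℝ × ℝ × ℝ → ℝ
  | false, u => u.1
  | true, u => -u.2.1

/-- The coordinate which is positive on the side where there are two sheets. -/
def across : Bool → ℝ × ℝ × ℝ → ℝ
  | false, u => u.2.1
  | true, u => u.1

lemma axis_add (b : Bool) (s t : ℝ) : axis b (s + t) = axis b s + t • axis b 1 := by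
  cases b <;> simp [axis, add_comm]

lemma axis_zero (b : Bool) : axis b 0 = (0, 0, 0) := by
  cases b <;> simp [axis]

lemma continuous_axis (b : Bool) : Continuous (axis b) := by
  cases b <;> unfold axis <;> fun_prop

lemma along_axis (b : Bool) (t : ℝ) : along b (axis b t) = t := by
  cases b <;> simp [axis, along]

lemma across_axis (b : Bool) (t : ℝ) : across b (axis b t) = 0 := by
  cases b <;> simp [axis, across]

/-- A linear map which preserves the vertical direction, and the line and the half-plane spanned
by an edge, preserves the direction of the edge if its determinant is positive. -/
lemma along_pos_of_det_pos {D : E3 →L[ℝ] E3} (hD : 0 < D.det) (b b' : Bool)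
    (hz : D (vec (0, 0, 1)) = vec (0, 0, 1))
    (hu : across b' (vecHomeo.symm (D (vec (axis b 1)))) = 0)
    (hu2 : D (vec (axis b 1)) 2 = 0)
    (hw : 0 ≤ across b' (vecHomeo.symm (D (vec (side b))))) :
    0 < along b' (vecHomeo.symm (D (vec (axis b 1)))) := by
  have hneg : vec (0, -1, 0) = -vec (0, 1, 0) := by ext i; fin_cases i <;> simp [vec]
  have hsymm : ∀ v : E3, vecHomeo.symm v = (v 0, v 1, v 2) := fun _ => rfl
  rw [det_eq, hz] at hD
  simp only [hsymm] at *
  -- For both kinds of axes, `axis b 1`, `side b` and the vertical vector form a positive frame. In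
  -- these frames the map is triangular, and its determinant is the product of the component along
  -- the edge and the component across it.
  cases b <;> cases b' <;>
    simp only [axis, side, along, across, hneg, map_neg, PiLp.neg_apply, vec_zero, vec_one,
      vec_two, mul_one, mul_zero, sub_zero, add_zero, zero_mul, neg_eq_zero, neg_neg]
      at hu hu2 hw hD ⊢
  · rw [hu] at hD
    simp only [mul_zero, sub_zero] at hD
    exact pos_of_mul_pos_left hD hw
  · rw [hu] at hD
    simp only [zero_mul, zero_sub] at hD
    by_contra! h
    nlinarith
  · rw [hu] at hD
    simp only [mul_zero, zero_sub] at hD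
    by_contra! h
    nlinarith
  · rw [hu] at hD
    simp only [zero_mul, sub_zero] at hD
    by_contra! h
    nlinarith

/-! ### Transition maps between boxes along an edge -/

variable {M : Type*} [TopologicalSpace M] [ChartedSpace E3 M]

lemma differentiableAt_of_mem {φ ψ : OpenPartialHomeomorph M E3}
    (hφ : φ ∈ IsManifold.maximalAtlas 𝓘(ℝ, E3) 1 M)
    (hψ : ψ ∈ IsManifold.maximalAtlas 𝓘(ℝ, E3) 1 M) {v : E3} (hv : v ∈ (φ.symm.trans ψ).source) :
    DifferentiableAt ℝ (φ.symm.trans ψ) v := by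
  have h := IsManifold.compatible_of_mem_maximalAtlas hφ hψ
  rw [contDiffGroupoid, mem_groupoid_of_pregroupoid] at h
  have h2 := h.1
  simp only [contDiffPregroupoid, modelWithCornersSelf_coe, modelWithCornersSelf_coe_symm,
    Function.comp_id, Function.id_comp, range_id, inter_univ, preimage_id] at h2
  exact (h2.contDiffAt ((φ.symm.trans ψ).open_source.mem_nhds hv)).differentiableAt one_ne_zero

/-- Positive charts have orientation preserving transition maps. -/
lemma Orientation3.IsPositive.det_pos {o : Orientation3 M} {φ ψ : OpenPartialHomeomorph M E3}
    (hφ : o.IsPositive φ) (hψ : o.IsPositive ψ) {v : E3} (hv : v ∈ (φ.symm.trans ψ).source) :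
    0 < (fderiv ℝ (φ.symm.trans ψ) v).det := by
  have hv1 : v ∈ φ.target := hv.1
  have hv2 : φ.symm v ∈ ψ.source := hv.2
  obtain ⟨χ, hχ, hχs⟩ := o.cover (φ.symm v)
  have hχa := o.subset_maximalAtlas hχ
  have h1 : v ∈ (φ.symm.trans χ).source := ⟨hv1, hχs⟩
  have hw : ψ.symm (φ.symm.trans ψ v) = φ.symm v := ψ.left_inv hv2
  have h2 : φ.symm.trans ψ v ∈ (ψ.symm.trans χ).source :=
    ⟨ψ.map_source hv2, by
      change ψ.symm (φ.symm.trans ψ v) ∈ χ.source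
      rw [hw]
      exact hχs⟩
  have e : (φ.symm.trans χ) =ᶠ[𝓝 v] (ψ.symm.trans χ) ∘ (φ.symm.trans ψ) := by
    filter_upwards [(φ.symm.trans ψ).open_source.mem_nhds hv] with u hu
    have hu2 : φ.symm u ∈ ψ.source := hu.2
    exact congrArg χ (ψ.left_inv hu2).symm
  have d1 := differentiableAt_of_mem hφ.1 hψ.1 hv
  have d2 := differentiableAt_of_mem hψ.1 hχa h2
  have h3 := hφ.2 χ hχ v h1
  rw [e.fderiv_eq, fderiv_comp v d2 d1, ContinuousLinearMap.det,
    ContinuousLinearMap.toLinearMap_comp, LinearMap.det_comp] at h3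
  exact pos_of_mul_pos_right h3 (hψ.2 χ hχ _ h2).le

variable {o : Orientation3 M} {F : Flow ℝ M} {P : Set M}

namespace FoldBox

variable {p : M} (B : FoldBox o F P p)

/-- The coordinates of a point. -/
def coord (q : M) : ℝ × ℝ × ℝ := vecHomeo.symm (B.chart q)

lemma coord_pt {u : ℝ × ℝ × ℝ} (hu : u ∈ box B.r B.h) : B.coord (B.pt u) = u := by
  rw [coord, B.chart_pt hu]
  rfl

lemma pt_coord {q : M} (hq : q ∈ B.chart.source) : B.pt (B.coord q) = q := by
  obtain ⟨x, y, z, hu, rfl⟩ := B.exists_pt hq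
  rw [B.coord_pt hu]

lemma continuousAt_coord {q : M} (hq : q ∈ B.chart.source) : ContinuousAt B.coord q :=
  vecHomeo.symm.continuous.continuousAt.comp (B.chart.continuousAt hq)

/-- The parameter `t` corresponds to an edge point on the given axis. -/
structure IsArc (b : Bool) (t : ℝ) : Prop where
  hasF : B.HasF
  hasG : b = true → B.HasG
  lt : t < B.r
  gt : -B.r < t
  ne : t ≠ 0 ∨ ¬ B.HasG

variable {B} {b : Bool} {t : ℝ}

lemma axis_mem_box (h1 : t < B.r) (h2 : -B.r < t) : axis b t ∈ box B.r B.h := by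
  have := B.r_pos
  cases b
  · exact B.mem_box_zero h2 h1 (by linarith) this
  · exact B.mem_box_zero (by linarith) this (by linarith) (by linarith)

lemma IsArc.mem_box (h : B.IsArc b t) : axis b t ∈ box B.r B.h := axis_mem_box h.lt h.gt

lemma axis_eq_or (u : ℝ × ℝ × ℝ) (hB : u.2.2 = 0 ∧ ((u.2.1 = 0 ∧ B.HasF) ∨ (u.1 = 0 ∧ B.HasG))) :
    ∃ b, (b = true → B.HasG) ∧ u = axis b (along b u) := by
  obtain ⟨x, y, z⟩ := u
  obtain ⟨h1, ⟨h2, h3⟩ | ⟨h2, h3⟩⟩ := hB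
  · exact ⟨false, by simp, by simp_all [axis, along]⟩
  · exact ⟨true, fun _ => h3, by simp_all [axis, along]⟩

variable [IsManifold 𝓘(ℝ, E3) 1 M]

lemma IsArc.pt_mem (hP : IsFlowSpine o F P) (hpos : IsPositiveSpine o F P) (h : B.IsArc b t) :
    B.pt (axis b t) ∈ singularSet o F P \ vertexSet o F P := by
  cases b
  · exact pt_x_mem hP hpos h.hasF h.gt h.lt h.ne
  · exact pt_y_mem hP hpos (h.hasG rfl) (by linarith [h.lt]) (by linarith [h.gt])
      (neg_ne_zero.2 (h.ne.resolve_right (not_not.2 (h.hasG rfl))))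

/-- Near an edge point, the singular set is the edge. -/
lemma IsArc.eventually_eq (hP : IsFlowSpine o F P) (hpos : IsPositiveSpine o F P)
    (h : B.IsArc b t) : ∀ᶠ q in 𝓝 (B.pt (axis b t)), q ∈ singularSet o F P →
      q ∈ B.chart.source ∧ B.coord q = axis b (along b (B.coord q)) := by
  rw [B.eventually_nhds h.mem_box]
  have hne : ∀ᶠ u in 𝓝 (axis b t), along b u ≠ 0 ∨ ¬ B.HasG := by
    rcases h.ne with h' | h'
    · have hc : Continuous (along b) := by cases b <;> unfold along <;> fun_prop
      filter_upwards [hc.continuousAt.eventually_ne (by rwa [along_axis])] with u hu using Or.inl hu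
    · exact Eventually.of_forall fun u => Or.inr h'
  filter_upwards [hne, (isOpen_box _ _).mem_nhds h.mem_box] with ⟨x, y, z⟩ h1 h2
  refine ⟨h2, fun h3 => ⟨B.pt_mem_source h2, ?_⟩⟩
  rw [B.coord_pt h2]
  obtain ⟨rfl, h4⟩ := (pt_mem_singularSet hP hpos h2).1 h3
  cases b
  · rcases h4 with h4 | h4
    · simp [axis, along, h4.1]
    · rcases h1 with h1 | h1
      · exact (h1 h4.1).elim
      · exact (h1 h4.2).elim
  · have hG := h.hasG rfl
    have hy := h1.resolve_right (not_not.2 hG)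
    rcases h4 with h4 | h4
    · exact (hy (by simp [along, h4.1])).elim
    · simp [axis, along, h4.1]

omit [IsManifold 𝓘(ℝ, E3) 1 M] in
/-- Near an edge point, points with another sheet nearby are on the side of two sheets. -/
lemma IsArc.eventually_across_pos (h : B.IsArc b t) :
    ∃ δ > 0, ∀ᶠ q in 𝓝 (B.pt (axis b t)), q ∈ P → (Up F P δ q ∨ Dn F P δ q) →
      0 < across b (B.coord q) := by
  have hh := B.h_pos
  -- Near a point of one axis the fold function of the other has a gap, so two distinct sheets that
  -- are close to each other must be those which separate at this axis.
  obtain ⟨ε, hε, hgap⟩ : ∃ ε > 0, ∀ᶠ u : ℝ × ℝ × ℝ in 𝓝 (axis b t), ∀ z z',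
      sheets B.f B.g u.1 u.2.1 z → sheets B.f B.g u.1 u.2.1 z' → z ≠ z' →
      z < z' + ε → z' < z + ε → 0 < across b u := by
    cases b
    · obtain ⟨ε, hε, hg⟩ := B.g_gap (x := t) (y := 0) 0 h.ne
      refine ⟨ε, hε, ?_⟩
      filter_upwards [hg] with u hu z z' h1 h2 h3 h4 h5
      have hf0 := B.f_nonneg (u.1, u.2.1)
      have hg0 := B.g_nonneg (u.1, u.2.1)
      refine pos_of_f_pos (B := B) (x := u.1) (y := u.2.1) (hf0.lt_of_ne fun h6 => ?_)
      unfold sheets at h1 h2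
      rw [← h6] at h1 h2
      rcases h1 with h1 | h1 | h1 <;> rcases h2 with h2 | h2 | h2 <;>
        first
        | (apply h3; linarith)
        | (rcases hu with hu | hu
           · apply h3; linarith
           · linarith)
    · have hG := h.hasG rfl
      obtain ⟨ε, hε, hg⟩ := B.f_gap (x := 0) (y := -t) 0
        (Or.inl (neg_ne_zero.2 (h.ne.resolve_right (not_not.2 hG))))
      refine ⟨ε, hε, ?_⟩
      filter_upwards [hg] with u hu z z' h1 h2 h3 h4 h5
      have hf0 := B.f_nonneg (u.1, u.2.1)
      have hg0 := B.g_nonneg (u.1, u.2.1)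
      refine pos_of_g_pos (B := B) (x := u.1) (y := u.2.1) (hg0.lt_of_ne fun h6 => ?_)
      unfold sheets at h1 h2
      rw [← h6, neg_zero] at h1 h2
      rcases h1 with h1 | h1 | h1 <;> rcases h2 with h2 | h2 | h2 <;>
        first
        | (apply h3; linarith)
        | (rcases hu with hu | hu
           · apply h3; linarith
           · linarith)
  refine ⟨min ε (B.h / 2), lt_min hε (by linarith), ?_⟩
  have e1 := min_le_left ε (B.h / 2)
  have e2 := min_le_right ε (B.h / 2)
  rw [B.eventually_nhds h.mem_box]
  have hz0 : (axis b t).2.2 = 0 := by cases b <;> rfl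
  have hc2 : Continuous fun v : ℝ × ℝ × ℝ => v.2.2 := by fun_prop
  have h1 : ∀ᶠ v : ℝ × ℝ × ℝ in 𝓝 (axis b t), v.2.2 < B.h / 2 :=
    hc2.continuousAt.eventually_lt continuousAt_const (by simp only [hz0]; linarith)
  have h2 : ∀ᶠ v : ℝ × ℝ × ℝ in 𝓝 (axis b t), -(B.h / 2) < v.2.2 :=
    hc2.continuousAt.eventually_const_lt (by simp only [hz0]; linarith)
  filter_upwards [hgap, h1, h2, (isOpen_box _ _).mem_nhds h.mem_box] with ⟨x, y, z⟩ h0 h1 h2 h3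
  simp only [] at h1 h2
  refine ⟨h3, fun h4 h5 => ?_⟩
  rw [B.coord_pt h3]
  have hs := (B.pt_mem_iff h3).1 h4
  rw [B.up_iff h3 (by linarith), B.dn_iff h3 (by linarith)] at h5
  rcases h5 with ⟨z', h6, h7, h8⟩ | ⟨z', h6, h7, h8⟩
  · exact h0 z z' hs h6 h7.ne (by linarith) (by linarith)
  · exact h0 z z' hs h6 h8.ne' (by linarith) (by linarith)

omit [IsManifold 𝓘(ℝ, E3) 1 M] in
/-- On the side of two sheets there are pairs of sheets close to each other. -/
lemma IsArc.eventually_close (h : B.IsArc b t) {δ : ℝ} (hδ : 0 < δ) :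
    ∀ᶠ s : ℝ in 𝓝[>] 0, B.pt (axis b t + s • side b) ∈ P ∧
      (Up F P δ (B.pt (axis b t + s • side b)) ∨ Dn F P δ (B.pt (axis b t + s • side b))) := by
  have hh := B.h_pos
  have hr := B.r_pos
  have h1 := h.lt
  have h2 := h.gt
  have hδ' := lt_min hδ hh
  cases b
  · have h3 := eventually_small_line (a := t) (b := 0) (c := 0) (d := 1) B.continuous_f
      (by rw [B.f_eq_zero le_rfl]; exact hδ')
    filter_upwards [h3, eventually_small_pos hr] with s h3 h4
    simp only [axis, side, Prod.smul_mk, smul_eq_mul, mul_zero, mul_one, Prod.mk_add_mk, zero_add,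
      add_zero] at h3 ⊢
    have hm := B.mem_box_zero h2 h1 (by linarith) h4.2
    refine ⟨(B.pt_mem_iff hm).2 (Or.inl rfl), Or.inl ?_⟩
    obtain ⟨s', ht1, ht2, ht3⟩ := (B.up_iff (δ := min δ B.h) hm (by simp)).2
      ⟨B.f (t, s), Or.inr (Or.inl rfl), h.hasF.pos h4.1, by simpa using h3⟩
    exact ⟨s', ht1, ht2.trans_le (min_le_left _ _), ht3⟩
  · have h3 := eventually_small_line (a := 0) (b := -t) (c := 1) (d := 0) B.continuous_g
      (by rw [B.g_eq_zero le_rfl]; exact hδ')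
    filter_upwards [h3, eventually_small_pos hr] with s h3 h4
    simp only [axis, side, Prod.smul_mk, smul_eq_mul, mul_zero, mul_one, Prod.mk_add_mk, zero_add,
      add_zero] at h3 ⊢
    have hm := B.mem_box_zero (x := s) (y := -t) (by linarith) h4.2 (by linarith) (by linarith)
    refine ⟨(B.pt_mem_iff hm).2 (Or.inl rfl), Or.inr ?_⟩
    have := (h.hasG rfl).pos (y := -t) h4.1
    obtain ⟨s', ht1, ht2, ht3⟩ := (B.dn_iff (δ := min δ B.h) hm (by simp)).2
      ⟨-B.g (s, -t), Or.inr (Or.inr rfl), by linarith, by linarith⟩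
    exact ⟨s', ht1, ht2.trans_le (min_le_left _ _), ht3⟩

lemma hasDerivAt_line {Φ : E3 → E3} {D : E3 →L[ℝ] E3} {v w : E3} (h : HasFDerivAt Φ D v) :
    HasDerivAt (fun s : ℝ => Φ (v + s • w)) (D w) 0 := by
  have h1 : HasDerivAt (fun s : ℝ => v + s • w) w 0 := by
    simpa using ((hasDerivAt_id (0 : ℝ)).smul_const w).const_add v
  have h2 : HasFDerivAt Φ D (v + (0 : ℝ) • w) := by simpa using h
  exact h2.comp_hasDerivAt 0 h1

lemma hasDerivAt_coord {k : ℝ → E3} {w : E3} {s : ℝ} (h : HasDerivAt k w s) (i : Fin 3) :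
    HasDerivAt (fun s => k s i) (w i) s :=
  ((EuclideanSpace.proj i : E3 →L[ℝ] ℝ).hasFDerivAt (x := k s)).comp_hasDerivAt s h

lemma hasDerivAt_along {k : ℝ → E3} {w : E3} {s : ℝ} (h : HasDerivAt k w s) (b : Bool) :
    HasDerivAt (fun s => along b (vecHomeo.symm (k s))) (along b (vecHomeo.symm w)) s := by
  cases b
  · exact hasDerivAt_coord h 0
  · exact (hasDerivAt_coord h 1).neg

lemma hasDerivAt_across {k : ℝ → E3} {w : E3} {s : ℝ} (h : HasDerivAt k w s) (b : Bool) :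
    HasDerivAt (fun s => across b (vecHomeo.symm (k s))) (across b (vecHomeo.symm w)) s := by
  cases b
  · exact hasDerivAt_coord h 1
  · exact hasDerivAt_coord h 0

/-- Edge charts agree about the orientation of the edge. -/
theorem IsArc.exists_transition (hP : IsFlowSpine o F P) (hpos : IsPositiveSpine o F P)
    {p' : M} {B' : FoldBox o F P p'} {b' : Bool} {t' : ℝ} (h : B.IsArc b t) (h' : B'.IsArc b' t')
    (he : B.pt (axis b t) = B'.pt (axis b' t')) :
    ∃ (c : ℝ → ℝ) (d : ℝ), HasDerivAt c d t ∧ 0 < d ∧ c t = t' ∧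
      ∀ᶠ s in 𝓝 t, B.pt (axis b s) = B'.pt (axis b' (c s)) := by
  set Φ := B.chart.symm.trans B'.chart with hΦ
  set v := vec (axis b t) with hv
  have hvt : v ∈ B.chart.target := (B.mem_target _).2 h.mem_box
  have hvs : v ∈ Φ.source := by
    refine ⟨hvt, ?_⟩
    change B.pt (axis b t) ∈ B'.chart.source
    rw [he]
    exact B'.pt_mem_source h'.mem_box
  have hdet := B.model.positive.det_pos B'.model.positive hvs
  have hD := (differentiableAt_of_mem B.model.positive.1 B'.model.positive.1 hvs).hasFDerivAt
  set D := fderiv ℝ Φ v with hDdef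
  have hcoordΦ : ∀ u, vecHomeo.symm (Φ (vec u)) = B'.coord (B.pt u) := fun u => rfl
  have hΦv : vecHomeo.symm (Φ v) = axis b' t' := by
    rw [hv, hcoordΦ, he, B'.coord_pt h'.mem_box]
  have htend : ∀ w : ℝ × ℝ × ℝ, Tendsto (fun s : ℝ => B.pt (axis b t + s • w)) (𝓝 0)
      (𝓝 (B.pt (axis b t))) := by
    intro w
    have h1 : Continuous fun s : ℝ => axis b t + s • w := by fun_prop
    have h2 := h1.tendsto 0
    simp only [zero_smul, add_zero] at h2
    exact (B.continuousAt_pt h.mem_box).tendsto.comp h2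
  have hline : ∀ w : ℝ × ℝ × ℝ, HasDerivAt (fun s : ℝ => Φ (vec (axis b t + s • w)))
      (D (vec w)) 0 := by
    intro w
    simp only [vec_add_smul]
    exact hasDerivAt_line hD
  have hz0 : ∀ (b : Bool) t, (axis b t).2.2 = 0 := by intro b t; cases b <;> rfl
  -- Both charts straighten the same flow with the same time parameter.
  have hz : D (vec (0, 0, 1)) = vec (0, 0, 1) := by
    have h1 : (fun s : ℝ => Φ (vec (axis b t + s • (0, 0, 1)))) =ᶠ[𝓝 0]
        fun s => Φ v + s • vec (0, 0, 1) := by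
      have hmem : ∀ (b : Bool) (t r h : ℝ), axis b t ∈ box r h →
          ∀ᶠ s : ℝ in 𝓝 0, axis b t + s • ((0 : ℝ), (0 : ℝ), (1 : ℝ)) ∈ box r h := by
        intro b t r h hb
        have h1 : Continuous fun s : ℝ => axis b t + s • ((0 : ℝ), (0 : ℝ), (1 : ℝ)) := by fun_prop
        exact h1.continuousAt.eventually ((isOpen_box r h).mem_nhds (by simpa using hb))
      filter_upwards [hmem b t _ _ h.mem_box, hmem b' t' _ _ h'.mem_box] with s h2 h3
      have e1 : ∀ (b : Bool) t, axis b t + s • ((0 : ℝ), (0 : ℝ), (1 : ℝ)) =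
          ((axis b t).1, (axis b t).2.1, (axis b t).2.2 + s) := by
        intro b t
        cases b <;> simp [axis]
      have h4 : B.pt (axis b t + s • ((0 : ℝ), (0 : ℝ), (1 : ℝ))) = F s (B.pt (axis b t)) := by
        rw [e1] at h2 ⊢
        exact (B.flow_pt h.mem_box h2).symm
      have h5 : B'.pt (axis b' t' + s • ((0 : ℝ), (0 : ℝ), (1 : ℝ))) =
          F s (B'.pt (axis b' t')) := by
        rw [e1] at h3 ⊢
        exact (B'.flow_pt h'.mem_box h3).symm
      apply vecHomeo.symm.injective
      rw [hcoordΦ, h4, he, ← h5, B'.coord_pt h3]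
      apply vecHomeo.injective
      rw [vecHomeo.apply_symm_apply, ← vecHomeo.apply_symm_apply (Φ v), hΦv]
      exact vec_add_smul _ _ _
    have h2 : HasDerivAt (fun s : ℝ => Φ v + s • vec (0, 0, 1)) (vec (0, 0, 1)) 0 := by
      simpa using ((hasDerivAt_id (0 : ℝ)).smul_const (vec (0, 0, 1))).const_add (Φ v)
    exact (hline (0, 0, 1)).unique (h2.congr_of_eventuallyEq h1)
  -- The singular set does not depend on the chart, and near the point it is an axis in both boxes.
  -- So the transition map carries axis to axis.
  have harc : ∀ᶠ s : ℝ in 𝓝 0, B.pt (axis b t + s • axis b 1) ∈ B'.chart.source ∧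
      B'.coord (B.pt (axis b t + s • axis b 1)) =
        axis b' (along b' (B'.coord (B.pt (axis b t + s • axis b 1)))) := by
    have h1 := h'.eventually_eq hP hpos
    rw [← he] at h1
    have h2 : ∀ᶠ s : ℝ in 𝓝 0, t + s ∈ Ioo (-B.r) B.r ∧ (t + s ≠ 0 ∨ ¬ B.HasG) := by
      have hc : Continuous fun s : ℝ => t + s := by fun_prop
      have h3 : ∀ᶠ s : ℝ in 𝓝 0, t + s ∈ Ioo (-B.r) B.r :=
        hc.continuousAt.eventually (isOpen_Ioo.mem_nhds (by simpa using ⟨h.gt, h.lt⟩))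
      rcases h.ne with h4 | h4
      · filter_upwards [h3, hc.continuousAt.eventually_ne (by simpa using h4)] with s h5 h6
          using ⟨h5, Or.inl h6⟩
      · filter_upwards [h3] with s h5 using ⟨h5, Or.inr h4⟩
    filter_upwards [(htend (axis b 1)).eventually h1, h2] with s h3 h4
    apply h3
    rw [← axis_add]
    exact (IsArc.pt_mem hP hpos ⟨h.hasF, h.hasG, h4.1.2, h4.1.1, h4.2⟩).1
  have hu : across b' (vecHomeo.symm (D (vec (axis b 1)))) = 0 := by
    refine (hasDerivAt_across (hline (axis b 1)) b').unique ?_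
    refine (hasDerivAt_const (0 : ℝ) (0 : ℝ)).congr_of_eventuallyEq ?_
    filter_upwards [harc] with s hs
    rw [hcoordΦ, hs.2, across_axis]
  have hu2 : D (vec (axis b 1)) 2 = 0 := by
    refine (hasDerivAt_coord (hline (axis b 1)) 2).unique ?_
    refine (hasDerivAt_const (0 : ℝ) (0 : ℝ)).congr_of_eventuallyEq ?_
    filter_upwards [harc] with s hs
    have : (Φ (vec (axis b t + s • axis b 1))) 2 =
      (B'.coord (B.pt (axis b t + s • axis b 1))).2.2 := rfl
    rw [this, hs.2, hz0]
  -- The side with two sheets is recognised by short return times, hence is the same in both boxes.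
  -- Passing to the derivative leaves a weak inequality, which is enough because the determinant is
  -- positive.
  have hw : 0 ≤ across b' (vecHomeo.symm (D (vec (side b)))) := by
    refine nonneg_of_hasDerivAt (hasDerivAt_across (hline (side b)) b') ?_ ?_
    · simp only [zero_smul, add_zero]
      rw [← hv, hΦv, across_axis]
    · obtain ⟨δ, hδ, h1⟩ := h'.eventually_across_pos
      rw [← he] at h1
      have h2 := ((htend (side b)).mono_left nhdsWithin_le_nhds).eventually h1 (f := fun s : ℝ =>
        B.pt (axis b t + s • side b)) (l₁ := 𝓝[>] 0)
      filter_upwards [h2, h.eventually_close hδ] with s h3 h4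
      rw [hcoordΦ]
      exact (h3 h4.1 h4.2).le
  have hpos' := along_pos_of_det_pos hdet b b' hz hu hu2 hw
  refine ⟨fun s => along b' (B'.coord (B.pt (axis b s))), _, ?_, hpos', ?_, ?_⟩
  · have h1 := hasDerivAt_along (hline (axis b 1)) b'
    have h2 : HasDerivAt (fun s : ℝ => s - t) 1 t := (hasDerivAt_id t).sub_const t
    have h3 : HasDerivAt (fun s => along b' (vecHomeo.symm (Φ (vec (axis b t + s • axis b 1)))))
        (along b' (vecHomeo.symm (D (vec (axis b 1))))) (t - t) := by rwa [sub_self]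
    have h4 := HasDerivAt.comp (h := fun s : ℝ => s - t) t h3 h2
    rw [mul_one] at h4
    refine h4.congr_of_eventuallyEq (Eventually.of_forall fun s => ?_)
    simp only [Function.comp_apply]
    rw [hcoordΦ, ← axis_add, add_sub_cancel]
  · simp only []
    rw [he, B'.coord_pt h'.mem_box, along_axis]
  · have hc : Continuous fun s : ℝ => s - t := by fun_prop
    have h1 : Tendsto (fun s : ℝ => s - t) (𝓝 t) (𝓝 0) := by simpa using hc.tendsto t
    filter_upwards [h1.eventually harc] with s hs
    rw [← axis_add, add_sub_cancel] at hs
    rw [← hs.2, B'.pt_coord hs.1]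

end FoldBox

end FlowSpine

namespace FlowSpine

open Set Filter Topology

variable {M : Type*} [TopologicalSpace M] [ChartedSpace E3 M] [IsManifold 𝓘(ℝ, E3) 1 M]
variable {o : Orientation3 M} {F : Flow ℝ M} {P : Set M}

/-! ### Segments of edges -/

namespace FoldBox

variable {p p' : M} {B : FoldBox o F P p} {B' : FoldBox o F P p'} {b b' : Bool} {s t : ℝ}

omit [IsManifold 𝓘(ℝ, E3) 1 M] in
lemma continuousAt_arc (h1 : t < B.r) (h2 : -B.r < t) :
    ContinuousAt (fun t => B.pt (axis b t)) t :=
  ContinuousAt.comp (f := axis b) (B.continuousAt_pt (axis_mem_box h1 h2))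
    (continuous_axis b).continuousAt

omit [IsManifold 𝓘(ℝ, E3) 1 M] in
lemma arc_inj (h1 : t < B.r) (h2 : -B.r < t) (h3 : s < B.r) (h4 : -B.r < s)
    (h : B.pt (axis b t) = B.pt (axis b s)) : t = s := by
  have := congrArg (along b) (B.pt_inj (axis_mem_box h1 h2) (axis_mem_box h3 h4) h)
  rwa [along_axis, along_axis] at this

lemma arc_mem_singularSet (hP : IsFlowSpine o F P) (hpos : IsPositiveSpine o F P) (hF : B.HasF)
    (hb : b = true → B.HasG) (h1 : t < B.r) (h2 : -B.r < t) :
    B.pt (axis b t) ∈ singularSet o F P := by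
  have hm := axis_mem_box (B := B) (b := b) h1 h2
  cases b
  · exact (pt_mem_singularSet hP hpos hm).2 ⟨rfl, Or.inl ⟨rfl, hF⟩⟩
  · exact (pt_mem_singularSet hP hpos hm).2 ⟨rfl, Or.inr ⟨rfl, hb rfl⟩⟩

lemma arc_mem_vertexSet (hP : IsFlowSpine o F P) (hpos : IsPositiveSpine o F P)
    (h1 : t < B.r) (h2 : -B.r < t) :
    B.pt (axis b t) ∈ vertexSet o F P ↔ t = 0 ∧ B.HasG := by
  have hm := axis_mem_box (B := B) (b := b) h1 h2
  cases b
  · refine (pt_mem_vertexSet hP hpos hm).trans ?_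
    simp [and_comm]
  · refine (pt_mem_vertexSet hP hpos hm).trans ?_
    simp [and_comm]

lemma IsArc.eventually_mem (hP : IsFlowSpine o F P) (hpos : IsPositiveSpine o F P)
    (h : B.IsArc b t) {t0 t1 : ℝ} (h0 : t0 < t) (h1 : t < t1) :
    ∀ᶠ q in 𝓝 (B.pt (axis b t)), q ∈ singularSet o F P →
      ∃ s ∈ Ioo t0 t1, q = B.pt (axis b s) := by
  have hc : Continuous (along b) := by cases b <;> unfold along <;> fun_prop
  have h2 : ContinuousAt (fun q => along b (B.coord q)) (B.pt (axis b t)) :=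
    hc.continuousAt.comp (B.continuousAt_coord (B.pt_mem_source h.mem_box))
  have h3 : along b (B.coord (B.pt (axis b t))) = t := by rw [B.coord_pt h.mem_box, along_axis]
  have h4 : ∀ᶠ q in 𝓝 (B.pt (axis b t)), along b (B.coord q) ∈ Ioo t0 t1 :=
    h2 (isOpen_Ioo.mem_nhds (by simp only []; rw [h3]; exact ⟨h0, h1⟩))
  filter_upwards [h.eventually_eq hP hpos, h4] with q h5 h6 h7
  exact ⟨_, h6, by rw [← (h5 h7).2, B.pt_coord (h5 h7).1]⟩

variable (B) in
/-- The piece of an axis between two consecutive points of `E`. -/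
structure IsSegment (E : Set M) (b : Bool) (t0 t1 : ℝ) : Prop where
  hasF : B.HasF
  hasG : b = true → B.HasG
  gt : -B.r < t0
  lt : t0 < t1
  lt_r : t1 < B.r
  left : B.pt (axis b t0) ∈ E
  right : B.pt (axis b t1) ∈ E
  inner : ∀ t ∈ Ioo t0 t1, B.pt (axis b t) ∉ E

namespace IsSegment

variable {E : Set M} {t0 t1 s0 s1 : ℝ}

lemma isArc (hP : IsFlowSpine o F P) (hpos : IsPositiveSpine o F P) (hE : vertexSet o F P ⊆ E)
    (σ : B.IsSegment E b t0 t1) (ht : t ∈ Ioo t0 t1) : B.IsArc b t where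
  hasF := σ.hasF
  hasG := σ.hasG
  lt := ht.2.trans σ.lt_r
  gt := σ.gt.trans ht.1
  ne := by
    by_contra h
    push Not at h
    exact σ.inner t ht (hE ((arc_mem_vertexSet hP hpos (ht.2.trans σ.lt_r)
      (σ.gt.trans ht.1)).2 h))

omit [IsManifold 𝓘(ℝ, E3) 1 M] in
lemma continuousOn (σ : B.IsSegment E b t0 t1) :
    ContinuousOn (fun t => B.pt (axis b t)) (Icc t0 t1) := fun _ ht =>
  (continuousAt_arc (ht.2.trans_lt σ.lt_r) (σ.gt.trans_le ht.1)).continuousWithinAt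

omit [IsManifold 𝓘(ℝ, E3) 1 M] in
lemma isClosed_image [T2Space M] (σ : B.IsSegment E b t0 t1) {s : ℝ} (hs : s ≤ t1) :
    IsClosed ((fun t => B.pt (axis b t)) '' Icc t0 s) :=
  (isCompact_Icc.image_of_continuousOn
    (σ.continuousOn.mono (Icc_subset_Icc_right hs))).isClosed

/-- The parameters whose points lie on the other segment form an open set, since the singular set is
locally an arc. They also form a relatively closed set, since the other closed segment is compact
and its ends belong to `E`, which the interior of a segment avoids. -/
lemma subset_of_meet [T2Space M] (hP : IsFlowSpine o F P) (hpos : IsPositiveSpine o F P)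
    (hE : vertexSet o F P ⊆ E) (σ : B.IsSegment E b t0 t1) (σ' : B'.IsSegment E b' s0 s1)
    (hm : ∃ t ∈ Ioo t0 t1, ∃ s ∈ Ioo s0 s1, B.pt (axis b t) = B'.pt (axis b' s))
    (ht : t ∈ Ioo t0 t1) : ∃ s ∈ Ioo s0 s1, B.pt (axis b t) = B'.pt (axis b' s) := by
  obtain ⟨u, hu, hmu⟩ := hm
  have key : (∃ s ∈ Ioo s0 s1, B.pt (axis b u) = B'.pt (axis b' s)) =
      (∃ s ∈ Ioo s0 s1, B.pt (axis b t) = B'.pt (axis b' s)) := by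
    refine eq_of_isPreconnected (f := fun t => ∃ s ∈ Ioo s0 s1, B.pt (axis b t) =
      B'.pt (axis b' s)) isPreconnected_Ioo ?_ hu ht
    intro x hx
    have hax := σ.isArc hP hpos hE hx
    have hc : ContinuousAt (fun t => B.pt (axis b t)) x := continuousAt_arc hax.lt hax.gt
    by_cases h : ∃ s ∈ Ioo s0 s1, B.pt (axis b x) = B'.pt (axis b' s)
    · obtain ⟨s, hs, he⟩ := h
      have h1 := (σ'.isArc hP hpos hE hs).eventually_mem hP hpos hs.1 hs.2
      rw [← he] at h1
      filter_upwards [mem_nhdsWithin_of_mem_nhds (hc.eventually h1), self_mem_nhdsWithin]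
        with y hy hyI
      exact propext ⟨fun _ => ⟨s, hs, he⟩,
        fun _ => hy ((σ.isArc hP hpos hE hyI).pt_mem hP hpos).1⟩
    · have h1 : B.pt (axis b x) ∉ (fun t => B'.pt (axis b' t)) '' Icc s0 s1 := by
        rintro ⟨s, hs, he⟩
        rcases hs.1.eq_or_lt with h2 | h2
        · refine σ.inner x hx ?_
          rw [← he, ← h2]
          exact σ'.left
        rcases hs.2.eq_or_lt with h3 | h3
        · refine σ.inner x hx ?_
          rw [← he, h3]
          exact σ'.right
        exact h ⟨s, ⟨h2, h3⟩, he.symm⟩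
      have h2 := hc.eventually ((σ'.isClosed_image le_rfl).isOpen_compl.mem_nhds h1)
      filter_upwards [mem_nhdsWithin_of_mem_nhds h2] with y hy
      exact propext ⟨fun ⟨s, hs, he⟩ => (hy ⟨s, Ioo_subset_Icc_self hs, he.symm⟩).elim,
        fun h' => (h h').elim⟩
  rw [← key]
  exact hmu

/-- Two segments which meet start at the same point, and pass through their common points in the
same direction. -/
lemma left_eq [T2Space M] (hP : IsFlowSpine o F P) (hpos : IsPositiveSpine o F P)
    (hE : vertexSet o F P ⊆ E) (σ : B.IsSegment E b t0 t1) (σ' : B'.IsSegment E b' s0 s1)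
    (hm : ∃ t ∈ Ioo t0 t1, ∃ s ∈ Ioo s0 s1, B.pt (axis b t) = B'.pt (axis b' s)) :
    B.pt (axis b t0) = B'.pt (axis b' s0) := by
  set c : ℝ → ℝ := fun t => along b' (B'.coord (B.pt (axis b t)))
  have hceq : ∀ {t s}, s < B'.r → -B'.r < s → B.pt (axis b t) = B'.pt (axis b' s) → c t = s := by
    intro t s h1 h2 h
    simp only [c]
    rw [h, B'.coord_pt (axis_mem_box h1 h2), along_axis]
  have hc : ∀ t ∈ Ioo t0 t1, c t ∈ Ioo s0 s1 ∧ B.pt (axis b t) = B'.pt (axis b' (c t)) := by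
    intro t ht
    obtain ⟨s, hs, he⟩ := subset_of_meet hP hpos hE σ σ' hm ht
    have h1 := σ'.isArc hP hpos hE hs
    rw [hceq h1.lt h1.gt he]
    exact ⟨hs, he⟩
  have hd : ∀ t ∈ Ioo t0 t1, ∃ d, HasDerivAt c d t ∧ 0 < d := by
    intro t ht
    obtain ⟨hs, he⟩ := hc t ht
    have h1 := σ'.isArc hP hpos hE hs
    obtain ⟨c', d, hd, hd0, hct, hev⟩ :=
      IsArc.exists_transition hP hpos (σ.isArc hP hpos hE ht) h1 he
    refine ⟨d, hd.congr_of_eventuallyEq ?_, hd0⟩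
    have h2 : c' t ∈ Ioo (-B'.r) B'.r := by rw [hct]; exact ⟨h1.gt, h1.lt⟩
    filter_upwards [hev, hd.continuousAt.eventually (isOpen_Ioo.mem_nhds h2)] with x hx1 hx2
    exact hceq hx2.2 hx2.1 hx1
  have hmono : StrictMonoOn c (Ioo t0 t1) := by
    refine strictMonoOn_of_deriv_pos (convex_Ioo _ _) (fun t ht => ?_) (fun t ht => ?_)
    · obtain ⟨d, hd, -⟩ := hd t ht
      exact hd.continuousAt.continuousWithinAt
    · rw [interior_Ioo] at ht
      obtain ⟨d, hd, hd0⟩ := hd t ht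
      rwa [hd.deriv]
  obtain ⟨m, hm0, hm1⟩ := exists_between σ.lt
  have hcm := (hc m ⟨hm0, hm1⟩).1
  -- Since the change of parameter increases, the beginning of the first segment is mapped into the
  -- part of the second before `c m`. The limit therefore lies on that part, and being in `E` it can
  -- only be its initial point.
  have hev : ∀ᶠ t in 𝓝[>] t0, B.pt (axis b t) ∈ (fun t => B'.pt (axis b' t)) '' Icc s0 (c m) := by
    filter_upwards [Ioo_mem_nhdsGT hm0] with t ht
    have ht' : t ∈ Ioo t0 t1 := ⟨ht.1, ht.2.trans hm1⟩
    exact ⟨c t, ⟨(hc t ht').1.1.le, (hmono ht' ⟨hm0, hm1⟩ ht.2).le⟩, (hc t ht').2.symm⟩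
  have hlim : Tendsto (fun t => B.pt (axis b t)) (𝓝[>] t0) (𝓝 (B.pt (axis b t0))) :=
    (continuousAt_arc (σ.lt.trans σ.lt_r) σ.gt).tendsto.mono_left nhdsWithin_le_nhds
  obtain ⟨s, hs, he⟩ := (σ'.isClosed_image hcm.2.le).mem_of_tendsto hlim hev
  rcases hs.1.eq_or_lt with h2 | h2
  · rw [← he, ← h2]
  · refine (σ'.inner s ⟨h2, hs.2.trans_lt hcm.2⟩ ?_).elim
    simp only [] at he
    rw [he]
    exact σ.left

/-- Segments which end at the same edge point meet. -/
lemma meet_of_right_eq (hP : IsFlowSpine o F P) (hpos : IsPositiveSpine o F P)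
    (σ : B.IsSegment E b t0 t1) (σ' : B'.IsSegment E b' s0 s1) (h : B.IsArc b t1)
    (h' : B'.IsArc b' s1) (he : B.pt (axis b t1) = B'.pt (axis b' s1)) :
    ∃ t ∈ Ioo t0 t1, ∃ s ∈ Ioo s0 s1, B.pt (axis b t) = B'.pt (axis b' s) := by
  obtain ⟨c, d, hd, hd0, hct, hev⟩ := IsArc.exists_transition hP hpos h h' he
  -- The positive derivative sends parameters just before one end to parameters before the other. A
  -- reversed direction would allow the segments to arrive from opposite sides.
  have h1 : ∀ᶠ t in 𝓝[<] t1, c t < s1 := by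
    have h2 := (hasDerivAt_iff_tendsto_slope.1 hd).mono_left
      (nhdsWithin_mono t1 (fun x (hx : x ∈ Iio t1) => (ne_of_lt hx : x ≠ t1)))
    filter_upwards [h2.eventually (lt_mem_nhds hd0), self_mem_nhdsWithin] with t h3 h4
    rw [slope_def_field, hct] at h3
    have h5 : t - t1 < 0 := sub_neg.2 h4
    by_contra! h6
    exact absurd h3 (not_lt.2 (div_nonpos_of_nonneg_of_nonpos (sub_nonneg.2 h6) h5.le))
  have h2 : ∀ᶠ t in 𝓝[<] t1, s0 < c t :=
    (hd.continuousAt.mono_left nhdsWithin_le_nhds).eventually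
      (lt_mem_nhds (by rw [hct]; exact σ'.lt))
  obtain ⟨t, h3, h4, h5, h6⟩ := (h1.and (h2.and ((hev.filter_mono nhdsWithin_le_nhds).and
    (Ioo_mem_nhdsLT σ.lt)))).exists
  exact ⟨t, h6, c t, ⟨h4, h3⟩, h5⟩

end IsSegment

end FoldBox

end FlowSpine

namespace FlowSpine

open Set Filter Topology

variable {M : Type*} [TopologicalSpace M] [ChartedSpace E3 M] [IsManifold 𝓘(ℝ, E3) 1 M]
variable {o : Orientation3 M} {F : Flow ℝ M} {P : Set M}

/-! ### Weights decrease along the edges -/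

lemma isCompact_singularSet [T2Space M] (hP : IsFlowSpine o F P) (hpos : IsPositiveSpine o F P) :
    IsCompact (singularSet o F P) := by
  refine hP.compact.of_isClosed_subset ?_ (singularSet_subset hP hpos)
  rw [← isOpen_compl_iff, isOpen_iff_mem_nhds]
  intro p hp
  by_cases h : p ∈ P
  · obtain ⟨B, -⟩ := exists_foldBox hP hpos h univ_mem
    have hF : ¬ B.HasF := mt (B.hasF_iff hP hpos).1 hp
    filter_upwards [B.source_mem_nhds] with q hq
    obtain ⟨x, y, z, hu, rfl⟩ := B.exists_pt hq
    rw [mem_compl_iff, FoldBox.pt_mem_singularSet hP hpos hu]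
    rintro ⟨-, ⟨-, h⟩ | ⟨-, h⟩⟩
    · exact hF h
    · exact hF h.hasF
  · filter_upwards [hP.compact.isClosed.isOpen_compl.mem_nhds h] with q hq h'
    exact hq (singularSet_subset hP hpos h')

/-- Finitely many short arcs cover the singular set. -/
lemma exists_finset_arcs [T2Space M] (hP : IsFlowSpine o F P) (hpos : IsPositiveSpine o F P)
    (𝔅 : ∀ p : singularSet o F P, FoldBox o F P (p : M)) :
    ∃ K : Finset (singularSet o F P), ∀ q ∈ singularSet o F P, ∃ p ∈ K, ∃ b t,
      (b = true → (𝔅 p).HasG) ∧ t < (𝔅 p).r / 2 ∧ -((𝔅 p).r / 2) < t ∧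
        (𝔅 p).pt (axis b t) = q := by
  -- Boxes of half the width are used for the covering, so that the closed arcs with their end
  -- points remain inside the full boxes.
  obtain ⟨K, hK⟩ := (isCompact_singularSet hP hpos).elim_nhds_subcover'
    (fun p hp => {q | q ∈ (𝔅 ⟨p, hp⟩).chart.source ∧
      (𝔅 ⟨p, hp⟩).coord q ∈ box ((𝔅 ⟨p, hp⟩).r / 2) (𝔅 ⟨p, hp⟩).h}) (fun p hp => by
      set B := 𝔅 ⟨p, hp⟩
      have hc := (B.continuousAt_coord B.model.mem_source).eventually
        ((isOpen_box (B.r / 2) B.h).mem_nhds (by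
          have h0 : B.coord p = (0, 0, 0) := by
            rw [← B.coord_pt B.zero_mem, B.pt_zero]
          simp only []
          rw [h0, mem_box]
          have h1 := B.r_pos
          have h2 := B.h_pos
          refine ⟨⟨?_, ?_⟩, ⟨?_, ?_⟩, ?_, ?_⟩ <;> linarith))
      filter_upwards [B.source_mem_nhds, hc] with q h1 h2 using ⟨h1, h2⟩)
  refine ⟨K, fun q hq => ?_⟩
  obtain ⟨p, hp, h1, h2⟩ := mem_iUnion₂.1 (hK hq)
  refine ⟨p, hp, ?_⟩
  set B := 𝔅 p
  obtain ⟨x, y, z, hu, rfl⟩ := B.exists_pt h1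
  have h3 : B.coord (B.pt (x, y, z)) ∈ box (B.r / 2) B.h := h2
  rw [B.coord_pt hu, mem_box] at h3
  obtain ⟨b, hb, he⟩ := FoldBox.axis_eq_or (B := B) (x, y, z)
    ((FoldBox.pt_mem_singularSet hP hpos hu).1 hq)
  refine ⟨b, along b (x, y, z), hb, ?_, ?_, by rw [← he]⟩
  · cases b
    · exact h3.1.2
    · have := h3.2.1.1
      simp only [along]
      linarith
  · cases b
    · exact h3.1.1
    · have := h3.2.1.2
      simp only [along]
      linarith

/-! ### Marked points on the edges -/

section Arcs

variable (𝔅 : ∀ p : singularSet o F P, FoldBox o F P (p : M)) (K : Finset (singularSet o F P))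

/-- The end points and the centres of the arcs of a finite family. -/
def arcMarks : Set M :=
  {q | ∃ p ∈ K, ∃ b, (b = true → (𝔅 p).HasG) ∧ ∃ c ∈ ({-1, 0, 1} : Finset ℝ),
    (𝔅 p).pt (axis b (c * ((𝔅 p).r / 2))) = q}

omit [IsManifold 𝓘(ℝ, E3) 1 M] in
lemma finite_arcMarks : (arcMarks 𝔅 K).Finite := by
  refine ((K ×ˢ (Finset.univ : Finset Bool) ×ˢ ({-1, 0, 1} : Finset ℝ)).finite_toSet.image
    fun k => (𝔅 k.1).pt (axis k.2.1 (k.2.2 * ((𝔅 k.1).r / 2)))).subset ?_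
  rintro q ⟨p, hp, b, -, c, hc, h⟩
  exact ⟨(p, b, c), by simpa [hp] using hc, h⟩

variable {𝔅 K}

/-- A vertex in a box is its centre. -/
lemma FoldBox.eq_of_mem_vertexSet (hP : IsFlowSpine o F P) (hpos : IsPositiveSpine o F P) {p : M}
    {B : FoldBox o F P p} {b : Bool} {t : ℝ} (h1 : t < B.r) (h2 : -B.r < t)
    (h : B.pt (axis b t) ∈ vertexSet o F P) : t = 0 ∧ B.HasG ∧ B.pt (axis b t) = p := by
  obtain ⟨rfl, hG⟩ := (FoldBox.arc_mem_vertexSet hP hpos h1 h2).1 h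
  exact ⟨rfl, hG, by rw [axis_zero, B.pt_zero]⟩

lemma vertexSet_subset_arcMarks (hP : IsFlowSpine o F P) (hpos : IsPositiveSpine o F P)
    (hK : ∀ q ∈ singularSet o F P, ∃ p ∈ K, ∃ b t,
      (b = true → (𝔅 p).HasG) ∧ t < (𝔅 p).r / 2 ∧ -((𝔅 p).r / 2) < t ∧
        (𝔅 p).pt (axis b t) = q) : vertexSet o F P ⊆ arcMarks 𝔅 K := by
  intro q hq
  obtain ⟨p, hp, b, t, hb, h1, h2, rfl⟩ := hK q (Or.inr hq)
  have hr := (𝔅 p).r_pos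
  obtain ⟨rfl, -⟩ := FoldBox.eq_of_mem_vertexSet hP hpos (by linarith) (by linarith) hq
  exact ⟨p, hp, b, hb, 0, by simp, by rw [zero_mul]⟩

lemma arcMarks_subset (hP : IsFlowSpine o F P) (hpos : IsPositiveSpine o F P) :
    arcMarks 𝔅 K ⊆ singularSet o F P := by
  rintro q ⟨p, hp, b, hb, c, hc, rfl⟩
  have hr := (𝔅 p).r_pos
  simp only [Finset.mem_insert, Finset.mem_singleton] at hc
  refine FoldBox.arc_mem_singularSet hP hpos (((𝔅 p).hasF_iff hP hpos).2 p.2) hb ?_ ?_ <;>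
    rcases hc with rfl | rfl | rfl <;> linarith

/-- A segment begins at every marked point, in the direction of each edge which passes through
it. -/
lemma exists_isSegment (hP : IsFlowSpine o F P) (hpos : IsPositiveSpine o F P)
    (hK : ∀ q ∈ singularSet o F P, ∃ p ∈ K, ∃ b t,
      (b = true → (𝔅 p).HasG) ∧ t < (𝔅 p).r / 2 ∧ -((𝔅 p).r / 2) < t ∧
        (𝔅 p).pt (axis b t) = q) {q : M} (hq : q ∈ arcMarks 𝔅 K) (β : Bool) :
    ∃ p b t0 t1, (𝔅 p).IsSegment (arcMarks 𝔅 K) b t0 t1 ∧ (𝔅 p).pt (axis b t0) = q ∧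
      (q ∈ vertexSet o F P → b = β) := by
  obtain ⟨p, hp, b', t0, hb', h1, h2, h0⟩ := hK q (arcMarks_subset hP hpos hq)
  have hr := (𝔅 p).r_pos
  -- A vertex is the centre of its box and lies on both axes, so the axis can be prescribed. At
  -- other points it is given by the covering.
  obtain ⟨b, hb, h0, hβ⟩ : ∃ b, (b = true → (𝔅 p).HasG) ∧ (𝔅 p).pt (axis b t0) = q ∧
      (q ∈ vertexSet o F P → b = β) := by
    by_cases hv : q ∈ vertexSet o F P
    · rw [← h0] at hv
      obtain ⟨rfl, hG, -⟩ := FoldBox.eq_of_mem_vertexSet hP hpos (by linarith) (by linarith) hv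
      exact ⟨β, fun _ => hG, by rw [← h0, axis_zero, axis_zero], fun _ => rfl⟩
    · exact ⟨b', hb', h0, fun h => (hv h).elim⟩
  set B := 𝔅 p
  have hfin : {t | t ∈ Ioc t0 (B.r / 2) ∧ B.pt (axis b t) ∈ arcMarks 𝔅 K}.Finite := by
    refine Set.Finite.of_finite_image (f := fun t => B.pt (axis b t))
      ((finite_arcMarks 𝔅 K).subset ?_) ?_
    · rintro _ ⟨t, ht, rfl⟩
      exact ht.2
    · intro t ht s hs h
      exact FoldBox.arc_inj (by linarith [ht.1.2]) (by linarith [ht.1.1]) (by linarith [hs.1.2])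
        (by linarith [hs.1.1]) h
  -- The end `r / 2` of the arc is itself marked, so there is a next marked point on it.
  obtain ⟨t1, ht1, hmin⟩ := hfin.exists_minimal
    ⟨B.r / 2, ⟨h1, le_rfl⟩, p, hp, b, hb, 1, by simp, by rw [one_mul]⟩
  refine ⟨p, b, t0, t1, ⟨(B.hasF_iff hP hpos).2 p.2, hb, by linarith, ht1.1.1,
    by linarith [ht1.1.2], by rwa [h0], ht1.2, fun t ht h => ?_⟩, h0, hβ⟩
  have := hmin ⟨⟨ht.1, ht.2.le.trans ht1.1.2⟩, h⟩ ht.2.le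
  exact absurd ht.2 (not_lt.2 this)

end Arcs

namespace FoldBox

variable {p : M} {B : FoldBox o F P p} {b : Bool}

lemma reg_arc_eq (hP : IsFlowSpine o F P) (hpos : IsPositiveSpine o F P) {J : Set ℝ}
    (hJ : IsPreconnected J) (h : ∀ t ∈ J, B.IsArc b t) {t t' : ℝ} (ht : t ∈ J) (ht' : t' ∈ J)
    (s : Sheet) : reg o F P s (B.pt (axis b t)) = reg o F P s (B.pt (axis b t')) := by
  refine reg_eq_of_isPreconnected (A := (fun t => B.pt (axis b t)) '' J) hP hpos
    (hJ.image _ fun t ht => (continuousAt_arc (h t ht).lt (h t ht).gt).continuousWithinAt) ?_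
    ⟨t, ht, rfl⟩ ⟨t', ht', rfl⟩ s
  rintro _ ⟨t, ht, rfl⟩
  exact (h t ht).pt_mem hP hpos

end FoldBox

variable {a : Set M → ℝ}

variable (o F P a) in
/-- The difference of the weights of the lower and the upper sheet. -/
def weightGap (p : M) : ℝ := a (reg o F P .lower p) - a (reg o F P .upper p)

/-- On the first axis the upper sheet is the top sheet throughout, while the lower sheet is the
middle sheet over the second quadrant before the vertex and over the first quadrant after it. Their
weights differ by that of the bottom sheet, by balance on the second axis for `y > 0`. On the second
axis, followed downwards, the lower sheet is the bottom sheet throughout and the upper sheet passes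
from the first quadrant to the fourth. Their weights differ by that of the top sheet, by balance on
the first axis for `x > 0`. At an `r`-vertex the signs would be reversed. -/
lemma FoldBox.weightGap_sub (hP : IsFlowSpine o F P) (hpos : IsPositiveSpine o F P)
    (ha : IsBalanced o F P a) {p : M} {B : FoldBox o F P p} (hG : B.HasG) {t : ℝ} (h0 : 0 < t)
    (h1 : t < B.r) {q q' : M} (hq : q ∈ B.bot) (hq' : q' ∈ B.top) :
    weightGap o F P a (B.pt (axis false (-t))) - weightGap o F P a (B.pt (axis false t)) =
      a (comp o F P q) ∧
    weightGap o F P a (B.pt (axis true (-t))) - weightGap o F P a (B.pt (axis true t)) =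
      a (comp o F P q') := by
  have hF := hG.hasF
  have hr := B.r_pos
  have hm : ∀ {x y a b c d}, a < x → x < b → c < y → y < d →
      B.pt (x, y, 0) ∈ B.mid a b c d := fun h1 h2 h3 h4 => mem_graph (k := 0) h1 h2 h3 h4
  -- The indices of the following facts are those of the quadrants.
  have m1 := hm h0 h1 h0 h1
  have m2 := hm (x := -t) (y := t) (by linarith : -B.r < -t) (by linarith : -t < 0) h0 h1
  have m4 := hm (x := t) (y := -t) h0 h1 (by linarith : -B.r < -t) (by linarith : -t < 0)
  have xu : ∀ {x}, -B.r < x → x < B.r → x ≠ 0 → _ := fun h1 h2 h3 =>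
    reg_x_upper hP hpos hF h1 h2 (Or.inl h3) hq'
  have yl : ∀ {x}, -B.r < x → x < B.r → x ≠ 0 → _ := fun h1 h2 h3 =>
    reg_y_lower hP hpos hG h1 h2 h3 hq
  have xl1 := reg_x_lower hP hpos hF h0 h1 (by linarith) le_rfl (Or.inl le_rfl) m1
  have xl2 := reg_x_lower hP hpos hF (x := -t) (by linarith) (by linarith) le_rfl hr.le
    (Or.inr (Or.inl le_rfl)) m2
  have xs4 := reg_x_single hP hpos hF h0 h1 (by linarith) le_rfl (Or.inl le_rfl) m4
  have yu1 := reg_y_upper hP hpos hG h0 h1 (by linarith) le_rfl (Or.inl le_rfl) m1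
  have yu4 := reg_y_upper hP hpos hG (y := -t) (by linarith) (by linarith) le_rfl hr.le
    (Or.inr le_rfl) m4
  have ys2 := reg_y_single hP hpos hG h0 h1 (by linarith) le_rfl (Or.inl le_rfl) m2
  have bx := ha _ (pt_x_mem hP hpos hF (x := t) (by linarith) h1 (Or.inl h0.ne'))
  have bY := ha _ (pt_y_mem hP hpos hG (y := t) (by linarith) h1 h0.ne')
  rw [xu (by linarith) h1 h0.ne', xl1, xs4] at bx
  rw [yu1, yl (by linarith) h1 h0.ne', ys2] at bY
  simp only [axis, weightGap, neg_neg]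
  rw [xu (by linarith) h1 h0.ne', xu (by linarith) (by linarith) (by linarith : -t ≠ 0), xl1, xl2,
    yl (by linarith) h1 h0.ne', yl (by linarith) (by linarith) (by linarith : -t ≠ 0), yu1, yu4]
  constructor <;> linarith

end FlowSpine

namespace FlowSpine

open Set Filter Topology

variable {M : Type*} [TopologicalSpace M] [ChartedSpace E3 M] [IsManifold 𝓘(ℝ, E3) 1 M]
variable {o : Orientation3 M} {F : Flow ℝ M} {P : Set M} {a : Set M → ℝ}

/-! ### Balanced weights vanish at the vertices -/

/-! ### Weight gaps before and after a marked point -/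

section Cusps

variable (𝔅 : ∀ p : singularSet o F P, FoldBox o F P (p : M))

open Classical in
variable (a) in
/-- The weight gap immediately before (`c = -1`) or after (`c = 1`) a marked point. At a vertex
there are two passages. -/
noncomputable def cuspGap (c : ℝ) (g : M × Bool) : ℝ :=
  if h : g.1 ∈ vertexSet o F P then
    weightGap o F P a ((𝔅 ⟨g.1, Or.inr h⟩).pt (axis g.2 (c * ((𝔅 ⟨g.1, Or.inr h⟩).r / 2))))
  else weightGap o F P a g.1

variable {𝔅}

omit [IsManifold 𝓘(ℝ, E3) 1 M] in
lemma cuspGap_of_mem {c : ℝ} {b : Bool} {p : singularSet o F P}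
    (h : (p : M) ∈ vertexSet o F P) :
    cuspGap a 𝔅 c (p, b) = weightGap o F P a ((𝔅 p).pt (axis b (c * ((𝔅 p).r / 2)))) :=
  dif_pos h

omit [IsManifold 𝓘(ℝ, E3) 1 M] in
lemma cuspGap_of_notMem {c : ℝ} {g : M × Bool} (h : g.1 ∉ vertexSet o F P) :
    cuspGap a 𝔅 c g = weightGap o F P a g.1 :=
  dif_neg h

variable {E : Set M} {p : singularSet o F P} {b : Bool} {t0 t1 : ℝ}

/-- A segment which begins or ends at the vertex in its box. -/
lemma FoldBox.IsSegment.eq_center (hP : IsFlowSpine o F P) (hpos : IsPositiveSpine o F P) {t : ℝ}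
    (σ : (𝔅 p).IsSegment E b t0 t1) (ht : t ∈ Icc t0 t1)
    (hv : (𝔅 p).pt (axis b t) ∈ vertexSet o F P) :
    t = 0 ∧ (𝔅 p).HasG ∧ (𝔅 p).pt (axis b t) = p :=
  eq_of_mem_vertexSet hP hpos (ht.2.trans_lt σ.lt_r) (σ.gt.trans_le ht.1) hv

lemma FoldBox.isArc_of_notMem (hP : IsFlowSpine o F P) (hpos : IsPositiveSpine o F P) {p : M}
    {B : FoldBox o F P p} {t : ℝ} (hF : B.HasF) (hG : b = true → B.HasG) (h1 : t < B.r)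
    (h2 : -B.r < t) (hv : B.pt (axis b t) ∉ vertexSet o F P) : B.IsArc b t :=
  ⟨hF, hG, h1, h2, by
    by_contra h
    push Not at h
    exact hv ((arc_mem_vertexSet hP hpos h1 h2).2 h)⟩

lemma FoldBox.weightGap_arc_eq (hP : IsFlowSpine o F P) (hpos : IsPositiveSpine o F P) {p : M}
    {B : FoldBox o F P p} {J : Set ℝ} (hJ : IsPreconnected J) (h : ∀ t ∈ J, B.IsArc b t)
    {t t' : ℝ} (ht : t ∈ J) (ht' : t' ∈ J) :
    weightGap o F P a (B.pt (axis b t)) = weightGap o F P a (B.pt (axis b t')) := by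
  rw [weightGap, weightGap, reg_arc_eq hP hpos hJ h ht ht', reg_arc_eq hP hpos hJ h ht ht']

/-- The gap is constant along the segment. If it starts at a vertex, it is compared with the point
at `r / 2` on the same open half-axis, which contains no vertex; otherwise the starting point can be
included in the arc. -/
lemma cuspGap_left (hP : IsFlowSpine o F P) (hpos : IsPositiveSpine o F P)
    (hE : vertexSet o F P ⊆ E) (σ : (𝔅 p).IsSegment E b t0 t1) {β : Bool}
    (hβ : (𝔅 p).pt (axis b t0) ∈ vertexSet o F P → b = β) {t : ℝ} (ht : t ∈ Ioo t0 t1) :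
    cuspGap a 𝔅 1 ((𝔅 p).pt (axis b t0), β) = weightGap o F P a ((𝔅 p).pt (axis b t)) := by
  by_cases hv : (𝔅 p).pt (axis b t0) ∈ vertexSet o F P
  · obtain ⟨rfl, hG, he⟩ := σ.eq_center hP hpos (left_mem_Icc.2 σ.lt.le) hv
    obtain rfl := hβ hv
    rw [he] at hv ⊢
    rw [cuspGap_of_mem hv, one_mul]
    have hr := (𝔅 p).r_pos
    exact FoldBox.weightGap_arc_eq hP hpos (isPreconnected_Ioo (a := 0) (b := (𝔅 p).r))
      (fun s hs => ⟨σ.hasF, σ.hasG, hs.2, by linarith [hs.1], Or.inl hs.1.ne'⟩)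
      ⟨by linarith, by linarith⟩ ⟨ht.1, ht.2.trans σ.lt_r⟩
  · rw [cuspGap_of_notMem hv]
    refine FoldBox.weightGap_arc_eq hP hpos (isPreconnected_Ico (a := t0) (b := t1))
      (fun s hs => ?_) ⟨le_rfl, σ.lt⟩ ⟨ht.1.le, ht.2⟩
    rcases hs.1.eq_or_lt with rfl | h
    · exact FoldBox.isArc_of_notMem hP hpos σ.hasF σ.hasG (σ.lt.trans σ.lt_r) σ.gt hv
    · exact σ.isArc hP hpos hE ⟨h, hs.2⟩

lemma cuspGap_right (hP : IsFlowSpine o F P) (hpos : IsPositiveSpine o F P)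
    (hE : vertexSet o F P ⊆ E) (σ : (𝔅 p).IsSegment E b t0 t1) {β : Bool}
    (hβ : (𝔅 p).pt (axis b t1) ∈ vertexSet o F P → b = β) {t : ℝ} (ht : t ∈ Ioo t0 t1) :
    cuspGap a 𝔅 (-1) ((𝔅 p).pt (axis b t1), β) = weightGap o F P a ((𝔅 p).pt (axis b t)) := by
  by_cases hv : (𝔅 p).pt (axis b t1) ∈ vertexSet o F P
  · obtain ⟨rfl, hG, he⟩ := σ.eq_center hP hpos (right_mem_Icc.2 σ.lt.le) hv
    obtain rfl := hβ hv
    rw [he] at hv ⊢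
    rw [cuspGap_of_mem hv, neg_one_mul]
    have hr := (𝔅 p).r_pos
    exact FoldBox.weightGap_arc_eq hP hpos (isPreconnected_Ioo (a := -(𝔅 p).r) (b := 0))
      (fun s hs => ⟨σ.hasF, σ.hasG, by linarith [hs.2], hs.1, Or.inl hs.2.ne⟩)
      ⟨by linarith, by linarith⟩ ⟨σ.gt.trans ht.1, ht.2⟩
  · rw [cuspGap_of_notMem hv]
    refine FoldBox.weightGap_arc_eq hP hpos (isPreconnected_Ioc (a := t0) (b := t1))
      (fun s hs => ?_) ⟨σ.lt, le_rfl⟩ ⟨ht.1, ht.2.le⟩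
    rcases hs.2.eq_or_lt with rfl | h
    · exact FoldBox.isArc_of_notMem hP hpos σ.hasF σ.hasG σ.lt_r (σ.gt.trans σ.lt) hv
    · exact σ.isArc hP hpos hE ⟨hs.1, h⟩

omit [IsManifold 𝓘(ℝ, E3) 1 M] in
-- The two axes of a box meet only at the origin, so a common point with nonzero parameter
-- identifies the axis.
lemma axis_type_eq {p p' : singularSet o F P} (h : p = p') {b b' : Bool} {t s : ℝ}
    (h1 : t < (𝔅 p).r) (h2 : -(𝔅 p).r < t) (h3 : s < (𝔅 p').r) (h4 : -(𝔅 p').r < s)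
    (h0 : t ≠ 0) (he : (𝔅 p).pt (axis b t) = (𝔅 p').pt (axis b' s)) : b = b' := by
  subst h
  have := (𝔅 p).pt_inj (FoldBox.axis_mem_box h1 h2) (FoldBox.axis_mem_box h3 h4) he
  cases b <;> cases b' <;> simp only [axis, Prod.mk.injEq] at this ⊢
  · exact (h0 this.1).elim
  · exact (h0 (by linarith [this.2.1])).elim

omit [IsManifold 𝓘(ℝ, E3) 1 M] in
lemma FoldBox.nonempty_top {p : M} (B : FoldBox o F P p) : B.top.Nonempty :=
  ⟨_, mem_graph (x := 0) (y := B.r / 2) (by linarith [B.r_pos]) B.r_pos (by linarith [B.r_pos])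
    (by linarith [B.r_pos])⟩

omit [IsManifold 𝓘(ℝ, E3) 1 M] in
lemma FoldBox.nonempty_bot {p : M} (B : FoldBox o F P p) : B.bot.Nonempty :=
  ⟨_, mem_graph (k := -B.g) (x := B.r / 2) (y := 0) (by linarith [B.r_pos])
    (by linarith [B.r_pos]) (by linarith [B.r_pos]) B.r_pos⟩

/-- At a vertex the drop is the weight of the bottom or of the top sheet, according to the axis;
elsewhere there is none. This is where the weights being nonnegative meets all vertices being of
`ℓ`-type. -/
lemma cuspGap_le (hP : IsFlowSpine o F P) (hpos : IsPositiveSpine o F P)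
    (ha : IsBalanced o F P a) (ha0 : ∀ R, 0 ≤ a R) (g : M × Bool) :
    cuspGap a 𝔅 1 g ≤ cuspGap a 𝔅 (-1) g := by
  by_cases hv : g.1 ∈ vertexSet o F P
  · obtain ⟨q, β⟩ := g
    set p : singularSet o F P := ⟨q, Or.inr hv⟩
    have hr := (𝔅 p).r_pos
    have h1 : (p : M) ∈ vertexSet o F P := hv
    obtain ⟨x, hx⟩ := (𝔅 p).nonempty_bot
    obtain ⟨y, hy⟩ := (𝔅 p).nonempty_top
    have h2 := FoldBox.weightGap_sub hP hpos ha (((𝔅 p).hasG_iff hP hpos).2 h1)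
      (by linarith : 0 < (𝔅 p).r / 2) (by linarith) hx hy
    change cuspGap a 𝔅 1 ((p : M), β) ≤ cuspGap a 𝔅 (-1) ((p : M), β)
    rw [cuspGap_of_mem h1, cuspGap_of_mem h1, one_mul, neg_one_mul]
    cases β
    · linarith [ha0 (comp o F P x)]
    · linarith [ha0 (comp o F P y)]
  · rw [cuspGap_of_notMem hv, cuspGap_of_notMem hv]

end Cusps

/-- Following the edges in their direction, the weight gap never increases. As one returns to
where one started, it is constant, so that the sheets which separate at a vertex have weight
zero. -/
theorem IsBalanced.vanishesAtVertices [T2Space M] (hP : IsFlowSpine o F P)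
    (hpos : IsPositiveSpine o F P) (ha : IsBalanced o F P a) (ha0 : ∀ R, 0 ≤ a R) :
    VanishesAtVertices o F P a := by
  classical
  intro v B hG q hq
  have hvV := (B.hasG_iff hP hpos).1 hG
  -- One box is chosen at each singular point, and at `v` it has to be the given box `B`, whose top
  -- and bottom sheets are in question.
  have hex : ∀ p : singularSet o F P, ∃ B' : FoldBox o F P (p : M),
      ∀ h : (p : M) = v, B' = h ▸ B := by
    rintro ⟨p, hp⟩
    by_cases h : p = v
    · subst h
      exact ⟨B, fun _ => rfl⟩
    · obtain ⟨B', -⟩ := exists_foldBox hP hpos (singularSet_subset hP hpos hp) univ_mem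
      exact ⟨B', fun h' => (h h').elim⟩
  choose 𝔅 h𝔅 using hex
  have hvB : 𝔅 ⟨v, Or.inr hvV⟩ = B := h𝔅 ⟨v, Or.inr hvV⟩ rfl
  obtain ⟨K, hK⟩ := exists_finset_arcs hP hpos 𝔅
  set E := arcMarks 𝔅 K
  have hE : vertexSet o F P ⊆ E := vertexSet_subset_arcMarks hP hpos hK
  have hV : ∀ {p b t}, t < (𝔅 p).r → -(𝔅 p).r < t → (𝔅 p).pt (axis b t) ∈ vertexSet o F P →
      t = 0 ∧ (𝔅 p).pt (axis b t) = p := fun h1 h2 h3 =>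
    ⟨(FoldBox.eq_of_mem_vertexSet hP hpos h1 h2 h3).1,
      (FoldBox.eq_of_mem_vertexSet hP hpos h1 h2 h3).2.2⟩
  -- These are the passages through marked points: two at a vertex, one for each axis, and one at
  -- any other point, where the second component is fixed to be `false`.
  let G := {g : M × Bool // g.1 ∈ E ∧ (g.2 = true → g.1 ∈ vertexSet o F P)}
  have : Finite E := finite_arcMarks 𝔅 K
  have : Finite G := Finite.of_injective (β := E × Bool) (fun g => (⟨g.1.1, g.2.1⟩, g.1.2))
    fun g g' h => by
      simp only [Prod.mk.injEq, Subtype.mk.injEq] at h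
      exact Subtype.ext (Prod.ext h.1 h.2)
  have := Fintype.ofFinite G
  choose pS bS t0 t1 σ hst hty using fun g : G => exists_isSegment hP hpos hK g.2.1 g.1.2
  let endPt : G → M := fun g => (𝔅 (pS g)).pt (axis (bS g) (t1 g))
  -- Follow the edge to the next marked point and continue there on the same axis, that is, straight
  -- through a vertex.
  let next : G → G := fun g => ⟨(endPt g, if endPt g ∈ vertexSet o F P then bS g else false),
    (σ g).right, fun h => by by_contra h'; simp [h'] at h⟩
  have hout : ∀ g : G, cuspGap a 𝔅 1 g.1 = cuspGap a 𝔅 (-1) (next g).1 := by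
    intro g
    obtain ⟨m, hm⟩ := exists_between (σ g).lt
    have h1 := cuspGap_left (a := a) hP hpos hE (σ g) (β := g.1.2)
      (fun h => hty g (by rwa [hst g] at h)) hm
    have h2 := cuspGap_right (a := a) hP hpos hE (σ g)
      (β := if endPt g ∈ vertexSet o F P then bS g else false) (fun h => (if_pos h).symm) hm
    rw [hst g] at h1
    exact h1.trans h2.symm
  have hinj : Function.Injective next := by
    intro g g' h
    have h1 : endPt g = endPt g' := congrArg (fun g : G => g.1.1) h
    have h2 : (if endPt g ∈ vertexSet o F P then bS g else false) =
        if endPt g' ∈ vertexSet o F P then bS g' else false := congrArg (fun g : G => g.1.2) h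
    have hg := σ g
    have hg' := σ g'
    have hmeet : ∃ t ∈ Ioo (t0 g) (t1 g), ∃ s ∈ Ioo (t0 g') (t1 g'),
        (𝔅 (pS g)).pt (axis (bS g) t) = (𝔅 (pS g')).pt (axis (bS g') s) := by
      by_cases hv : endPt g ∈ vertexSet o F P
      · have hv' := hv
        rw [h1] at hv'
        rw [if_pos hv, if_pos hv'] at h2
        obtain ⟨e1, e2⟩ := hV hg.lt_r (hg.gt.trans hg.lt) hv
        obtain ⟨e3, e4⟩ := hV hg'.lt_r (hg'.gt.trans hg'.lt) hv'
        have e5 : pS g = pS g' := Subtype.ext (e2.symm.trans (h1.trans e4))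
        -- Both segments end at parameter zero on the same axis of the same box, so they share all
        -- parameters slightly below zero.
        obtain ⟨m, hm0, hm1⟩ := exists_between (max_lt (hg.lt.trans_eq e1) (hg'.lt.trans_eq e3))
        refine ⟨m, ⟨(le_max_left _ _).trans_lt hm0, by rwa [e1]⟩, m,
          ⟨(le_max_right _ _).trans_lt hm0, by rwa [e3]⟩, ?_⟩
        rw [e5, h2]
      · have hv' := hv
        rw [h1] at hv'
        exact FoldBox.IsSegment.meet_of_right_eq hP hpos hg hg'
          (FoldBox.isArc_of_notMem hP hpos hg.hasF hg.hasG hg.lt_r (hg.gt.trans hg.lt) hv)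
          (FoldBox.isArc_of_notMem hP hpos hg'.hasF hg'.hasG hg'.lt_r (hg'.gt.trans hg'.lt) hv')
          h1
    have h3 := FoldBox.IsSegment.left_eq hP hpos hE hg hg' hmeet
    have h4 : g.1.1 = g'.1.1 := by rw [← hst g, ← hst g', h3]
    refine Subtype.ext (Prod.ext h4 ?_)
    by_cases hv : g.1.1 ∈ vertexSet o F P
    · have hv' := hv
      rw [h4] at hv'
      rw [← hty g hv, ← hty g' hv']
      obtain ⟨t, ht, s, hs, he⟩ := hmeet
      rw [← hst g] at hv
      rw [← hst g'] at hv'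
      obtain ⟨e1, e2⟩ := hV (hg.lt.trans hg.lt_r) hg.gt hv
      obtain ⟨e3, e4⟩ := hV (hg'.lt.trans hg'.lt_r) hg'.gt hv'
      have e5 : pS g = pS g' := Subtype.ext (e2.symm.trans (h3.trans e4))
      -- If they start at a vertex, their common interior point lies on a single axis there, so the
      -- passages agree in the second component as well.
      exact axis_type_eq e5 (ht.2.trans hg.lt_r) (hg.gt.trans ht.1) (hs.2.trans hg'.lt_r)
        (hg'.gt.trans hs.1) (e1 ▸ ht.1).ne' he
    · have hv' := hv
      rw [h4] at hv'
      have k1 : g.1.2 = false := by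
        by_contra k
        exact hv (g.2.2 (by simpa using k))
      have k2 : g'.1.2 = false := by
        by_contra k
        exact hv' (g'.2.2 (by simpa using k))
      rw [k1, k2]
  -- The gap after a passage equals the gap before the next one, and `next` is a permutation of a
  -- finite set. So the two sums agree.
  have hsum : ∑ g : G, (cuspGap a 𝔅 (-1) g.1 - cuspGap a 𝔅 1 g.1) = 0 := by
    rw [Finset.sum_sub_distrib, sub_eq_zero, Finset.sum_congr rfl fun g _ => hout g]
    exact ((Finite.injective_iff_bijective.1 hinj).sum_comp
      fun g : G => cuspGap a 𝔅 (-1) g.1).symm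
  have hzero : ∀ g : G, cuspGap a 𝔅 (-1) g.1 - cuspGap a 𝔅 1 g.1 = 0 := fun g =>
    (Finset.sum_eq_zero_iff_of_nonneg
      fun g _ => sub_nonneg.2 (cuspGap_le hP hpos ha ha0 g.1)).1 hsum g (Finset.mem_univ g)
  have hr := B.r_pos
  have hgap : ∀ b, weightGap o F P a (B.pt (axis b (-(B.r / 2)))) -
      weightGap o F P a (B.pt (axis b (B.r / 2))) = 0 := by
    intro b
    have h1 := hzero ⟨(v, b), hE hvV, fun _ => hvV⟩
    have h2 : ((⟨v, Or.inr hvV⟩ : singularSet o F P) : M) ∈ vertexSet o F P := hvV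
    have h3 : ∀ c, cuspGap a 𝔅 c (v, b) =
        weightGap o F P a (B.pt (axis b (c * (B.r / 2)))) := by
      intro c
      rw [← hvB]
      exact cuspGap_of_mem (b := b) h2
    rw [h3, h3, neg_one_mul, one_mul] at h1
    exact h1
  obtain ⟨x, hx⟩ := B.nonempty_bot
  obtain ⟨y, hy⟩ := B.nonempty_top
  rcases hq with hq | hq
  · rw [← (FoldBox.weightGap_sub hP hpos ha hG (by linarith : 0 < B.r / 2) (by linarith) hx hq).2,
      hgap]
  · rw [← (FoldBox.weightGap_sub hP hpos ha hG (by linarith : 0 < B.r / 2) (by linarith) hq hy).1,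
      hgap]

end FlowSpine

namespace FlowSpine

open Set Filter Topology

/-- Gordan's alternative. -/
lemma exists_forall_sum_pos {ι κ : Type*} [Fintype ι] [Fintype κ] (N : ι → κ → ℝ)
    (h : ∀ a : ι → ℝ, (∀ i, 0 ≤ a i) → (∀ e, ∑ i, a i * N i e = 0) → ∀ i, a i = 0) :
    ∃ x : κ → ℝ, ∀ i, 0 < ∑ e, N i e * x e := by
  classical
  let T : (ι → ℝ) →ₗ[ℝ] (κ → ℝ) := Fintype.linearCombination ℝ N
  have hT : ∀ a e, T a e = ∑ i, a i * N i e := by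
    intro a e
    simp [T, Fintype.linearCombination_apply]
  have hTc : Continuous T := T.continuous_of_finiteDimensional
  -- A nonnegative relation is zero by hypothesis, so it cannot have coordinate sum 1.
  have h0 : (0 : κ → ℝ) ∉ T '' stdSimplex ℝ ι := by
    rintro ⟨a, ⟨ha0, ha1⟩, ha⟩
    have h1 := h a ha0 fun e => by rw [← hT, ha, Pi.zero_apply]
    simp [h1] at ha1
  obtain ⟨f, u, hf0, hf⟩ := geometric_hahn_banach_point_closed
    ((convex_stdSimplex ℝ ι).linear_image T) ((isCompact_stdSimplex ℝ ι).image hTc).isClosed h0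
  rw [map_zero] at hf0
  -- The functional that separates the image of the simplex from zero is given by the numbers
  -- sought. Each vertex of the simplex yields one of the inequalities.
  refine ⟨fun e => f (Pi.single e 1), fun i => hf0.trans ?_⟩
  have h1 := hf _ ⟨_, single_mem_stdSimplex ℝ i, rfl⟩
  have h2 : T (Pi.single i 1) = N i := by
    ext e
    rw [hT]
    simp [Pi.single_apply]
  rw [h2] at h1
  refine h1.trans_eq ((LinearMap.pi_apply_eq_sum_univ f.toLinearMap (N i)).trans
    (Finset.sum_congr rfl fun e _ => ?_))
  have h3 : (fun j => if e = j then (1 : ℝ) else 0) = Pi.single e 1 := by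
    ext j
    simp [Pi.single_apply, eq_comm]
  rw [h3, smul_eq_mul]
  rfl

variable {M : Type*} [TopologicalSpace M] [ChartedSpace E3 M] [IsManifold 𝓘(ℝ, E3) 1 M]
variable {o : Orientation3 M} {F : Flow ℝ M} {P : Set M} {a : Set M → ℝ}

/-! ### Admissibility -/

/-- There are no nontrivial balanced weights. -/
theorem IsBalanced.eq_zero [CompactSpace M] [T2Space M] (hP : IsFlowSpine o F P)
    (hpos : IsPositiveSpine o F P) (ha : IsBalanced o F P a) (ha0 : ∀ R, 0 ≤ a R) {q : M}
    (hq : q ∈ regular o F P) : a (comp o F P q) = 0 := by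
  have hv := ha.vanishesAtVertices hP hpos ha0
  obtain ⟨p, hp, s, hs⟩ := exists_reg_eq_comp hP hpos (isPreconnected_spine hP hpos) hq
  obtain ⟨v, hvV⟩ := hpos.1
  obtain ⟨B, -⟩ := exists_foldBox hP hpos (singularSet_subset hP hpos (Or.inr hvV)) univ_mem
  have hG := (B.hasG_iff hP hpos).2 hvV
  have hr := B.r_pos
  obtain ⟨x, hx⟩ := B.nonempty_bot
  obtain ⟨y, hy⟩ := B.nonempty_top
  -- Any edge has the same pair of weights as the edges at a vertex: the upper one is read off on
  -- the first axis, where the upper sheet is the top sheet, and below the lower one on the second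
  -- axis, where the lower sheet is the bottom sheet.
  have hu : a (reg o F P .upper p) = 0 := by
    rw [(reg_weight_eq hP hpos ha hv hp (FoldBox.pt_x_mem hP hpos hG.hasF (x := B.r / 2)
      (by linarith) (by linarith) (Or.inl (by linarith)))).1,
      FoldBox.reg_x_upper hP hpos hG.hasF (by linarith) (by linarith) (Or.inl (by linarith)) hy]
    exact hv v B hG y (Or.inl hy)
  have hl : a (reg o F P .lower p) = 0 := by
    rw [(reg_weight_eq hP hpos ha hv hp (FoldBox.pt_y_mem hP hpos hG (y := B.r / 2)
      (by linarith) (by linarith) (by linarith))).2,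
      FoldBox.reg_y_lower hP hpos hG (by linarith) (by linarith) (by linarith) hx]
    exact hv v B hG x (Or.inr hx)
  rw [← hs]
  cases s
  · exact hu
  · exact hl
  · rw [← ha p hp, hu, hl, add_zero]

/-- Finitely many arcs cover the singular set, and within its box each edge point can be moved to a
point at distance `r / 2` from the centre without meeting a vertex. -/
lemma finite_edge [T2Space M] (hP : IsFlowSpine o F P) (hpos : IsPositiveSpine o F P) :
    Finite (Edge o F P) := by
  choose 𝔅 _ using fun p : singularSet o F P =>
    exists_foldBox hP hpos (singularSet_subset hP hpos p.2) univ_mem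
  obtain ⟨K, hK⟩ := exists_finset_arcs hP hpos 𝔅
  have hfin : (Set.range fun k : K × Bool × Bool => connectedComponentIn
      (singularSet o F P \ vertexSet o F P) ((𝔅 k.1).pt (axis k.2.1
        (if k.2.2 then (𝔅 k.1).r / 2 else -((𝔅 k.1).r / 2))))).Finite := Set.finite_range _
  refine Set.Finite.subset (s := Set.range _) hfin ?_
  rintro C ⟨q, hq, rfl⟩
  obtain ⟨p, hp, b, t, hb, h1, h2, rfl⟩ := hK q hq.1
  have hr := (𝔅 p).r_pos
  have hF := ((𝔅 p).hasF_iff hP hpos).2 p.2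
  have key : ∀ J : Set ℝ, IsPreconnected J → t ∈ J → (∀ s ∈ J, (𝔅 p).IsArc b s) → ∀ s ∈ J,
      connectedComponentIn (singularSet o F P \ vertexSet o F P) ((𝔅 p).pt (axis b s)) =
        connectedComponentIn (singularSet o F P \ vertexSet o F P) ((𝔅 p).pt (axis b t)) := by
    intro J hJ ht hJa s hs
    refine connectedComponentIn_eq (IsPreconnected.subset_connectedComponentIn
      (hJ.image (fun s => (𝔅 p).pt (axis b s)) fun s hs =>
        (FoldBox.continuousAt_arc (hJa s hs).lt (hJa s hs).gt).continuousWithinAt)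
      ⟨s, hs, rfl⟩ ?_ ⟨t, ht, rfl⟩)
    rintro _ ⟨s, hs, rfl⟩
    exact (hJa s hs).pt_mem hP hpos
  have harc := FoldBox.isArc_of_notMem hP hpos hF hb (by linarith) (by linarith) hq.2
  by_cases hG : (𝔅 p).HasG
  · rcases lt_or_gt_of_ne (harc.ne.resolve_right (not_not.2 hG)) with ht | ht
    · refine ⟨(⟨p, hp⟩, b, false), key (Ioo (-(𝔅 p).r) 0) isPreconnected_Ioo
        ⟨by linarith, ht⟩ (fun s hs => ⟨hF, hb, by linarith [hs.2], hs.1, Or.inl hs.2.ne⟩) _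
        ⟨?_, ?_⟩⟩ <;> simp only [Bool.false_eq_true, if_false] <;> linarith
    · refine ⟨(⟨p, hp⟩, b, true), key (Ioo 0 (𝔅 p).r) isPreconnected_Ioo
        ⟨ht, by linarith⟩ (fun s hs => ⟨hF, hb, hs.2, by linarith [hs.1], Or.inl hs.1.ne'⟩) _
        ⟨?_, ?_⟩⟩ <;> simp only [if_true] <;> linarith
  · refine ⟨(⟨p, hp⟩, b, true), key (Ioo (-(𝔅 p).r) (𝔅 p).r) isPreconnected_Ioo
      ⟨by linarith, by linarith⟩ (fun s hs => ⟨hF, hb, hs.2, hs.1, Or.inr hG⟩) _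
      ⟨?_, ?_⟩⟩ <;> simp only [if_true] <;> linarith

/-- The edge through a point. -/
def edgeOf {p : M} (hp : p ∈ singularSet o F P \ vertexSet o F P) : Edge o F P :=
  ⟨_, p, hp, rfl⟩

/-- The region which contains a sheet. -/
lemma exists_region (hP : IsFlowSpine o F P) (hpos : IsPositiveSpine o F P) {p : M}
    (hp : p ∈ singularSet o F P \ vertexSet o F P) (s : Sheet) :
    ∃ R : Region o F P, R.1 = reg o F P s p := by
  obtain ⟨q, hq, h⟩ := exists_reg_eq hP hpos hp s
  exact ⟨⟨_, q, hq, rfl⟩, h.symm⟩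

/-- Every region is one of the three regions along one of the finitely many edges. -/
lemma finite_region [CompactSpace M] [T2Space M] (hP : IsFlowSpine o F P)
    (hpos : IsPositiveSpine o F P) : Finite (Region o F P) := by
  have := finite_edge hP hpos
  have hex : ∀ e : Edge o F P, ∃ p ∈ singularSet o F P \ vertexSet o F P, p ∈ e.1 := by
    rintro ⟨_, p, hp, rfl⟩
    exact ⟨p, hp, mem_connectedComponentIn hp⟩
  choose pt hpt hpte using hex
  have hfin : (Set.range fun k : Edge o F P × Sheet => reg o F P k.2 (pt k.1)).Finite :=
    Set.finite_range _
  refine Set.Finite.subset (s := Set.range _) hfin ?_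
  rintro C ⟨q, hq, rfl⟩
  obtain ⟨p, hp, s, hs⟩ := exists_reg_eq_comp hP hpos (isPreconnected_spine hP hpos) hq
  refine ⟨(edgeOf hp, s), ?_⟩
  change reg o F P s (pt (edgeOf hp)) = comp o F P q
  rw [← hs]
  exact reg_eq_of_isPreconnected hP hpos isPreconnected_connectedComponentIn
    (connectedComponentIn_subset _ _) (hpte (edgeOf hp)) (mem_connectedComponentIn hp) s

lemma sum_sheet (f : Sheet → ℝ) : ∑ s, f s = f .upper + f .lower + f .single := by
  change ∑ s ∈ {Sheet.upper, Sheet.lower, Sheet.single}, f s = _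
  rw [Finset.sum_insert (by decide), Finset.sum_pair (by decide), add_assoc]

/-- The matrix of Gordan's alternative sums over sheets, so that a region which borders an edge
several times is counted with multiplicity. The relations dual to it are the balance equations, up
to the sign `η` of each edge, which does not affect their vanishing. -/
theorem isAdmissible [CompactSpace M] [T2Space M] (hP : IsFlowSpine o F P)
    (hpos : IsPositiveSpine o F P) : IsAdmissible o F P := by
  classical
  intro η
  have := finite_edge hP hpos
  have := finite_region hP hpos
  have := Fintype.ofFinite (Edge o F P)
  have := Fintype.ofFinite (Region o F P)
  obtain ⟨x, hx⟩ := exists_forall_sum_pos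
    (fun (R : Region o F P) (e : Edge o F P) =>
      ∑ s : Sheet, if LiesIn o F P s e R then ((η e : ℤ) : ℝ) * s.sign else 0) (by
    intro w hw0 hw
    -- Weights are turned into a function on all subsets of `M`; the value 0 off the regions is
    -- never needed, except to be nonnegative.
    let a : Set M → ℝ := fun C =>
      if h : ∃ p ∈ P \ singularSet o F P, C = connectedComponentIn (P \ singularSet o F P) p
        then w ⟨C, h⟩ else 0
    have ha : ∀ R : Region o F P, a R.1 = w R := fun R => dif_pos R.2
    have ha0 : ∀ C, 0 ≤ a C := by
      intro C
      simp only [a]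
      split_ifs
      · exact hw0 _
      · exact le_rfl
    have hbal : IsBalanced o F P a := by
      intro p hp
      have h1 := hw (edgeOf hp)
      have h2 : ∀ s : Sheet, ∑ R : Region o F P, w R * (if LiesIn o F P s (edgeOf hp) R then
          ((η (edgeOf hp) : ℤ) : ℝ) * s.sign else 0) =
          ((η (edgeOf hp) : ℤ) : ℝ) * (s.sign * a (reg o F P s p)) := by
        intro s
        obtain ⟨R, hR⟩ := exists_region hP hpos hp s
        have h3 : ∀ R', LiesIn o F P s (edgeOf hp) R' ↔ R' = R := fun R' =>
          (liesIn_iff hP hpos (mem_connectedComponentIn hp)).trans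
            ⟨fun h => Subtype.ext (h.trans hR.symm), fun h => h ▸ hR⟩
        simp only [h3, mul_ite, mul_zero, Finset.sum_ite_eq', Finset.mem_univ, if_true]
        rw [← hR, ha]
        ring
      simp only [Finset.mul_sum] at h1
      rw [Finset.sum_comm, Finset.sum_congr rfl fun s _ => h2 s, ← Finset.mul_sum, sum_sheet] at h1
      have h4 : ((η (edgeOf hp) : ℤ) : ℝ) ≠ 0 := by
        rcases Int.units_eq_one_or (η (edgeOf hp)) with h | h <;> simp [h]
      have h5 := (mul_eq_zero.1 h1).resolve_left h4
      simp only [Sheet.sign] at h5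
      linarith
    intro R
    obtain ⟨q, hq, hR⟩ := R.2
    rw [← ha, hR]
    exact hbal.eq_zero hP hpos ha0 hq)
  refine ⟨x, fun R => ?_⟩
  rw [boundarySum, finsum_eq_sum_of_fintype]
  refine (hx R).trans_eq (Finset.sum_congr rfl fun e _ => ?_)
  rw [Finset.sum_mul]
  refine Finset.sum_congr rfl fun s _ => ?_
  rw [ite_mul, zero_mul]

end FlowSpine

theorem proposition4 {M : Type*} [TopologicalSpace M] [ChartedSpace FlowSpine.E3 M]
    [IsManifold 𝓘(ℝ, FlowSpine.E3) 1 M] [T2Space M] [CompactSpace M] [ConnectedSpace M]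
    (o : FlowSpine.Orientation3 M) (F : Flow ℝ M) (P : Set M)
    (hP : FlowSpine.IsFlowSpine o F P) (hpos : FlowSpine.IsPositiveSpine o F P) :
    FlowSpine.IsAdmissible o F P :=
  FlowSpine.isAdmissible hP hpos
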